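/- Let $\mathcal L=[0,\widehat L]$ with $0<\widehat L<\infty$, let $\theta\in\{0,1\}$ be a binary state with prior $\mu_0=\Pr(\theta=1)\in(0,1)$, and let $u(\theta,\cdot),v(\theta,\cdot)$ be continuous payoffs on $\mathcal L$ of an agent and a principal. Let $\phi:\mathcal L\to\mathbb R\cup\{+\infty\}$ be a lower semicontinuous mechanism, not identically $+\infty$, and put $U^\phi(\mu,l)=\mu u(1,l)+(1-\mu)u(0,l)-\phi(l)$, $V^\phi(\mu,l)=\mu v(1,l)+(1-\mu)v(0,l)+\phi(l)$ and $\widehat l_f(\mu)=\sup\operatorname{argmax}_{l\in\mathcal L}f(\mu,l)$. Assume that $U^\phi(\mu,\cdot)$ and $V^\phi(\mu,\cdot)$ are (weakly) single-peaked for every $\mu\in[0,1]$ and that $\widehat l_{U^\phi}$ is continuous and nondecreasing on $[0,1]$. A learning process is a càdlàg martingale $(\mu_l)_{l\in\mathcal L}$ with values in $[0,1]$ and mean $\mu_0$. Given a learning process, the agent chooses a stopping level $l^*$ of its (right-continuous) natural filtration that maximizes $\mathbb E[U^\phi(\mu_{l},l)]$, breaking indifference in favor of the latest one. A worst-case learning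 process minimizes $\mathbb E[V^\phi(\mu_{l^*},l^*)]$ over all learning processes. Let $\mathcal G$ be the set of nondecreasing right-continuous $G:\mathcal L\to[0,1-\mu_0]$ with $G(\widehat L)=1-\mu_0$, regarded as distribution functions with an atom of mass $G(0)$ at $0$. For $G\in\mathcal G$, the bad news process $\boldsymbol\mu^G$ is the learning process with $\mu^G_l\in\{0,\lambda^G(l)\}$ almost surely for each $l$, where $\lambda^G(l)=\mu_0/(1-G(l))$; thus $G(l)$ is the probability that bad news has arrived by $l$. Suppose that the principal prefers earlier stopping under $\phi$: $\widehat l_{V^\phi}(\mu)\le\widehat l_{U^\phi}(\mu)$ for all $\mu\in[0,1]$. Then: (1) There is $G\in\mathcal G$ such that the bad news process $\boldsymbol\mu^G$ is a worst-case learning process. (2) If moreover $\phi$ is finite on $(0,\widehat L)$, $U^\phi(0,\cdot)$ and $V^\phi(0,\cdot)$ are differentiable there with $\partial_lU^\phi(0,l)\neq0$, and $\left|\partial_lV^\phi(0,l)/\partial_lU^\phi(0,l)\right|$ is nondecreasing in $l\in(0,\widehat L)$, then, with $T:=\widehat l_{U^\phi}(1)$ (so $T=\widehat L$ whenever $U^\phi(1,\cdot)$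 is nondecreasing), there are $G\in\mathcal G$ and $\underline L\in[0,T]$ such that the bad news process $\boldsymbol\mu^G$ is a worst-case learning process, $G(T)=1-\mu_0$, the part of $\operatorname{supp}G$ below $T$ is $[\underline L,T)$, and for each $l\in[\underline L,T)$ $$U^\phi(\lambda^G(l),l)=\sup_{\tau\ge l}\mathbb E\left[U^\phi(\mu^G_\tau,\tau)\,\middle|\,\mu^G_l\ne0\right],$$ the supremum being over stopping levels $\tau\ge l$. This supremum is also attained by the agent's choice $l^*$, which satisfies $l^*>l$ almost surely on $\{\mu^G_l\neq0\}$: in the absence of bad news the agent is exactly indifferent between stopping and continuing. -/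

import Mathlib

open MeasureTheory ProbabilityTheory Set Filter Topology

universe w₁ w₂

noncomputable section

namespace TechReg

universe w

/-! ### Payoffs and mechanisms -/

/-- R&D levels: the compact interval `[0, L]`. -/
abbrev Level (L : ℝ) : Type := Set.Icc (0 : ℝ) L

/-- Indirect utility at belief `m = Pr(θ = 1)`: the expectation of `f θ l` over the state `θ`. -/
def indirect (f : Fin 2 → ℝ → ℝ) (m l : ℝ) : ℝ :=
  m * f 1 l + (1 - m) * f 0 l

/-- A mechanism on `[0, L]`: a lower semicontinuous transfer from the agent to the principal. The
value `⊤` (stopping there is prohibited) is allowed, though not at every level; the value `⊥`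
(an infinite subsidy) is not, since it makes the agent's problem ill-posed. -/
structure IsMechanism (L : ℝ) (φ : ℝ → EReal) : Prop where
  lsc : LowerSemicontinuousOn φ (Icc 0 L)
  ne_bot : ∀ l ∈ Icc 0 L, φ l ≠ ⊥
  proper : ∃ l ∈ Icc 0 L, φ l ≠ ⊤

/-- The agent's payoff `U^φ(m, l) = U(m, l) - φ(l)`, possibly infinite. -/
def agentE (u : Fin 2 → ℝ → ℝ) (φ : ℝ → EReal) (m l : ℝ) : EReal :=
  ((indirect u m l : ℝ) : EReal) - φ l

/-- The principal's payoff `V^φ(m, l) = V(m, l) + φ(l)`, possibly infinite. -/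
def principalE (v : Fin 2 → ℝ → ℝ) (φ : ℝ → EReal) (m l : ℝ) : EReal :=
  ((indirect v m l : ℝ) : EReal) + φ l

/-- The real number `U^φ(m, l)`; only used at levels where `φ` is finite. -/
def agentR (u : Fin 2 → ℝ → ℝ) (φ : ℝ → EReal) (m l : ℝ) : ℝ :=
  indirect u m l - (φ l).toReal

/-- The real number `V^φ(m, l)`; only used at levels where `φ` is finite. -/
def principalR (v : Fin 2 → ℝ → ℝ) (φ : ℝ → EReal) (m l : ℝ) : ℝ :=
  indirect v m l + (φ l).toReal

/-- Single-peakedness on `[0, L]` (in the weak sense: plateaus are allowed). -/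
def SinglePeaked (L : ℝ) (f : ℝ → EReal) : Prop :=
  ∃ p ∈ Icc 0 L, MonotoneOn f (Icc 0 p) ∧ AntitoneOn f (Icc p L)

/-- The one-shot choice: the supremum of the set of maximizers of `f` on `[0, L]`. -/
def oneShot (L : ℝ) (f : ℝ → EReal) : ℝ :=
  sSup {l | l ∈ Icc 0 L ∧ IsMaxOn f (Icc 0 L) l}

/-- The principal prefers earlier stopping: at each belief the principal's one-shot level is at most
the agent's. -/
def PrefersEarlierStopping (L : ℝ) (u v : Fin 2 → ℝ → ℝ) (φ : ℝ → EReal) : Prop :=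
  ∀ m ∈ Icc (0 : ℝ) 1, oneShot L (principalE v φ m) ≤ oneShot L (agentE u φ m)

/-- The marginal payoffs of both parties in state `0` exist, the agent's does not vanish, and
the absolute value of their ratio is (weakly) increasing in the level. -/
structure IncreasingMarginalRatio (L : ℝ) (u v : Fin 2 → ℝ → ℝ) (φ : ℝ → EReal) : Prop where
  finite : ∀ l ∈ Ioo 0 L, φ l ≠ ⊤
  diff_agent : ∀ l ∈ Ioo 0 L, DifferentiableAt ℝ (agentR u φ 0) l
  diff_principal : ∀ l ∈ Ioo 0 L, DifferentiableAt ℝ (principalR v φ 0) l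
  deriv_ne_zero : ∀ l ∈ Ioo 0 L, deriv (agentR u φ 0) l ≠ 0
  increasing : MonotoneOn
    (fun l => |deriv (principalR v φ 0) l / deriv (agentR u φ 0) l|) (Ioo 0 L)

/-! ### Learning processes and the agent's problem -/

/-- A learning process on a measurable space `Ω`: a probability measure and a càdlàg martingale of
beliefs with values in `[0, 1]`, indexed by levels, with mean the prior `μ₀`; the martingale
property refers to the natural filtration of the beliefs. -/
structure LearningProcess (L μ₀ : ℝ) (Ω : Type w) [MeasurableSpace Ω] where
  P : Measure Ω
  isProb : IsProbabilityMeasure P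
  belief : Level L → Ω → ℝ
  meas : ∀ l, StronglyMeasurable (belief l)
  mem_Icc : ∀ l ω, belief l ω ∈ Icc (0 : ℝ) 1
  right_cont : ∀ ω l, ContinuousWithinAt (fun s => belief s ω) (Ici l) l
  left_lim : ∀ ω l, ∃ x, Tendsto (fun s => belief s ω) (𝓝[<] l) (𝓝 x)
  martingale : Martingale belief (Filtration.natural belief meas) P
  prior : ∀ l, ∫ ω, belief l ω ∂P = μ₀

variable {L μ₀ : ℝ} {Ω : Type w} [MeasurableSpace Ω]

/-- The agent's information: the (right-continuous version of the) natural filtration of the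
belief process. -/
def LearningProcess.info (M : LearningProcess L μ₀ Ω) :
    Filtration (Level L) (inferInstance : MeasurableSpace Ω) :=
  (Filtration.natural M.belief M.meas).rightCont

/-- Admissible stopping levels: stopping times of the agent's information, with an expected transfer
that is finite (otherwise the agent's expected payoff is `-∞`). -/
structure IsStoppingLevel (φ : ℝ → EReal) (M : LearningProcess L μ₀ Ω) (τ : Ω → Level L) :
    Prop where
  stopping : IsStoppingTime M.info (fun ω => (τ ω : WithTop (Level L)))
  finite : ∀ᵐ ω ∂M.P, φ (τ ω) ≠ ⊤
  integrable : Integrable (fun ω => (φ (τ ω)).toReal) M.P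

/-- The agent's ex ante payoff `E[U^φ(μ_τ, τ)]` from an admissible stopping level. -/
def agentValue (u : Fin 2 → ℝ → ℝ) (φ : ℝ → EReal) (M : LearningProcess L μ₀ Ω)
    (τ : Ω → Level L) : ℝ :=
  ∫ ω, agentR u φ (M.belief (τ ω) ω) (τ ω) ∂M.P

/-- The principal's ex ante payoff `E[V^φ(μ_τ, τ)]` from an admissible stopping level. -/
def principalValue (v : Fin 2 → ℝ → ℝ) (φ : ℝ → EReal) (M : LearningProcess L μ₀ Ω)
    (τ : Ω → Level L) : ℝ :=
  ∫ ω, principalR v φ (M.belief (τ ω) ω) (τ ω) ∂M.P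

/-- `τ` is the agent's choice: it is an optimal stopping level, and the latest one, since
indifferences are broken in favor of more R&D. -/
structure IsAgentChoice (u : Fin 2 → ℝ → ℝ) (φ : ℝ → EReal) (M : LearningProcess L μ₀ Ω)
    (τ : Ω → Level L) : Prop where
  admissible : IsStoppingLevel φ M τ
  optimal : ∀ τ' : Ω → Level L, IsStoppingLevel φ M τ' → agentValue u φ M τ' ≤ agentValue u φ M τ
  latest : ∀ τ' : Ω → Level L, IsStoppingLevel φ M τ' →
    agentValue u φ M τ' = agentValue u φ M τ → ∀ᵐ ω ∂M.P, τ' ω ≤ τ ω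

/-- `M` is a worst-case learning process: among all learning processes (on all probability spaces)
it minimizes the principal's payoff, given the agent's choice of stopping level. -/
def IsWorstCase {L μ₀ : ℝ} {Ω : Type w₁} [MeasurableSpace Ω]
    (u v : Fin 2 → ℝ → ℝ) (φ : ℝ → EReal) (M : LearningProcess L μ₀ Ω) : Prop :=
  ∃ τ : Ω → Level L, IsAgentChoice u φ M τ ∧
    ∀ (Ω' : Type w₂) [MeasurableSpace Ω'] (M' : LearningProcess L μ₀ Ω') (τ' : Ω' → Level L),
      IsAgentChoice u φ M' τ' → principalValue v φ M τ ≤ principalValue v φ M' τ'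

/-! ### Bad news processes -/

/-- The class of functions `G`: nondecreasing, right-continuous (both are part of the type
`StieltjesFunction`), nonnegative on `[0, L]`, with `G(L) = 1 - μ₀`. `G(l)` is the probability
that bad news has arrived by level `l`; `G` is extended to the line by `0` on the left and by a
constant on the right, so that its Stieltjes measure has an atom of mass `G(0)` at `0`. -/
structure IsBadNewsCDF (L μ₀ : ℝ) (G : StieltjesFunction ℝ) : Prop where
  eq_zero : ∀ l < 0, G l = 0
  eq_top : ∀ l, L ≤ l → G l = 1 - μ₀

/-- The belief at level `l` if no bad news has arrived. -/
def noNewsBelief (μ₀ : ℝ) (G : StieltjesFunction ℝ) (l : ℝ) : ℝ := μ₀ / (1 - G l)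

/-- `M` is the bad news process of `G`: at each level the belief is `0` or `noNewsBelief μ₀ G l`.
As the belief has mean `μ₀`, it is then `0` with probability `G l`. -/
def IsBadNews (G : StieltjesFunction ℝ) (M : LearningProcess L μ₀ Ω) : Prop :=
  ∀ l : Level L, ∀ᵐ ω ∂M.P, M.belief l ω = 0 ∨ M.belief l ω = noNewsBelief μ₀ G l

/-- The event that no bad news has arrived by level `l`. -/
def noNews (M : LearningProcess L μ₀ Ω) (l : Level L) : Set Ω := {ω | M.belief l ω ≠ 0}

/-- Expected payoff of the agent from `τ` conditional on no bad news by level `l`. -/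
def condAgentValue (u : Fin 2 → ℝ → ℝ) (φ : ℝ → EReal) (M : LearningProcess L μ₀ Ω)
    (l : Level L) (τ : Ω → Level L) : ℝ :=
  ∫ ω, agentR u φ (M.belief (τ ω) ω) (τ ω) ∂(cond M.P (noNews M l))

/-- At level `l`, in the absence of bad news, the agent is indifferent between stopping and
continuing: stopping attains the supremum over all stopping levels from `l` on, and so does
her choice, which then continues beyond `l`. -/
structure IsIndifferentAt (u : Fin 2 → ℝ → ℝ) (φ : ℝ → EReal) (G : StieltjesFunction ℝ)
    (M : LearningProcess L μ₀ Ω) (l : Level L) : Prop where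
  stop_optimal : IsLUB
    {x : ℝ | ∃ τ : Ω → Level L, IsStoppingLevel φ M τ ∧ (∀ ω, l ≤ τ ω) ∧
      x = condAgentValue u φ M l τ}
    (agentR u φ (noNewsBelief μ₀ G l) l)
  continue_optimal : ∀ τ : Ω → Level L, IsAgentChoice u φ M τ →
    (∀ᵐ ω ∂M.P, ω ∈ noNews M l → l < τ ω) ∧
      condAgentValue u φ M l τ = agentR u φ (noNewsBelief μ₀ G l) l

/-- The bad news process of `G` exists and each version of it is a worst-case process. -/
def IsWorstCaseBadNews (L μ₀ : ℝ) (u v : Fin 2 → ℝ → ℝ) (φ : ℝ → EReal)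
    (G : StieltjesFunction ℝ) : Prop :=
  (∃ (Ω : Type) (_ : MeasurableSpace Ω) (M : LearningProcess L μ₀ Ω), IsBadNews G M) ∧
    ∀ (Ω : Type w₁) [MeasurableSpace Ω] (M : LearningProcess L μ₀ Ω),
      IsBadNews G M → IsWorstCase.{w₁, w₂} u v φ M

end TechReg

end

namespace TechReg

/-! ### One-shot levels of single-peaked functions -/

section OneShot

variable {L : ℝ} {f : ℝ → EReal}

/-! Write p(m) for the agent's one-shot level at belief m, and a, b for the net payoffs of agent and
principal. An agent who breaks ties late never stops before p at her current belief
(`Setting.peak_le_choice`). She goes beyond p(1) only if she is certain of state 0 and indifferent,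
hence never beyond R (`Setting.eq_zero_of_one_lt_choice`).

Take any learning process, and suppose that the agent would stop at level x with belief m, where x ≥
p(m). Instead of letting her stop, leak state 0 gradually: when, without news, a mass z of state 0
and a mass m of state 1 are left, bad news arrives at max(x, p(m/(m+z))). By an envelope argument
this is worth to the agent exactly what stopping at x is worth (`Regular.integral_a_arrival`). The
principal loses, because her payoff falls beyond p at every belief on the way
(`Regular.integral_b_arrival_le`). Pooling these arrivals over all stopping situations gives a law ν
of the arrival of bad news that is `Obedient`, so without news the agent is willing to wait until
p(1), and that is no better for the principal than the original process
(`Regular.exists_obedient_le`, `Setting.exists_obedient_le_principalValue`).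

Conversely, against bad news with an obedient law the agent stops upon the news, except that news at
p(1) sends her on to R, and she stops at p(1) without news (`Setting.isAgentChoice_badNews`). The
principal then gets exactly `badNewsValue`. The worst case is therefore the minimum of
`badNewsValue` over obedient laws. These form a compact set, the value is lower semicontinuous, and
a minimizer exists (`Regular.exists_minimizer`). This is part (1).

For part (2) the candidate is gradual revelation started from the prior at level p(μ₀), under which
all obedience constraints from p(μ₀) on bind (`Regular.exists_gradual`). A constraint bounds the
mean of w(max(l,s)) - w(l) from above, where w is minus the agent's payoff in state 0. If the ratio
of marginal payoffs is nondecreasing, minus the principal's payoff in state 0 is, up to a constant,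
a mixture of exactly these functions (`exists_mixture`, a layer-cake formula). Making all
constraints bind then hurts the principal most (`Regular.badNewsValue_gradual_le`), and binding
constraints are indifference (`Gradual.stop_eq`). -/

lemma bddAbove_argmax : BddAbove {l | l ∈ Icc 0 L ∧ IsMaxOn f (Icc 0 L) l} :=
  ⟨L, fun _ hl => hl.1.2⟩

lemma le_oneShot {l : ℝ} (hl : l ∈ Icc 0 L) (hmax : IsMaxOn f (Icc 0 L) l) :
    l ≤ oneShot L f :=
  le_csSup bddAbove_argmax ⟨hl, hmax⟩

lemma SinglePeaked.exists_isMaxOn (hf : SinglePeaked L f) :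
    ∃ p ∈ Icc 0 L, IsMaxOn f (Icc 0 L) p ∧ MonotoneOn f (Icc 0 p) ∧ AntitoneOn f (Icc p L) := by
  obtain ⟨p, hp, hmono, hanti⟩ := hf
  refine ⟨p, hp, fun l hl => ?_, hmono, hanti⟩
  rcases le_total l p with h | h
  · exact hmono ⟨hl.1, h⟩ ⟨hp.1, le_rfl⟩ h
  · exact hanti ⟨le_rfl, hp.2⟩ ⟨h, hl.2⟩ h

lemma SinglePeaked.oneShot_mem (hf : SinglePeaked L f) : oneShot L f ∈ Icc 0 L := by
  obtain ⟨p, hp, hmax, -, -⟩ := hf.exists_isMaxOn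
  exact ⟨hp.1.trans (le_oneShot hp hmax), csSup_le ⟨p, hp, hmax⟩ fun _ hl => hl.1.2⟩

lemma SinglePeaked.antitoneOn (hf : SinglePeaked L f) : AntitoneOn f (Icc (oneShot L f) L) := by
  obtain ⟨p, hp, hmax, -, hanti⟩ := hf.exists_isMaxOn
  exact hanti.mono (Icc_subset_Icc_left (le_oneShot hp hmax))

/-- A peak `p` witnessing single-peakedness may precede the latest maximizer. Between the two,
values are at most the maximum because it is attained at `oneShot L f`, and at least that because
`f` is antitone after `p`. -/
lemma SinglePeaked.monotoneOn (hf : SinglePeaked L f)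
    (hmax : IsMaxOn f (Icc 0 L) (oneShot L f)) : MonotoneOn f (Icc 0 (oneShot L f)) := by
  obtain ⟨p, hp, hpmax, hmono, hanti⟩ := hf.exists_isMaxOn
  have hm := hf.oneShot_mem
  intro x hx y hy hxy
  rcases le_total y p with h | h
  · exact hmono ⟨hx.1, hxy.trans h⟩ ⟨hy.1, h⟩ hxy
  · exact (hmax ⟨hx.1, hx.2.trans hm.2⟩ : f x ≤ f (oneShot L f)).trans
      (hanti ⟨h, hy.2.trans hm.2⟩ ⟨h.trans hy.2, hm.2⟩ hy.2)

end OneShot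

/-! ### Real-valued payoffs -/

/-- The agent's payoff net of the transfer in state `θ`. -/
noncomputable def agentNet (u : Fin 2 → ℝ → ℝ) (φ : ℝ → EReal) (θ : Fin 2) (l : ℝ) : ℝ :=
  u θ l - (φ l).toReal

/-- The principal's payoff including the transfer in state `θ`. -/
noncomputable def principalNet (v : Fin 2 → ℝ → ℝ) (φ : ℝ → EReal) (θ : Fin 2) (l : ℝ) : ℝ :=
  v θ l + (φ l).toReal

section Payoffs

variable {L : ℝ} {u v : Fin 2 → ℝ → ℝ} {φ : ℝ → EReal} {m l : ℝ}

lemma agentR_eq (u : Fin 2 → ℝ → ℝ) (φ : ℝ → EReal) (m l : ℝ) :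
    agentR u φ m l = indirect (agentNet u φ) m l := by
  simp only [agentR, indirect, agentNet]; ring

lemma principalR_eq (v : Fin 2 → ℝ → ℝ) (φ : ℝ → EReal) (m l : ℝ) :
    principalR v φ m l = indirect (principalNet v φ) m l := by
  simp only [principalR, indirect, principalNet]; ring

lemma indirect_zero (f : Fin 2 → ℝ → ℝ) (l : ℝ) : indirect f 0 l = f 0 l := by simp [indirect]

lemma indirect_one (f : Fin 2 → ℝ → ℝ) (l : ℝ) : indirect f 1 l = f 1 l := by simp [indirect]

lemma agentE_eq_coe (hb : φ l ≠ ⊥) (ht : φ l ≠ ⊤) :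
    agentE u φ m l = ((indirect (agentNet u φ) m l : ℝ) : EReal) := by
  rw [← agentR_eq, agentE, agentR, EReal.coe_sub, EReal.coe_toReal ht hb]

lemma principalE_eq_coe (hb : φ l ≠ ⊥) (ht : φ l ≠ ⊤) :
    principalE v φ m l = ((indirect (principalNet v φ) m l : ℝ) : EReal) := by
  rw [← principalR_eq, principalE, principalR, EReal.coe_add, EReal.coe_toReal ht hb]

lemma agentE_eq_bot (ht : φ l = ⊤) : agentE u φ m l = ⊥ := by
  rw [agentE, ht, EReal.sub_top]

lemma principalE_eq_top (ht : φ l = ⊤) : principalE v φ m l = ⊤ := by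
  rw [principalE, ht, EReal.coe_add_top]

lemma principalE_ne_top (hb : φ l ≠ ⊥) (ht : φ l ≠ ⊤) : principalE v φ m l ≠ ⊤ := by
  rw [principalE_eq_coe hb ht]; exact EReal.coe_ne_top _

lemma continuousOn_indirect (hu : ∀ θ, ContinuousOn (u θ) (Icc 0 L)) (m : ℝ) :
    ContinuousOn (indirect u m) (Icc 0 L) :=
  (continuousOn_const.mul (hu 1)).add (continuousOn_const.mul (hu 0))

/-- The transfer is finite at the maximizers of the agent's payoff. -/
lemma IsMechanism.ne_top_of_isMaxOn (hφ : IsMechanism L φ)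
    (hmax : IsMaxOn (agentE u φ m) (Icc 0 L) l) : φ l ≠ ⊤ := by
  obtain ⟨k, hk, hkt⟩ := hφ.proper
  intro h
  have := isMaxOn_iff.1 hmax k hk
  simp only [agentE_eq_bot h, agentE_eq_coe (hφ.ne_bot k hk) hkt] at this
  exact absurd (le_bot_iff.1 this) (EReal.coe_ne_bot _)

/-- By semicontinuity of the transfer the agent's latest maximizer exists. -/
lemma isMaxOn_oneShot (hu : ∀ θ, ContinuousOn (u θ) (Icc 0 L)) (hφ : IsMechanism L φ)
    (hU : SinglePeaked L (agentE u φ m)) :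
    IsMaxOn (agentE u φ m) (Icc 0 L) (oneShot L (agentE u φ m)) := by
  obtain ⟨k, hk, hkmax, -, -⟩ := hU.exists_isMaxOn
  have hkt := hφ.ne_top_of_isMaxOn hkmax
  have hkb := hφ.ne_bot k hk
  set p := oneShot L (agentE u φ m) with hp
  have hpm : p ∈ Icc 0 L := hU.oneShot_mem
  set M : ℝ := agentR u φ m k with hM
  have hMk : agentE u φ m k = (M : EReal) := by rw [agentE_eq_coe hkb hkt, hM, agentR_eq]
  -- Every maximizer `l` satisfies `φ l ≤ indirect u m l - M`. Maximizers accumulate at their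
  -- supremum `p` from the left, so lower semicontinuity of `φ` and continuity of `indirect u m`
  -- carry the bound to `p`.
  have key : φ p ≤ ((indirect u m p - M : ℝ) : EReal) := by
    by_contra! hlt
    obtain ⟨y, hy1, hy2⟩ := EReal.lt_iff_exists_real_btwn.1 hlt
    have h1 : ∀ᶠ l in 𝓝[Icc 0 L] p, (y : EReal) < φ l := hφ.lsc p hpm y hy2
    have h2 : ∀ᶠ l in 𝓝[Icc 0 L] p, indirect u m l - M < y :=
      (((continuousOn_indirect hu m) p hpm).sub tendsto_const_nhds).eventually_lt_const
        (by exact_mod_cast hy1)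
    obtain ⟨ε, hε, hball⟩ := Metric.mem_nhdsWithin_iff.1 (h1.and h2)
    obtain ⟨l, ⟨hl, hlmax⟩, hlp⟩ := exists_lt_of_lt_csSup (s := {l | l ∈ Icc 0 L ∧
      IsMaxOn (agentE u φ m) (Icc 0 L) l}) ⟨k, hk, hkmax⟩ (show p - ε < _ by rw [hp, oneShot]; linarith)
    have hlp' : l ≤ p := le_oneShot hl hlmax
    obtain ⟨g1, g2⟩ := hball ⟨by rw [Metric.mem_ball, Real.dist_eq, abs_lt]; constructor <;> linarith, hl⟩
    have hlt' := hφ.ne_top_of_isMaxOn hlmax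
    have := isMaxOn_iff.1 hlmax k hk
    simp only [hMk, agentE_eq_coe (hφ.ne_bot l hl) hlt', EReal.coe_le_coe_iff,
      ← agentR_eq] at this
    rw [← EReal.coe_toReal hlt' (hφ.ne_bot l hl), EReal.coe_lt_coe_iff] at g1
    simp only [agentR] at this
    linarith
  have hpt : φ p ≠ ⊤ := (key.trans_lt (EReal.coe_lt_top _)).ne
  rw [← EReal.coe_toReal hpt (hφ.ne_bot p hpm), EReal.coe_le_coe_iff] at key
  intro l hl
  refine (isMaxOn_iff.1 hkmax l hl).trans ?_
  rw [hMk, agentE_eq_coe (hφ.ne_bot p hpm) hpt, EReal.coe_le_coe_iff, ← agentR_eq, agentR]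
  linarith

end Payoffs

/-! ### Regular problems -/

/-- The properties of the net payoffs `a` of the agent and `b` of the principal on the levels from
`p 0` on, where `p m` is the agent's one-shot level at belief `m`; `R` is the last level that the
agent finds in state `0` as good as `p 1`. -/
structure Regular (L : ℝ) (a b : Fin 2 → ℝ → ℝ) (p : ℝ → ℝ) (R : ℝ) : Prop where
  nonneg : 0 ≤ p 0
  le_R : p 1 ≤ R
  R_le : R ≤ L
  mono : MonotoneOn p (Icc 0 1)
  cont : ContinuousOn p (Icc 0 1)
  cont_a : ∀ θ, ContinuousOn (a θ) (Icc (p 0) L)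
  cont_b : ∀ θ, ContinuousOn (b θ) (Icc (p 0) L)
  mono_a : ∀ m ∈ Icc (0 : ℝ) 1, MonotoneOn (indirect a m) (Icc (p 0) (p m))
  anti_a : ∀ m ∈ Icc (0 : ℝ) 1, AntitoneOn (indirect a m) (Icc (p m) L)
  lt_peak : ∀ m ∈ Icc (0 : ℝ) 1, ∀ l ∈ Ioc (p m) L, indirect a m l < indirect a m (p m)
  anti_b : ∀ m ∈ Icc (0 : ℝ) 1, AntitoneOn (indirect b m) (Icc (p m) L)
  a_R : a 0 R = a 0 (p 1)
  le_R_of_eq : ∀ l ∈ Icc (p 1) L, a 0 l = a 0 (p 1) → l ≤ R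

/-! ### From extended-real payoffs to a regular real-valued problem -/

section Reduction

variable {L : ℝ} {u v : Fin 2 → ℝ → ℝ} {φ : ℝ → EReal}

/-- Where the principal's payoff is decreasing, the transfer is finite. -/
lemma ne_top_of_oneShot_le (hu : ∀ θ, ContinuousOn (u θ) (Icc 0 L)) (hφ : IsMechanism L φ)
    (hU_peak : ∀ m ∈ Icc (0 : ℝ) 1, SinglePeaked L (agentE u φ m))
    (hV_peak : ∀ m ∈ Icc (0 : ℝ) 1, SinglePeaked L (principalE v φ m))
    (hpref : PrefersEarlierStopping L u v φ) {m : ℝ} (hm : m ∈ Icc (0 : ℝ) 1) {l : ℝ}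
    (hl : l ∈ Icc (oneShot L (agentE u φ m)) L) : φ l ≠ ⊤ := by
  intro ht
  have hp := (hU_peak m hm).oneShot_mem
  have hpt := hφ.ne_top_of_isMaxOn (isMaxOn_oneShot hu hφ (hU_peak m hm))
  have := (hV_peak m hm).antitoneOn ⟨hpref m hm, hp.2⟩ ⟨(hpref m hm).trans hl.1, hl.2⟩ hl.1
  rw [principalE_eq_top ht, top_le_iff] at this
  exact principalE_ne_top (hφ.ne_bot _ hp) hpt this

/-- The transfer is continuous from the agent's one-shot level in state `0` on. -/
lemma continuousOn_transfer (hu : ∀ θ, ContinuousOn (u θ) (Icc 0 L))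
    (hv : ∀ θ, ContinuousOn (v θ) (Icc 0 L)) (hφ : IsMechanism L φ)
    (hU_peak : ∀ m ∈ Icc (0 : ℝ) 1, SinglePeaked L (agentE u φ m))
    (hV_peak : ∀ m ∈ Icc (0 : ℝ) 1, SinglePeaked L (principalE v φ m))
    (hpref : PrefersEarlierStopping L u v φ) :
    ContinuousOn (fun l => (φ l).toReal) (Icc (oneShot L (agentE u φ 0)) L) := by
  have h0 : (0 : ℝ) ∈ Icc (0 : ℝ) 1 := by simp
  set p := oneShot L (agentE u φ 0) with hp
  have hpm : p ∈ Icc 0 L := (hU_peak 0 h0).oneShot_mem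
  have hsub : Icc p L ⊆ Icc 0 L := Icc_subset_Icc_left hpm.1
  have hft : ∀ l ∈ Icc p L, φ l ≠ ⊤ := fun l hl =>
    ne_top_of_oneShot_le hu hφ hU_peak hV_peak hpref h0 hl
  have hfb : ∀ l ∈ Icc p L, φ l ≠ ⊥ := fun l hl => hφ.ne_bot l (hsub hl)
  have hU : ∀ x ∈ Icc p L, ∀ y ∈ Icc p L, x ≤ y →
      u 0 y - (φ y).toReal ≤ u 0 x - (φ x).toReal := by
    intro x hx y hy hxy
    have := (hU_peak 0 h0).antitoneOn hx hy hxy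
    rwa [agentE_eq_coe (hfb _ hx) (hft _ hx), agentE_eq_coe (hfb _ hy) (hft _ hy),
      EReal.coe_le_coe_iff, indirect_zero, indirect_zero] at this
  have hV : ∀ x ∈ Icc p L, ∀ y ∈ Icc p L, x ≤ y →
      v 0 y + (φ y).toReal ≤ v 0 x + (φ x).toReal := by
    intro x hx y hy hxy
    have hle := hpref 0 h0
    have := (hV_peak 0 h0).antitoneOn (Icc_subset_Icc_left hle hx) (Icc_subset_Icc_left hle hy) hxy
    rwa [principalE_eq_coe (hfb _ hx) (hft _ hx), principalE_eq_coe (hfb _ hy) (hft _ hy),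
      EReal.coe_le_coe_iff, indirect_zero, indirect_zero] at this
  intro x hx
  refine tendsto_order.2 ⟨fun y hy => ?_, fun y hy => ?_⟩
  · have h1 : ∀ᶠ l in 𝓝[Icc p L] x, (y : EReal) < φ l := by
      refine (hφ.lsc.mono hsub) x hx y ?_
      change (y : EReal) < φ x
      rwa [← EReal.coe_toReal (hft x hx) (hfb x hx), EReal.coe_lt_coe_iff]
    filter_upwards [h1, self_mem_nhdsWithin] with l hl hlm
    rwa [← EReal.coe_toReal (hft l hlm) (hfb l hlm), EReal.coe_lt_coe_iff] at hl
  -- Semicontinuity gave the lower bound only. For the upper one, `φ` is controlled to the left of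
  -- `x` by the falling payoff of the agent and to the right by that of the principal.
  · have h1 : ∀ᶠ l in 𝓝[Icc p L] x, u 0 l - u 0 x < y - (φ x).toReal :=
      ((((hu 0).mono hsub) x hx).sub tendsto_const_nhds).eventually_lt_const (by simp at hy ⊢; linarith)
    have h2 : ∀ᶠ l in 𝓝[Icc p L] x, v 0 x - v 0 l < y - (φ x).toReal :=
      (tendsto_const_nhds.sub (((hv 0).mono hsub) x hx)).eventually_lt_const (by simp at hy ⊢; linarith)
    filter_upwards [h1, h2, self_mem_nhdsWithin] with l hl1 hl2 hlm
    rcases le_total l x with h | h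
    · linarith [hU l hlm x hx h]
    · linarith [hV x hx l hlm h]

/-- To the left of `p 0` the transfer may be infinite, so finiteness has to be propagated: once the
agent's payoff is real, a larger one cannot be `⊥`. -/
lemma agentNet_le_of_le (hu : ∀ θ, ContinuousOn (u θ) (Icc 0 L)) (hφ : IsMechanism L φ)
    (hU_peak : ∀ m ∈ Icc (0 : ℝ) 1, SinglePeaked L (agentE u φ m)) {m : ℝ}
    (hm : m ∈ Icc (0 : ℝ) 1) {x y : ℝ} (hx : 0 ≤ x) (hxy : x ≤ y)
    (hy : y ≤ oneShot L (agentE u φ m)) (hxt : φ x ≠ ⊤) :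
    φ y ≠ ⊤ ∧ indirect (agentNet u φ) m x ≤ indirect (agentNet u φ) m y := by
  have hp := (hU_peak m hm).oneShot_mem
  have hle := (hU_peak m hm).monotoneOn (isMaxOn_oneShot hu hφ (hU_peak m hm))
    ⟨hx, hxy.trans hy⟩ ⟨hx.trans hxy, hy⟩ hxy
  have hbx := hφ.ne_bot x ⟨hx, (hxy.trans hy).trans hp.2⟩
  have hby := hφ.ne_bot y ⟨hx.trans hxy, hy.trans hp.2⟩
  rw [agentE_eq_coe hbx hxt] at hle
  have hyt : φ y ≠ ⊤ := by
    intro h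
    rw [agentE_eq_bot h, le_bot_iff] at hle
    exact EReal.coe_ne_bot _ hle
  exact ⟨hyt, by rwa [agentE_eq_coe hby hyt, EReal.coe_le_coe_iff] at hle⟩

/-- Continuity of the transfer makes the net payoffs continuous from the agent's state-`0` level on.
The principal's peak lies to the left of the agent's, so her payoff falls after the latter. The
level set of `a 0` that defines `R` is closed, hence contains its supremum. -/
theorem exists_regular (hu : ∀ θ, ContinuousOn (u θ) (Icc 0 L))
    (hv : ∀ θ, ContinuousOn (v θ) (Icc 0 L)) (hφ : IsMechanism L φ)
    (hU_peak : ∀ m ∈ Icc (0 : ℝ) 1, SinglePeaked L (agentE u φ m))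
    (hV_peak : ∀ m ∈ Icc (0 : ℝ) 1, SinglePeaked L (principalE v φ m))
    (hU_cont : ContinuousOn (fun m => oneShot L (agentE u φ m)) (Icc 0 1))
    (hU_mono : MonotoneOn (fun m => oneShot L (agentE u φ m)) (Icc 0 1))
    (hpref : PrefersEarlierStopping L u v φ) :
    ∃ R, Regular L (agentNet u φ) (principalNet v φ) (fun m => oneShot L (agentE u φ m)) R := by
  have h0 : (0 : ℝ) ∈ Icc (0 : ℝ) 1 := by simp
  have h1 : (1 : ℝ) ∈ Icc (0 : ℝ) 1 := by simp
  set p : ℝ → ℝ := fun m => oneShot L (agentE u φ m) with hp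
  have hmem : ∀ m ∈ Icc (0 : ℝ) 1, p m ∈ Icc 0 L := fun m hm => (hU_peak m hm).oneShot_mem
  have hmax : ∀ m ∈ Icc (0 : ℝ) 1, IsMaxOn (agentE u φ m) (Icc 0 L) (p m) := fun m hm =>
    isMaxOn_oneShot hu hφ (hU_peak m hm)
  have hpp : ∀ m ∈ Icc (0 : ℝ) 1, p 0 ≤ p m := fun m hm => hU_mono h0 hm hm.1
  have hsub : Icc (p 0) L ⊆ Icc 0 L := Icc_subset_Icc_left (hmem 0 h0).1
  have hft : ∀ l ∈ Icc (p 0) L, φ l ≠ ⊤ := fun l hl =>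
    ne_top_of_oneShot_le hu hφ hU_peak hV_peak hpref h0 hl
  have hfb : ∀ l ∈ Icc (p 0) L, φ l ≠ ⊥ := fun l hl => hφ.ne_bot l (hsub hl)
  have hcont := continuousOn_transfer hu hv hφ hU_peak hV_peak hpref
  have hca : ∀ θ, ContinuousOn (agentNet u φ θ) (Icc (p 0) L) := fun θ =>
    ((hu θ).mono hsub).sub hcont
  have hanti : ∀ m ∈ Icc (0 : ℝ) 1, AntitoneOn (indirect (agentNet u φ) m) (Icc (p m) L) := by
    intro m hm x hx y hy hxy
    have hx' := Icc_subset_Icc_left (hpp m hm) hx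
    have hy' := Icc_subset_Icc_left (hpp m hm) hy
    have := (hU_peak m hm).antitoneOn hx hy hxy
    rwa [agentE_eq_coe (hfb _ hx') (hft _ hx'), agentE_eq_coe (hfb _ hy') (hft _ hy'),
      EReal.coe_le_coe_iff] at this
  set S : Set ℝ := {l | l ∈ Icc (p 1) L ∧ agentNet u φ 0 l = agentNet u φ 0 (p 1)} with hS
  have hSne : S.Nonempty := ⟨p 1, ⟨le_rfl, (hmem 1 h1).2⟩, rfl⟩
  have hSb : BddAbove S := ⟨L, fun _ hl => hl.1.2⟩
  have hScl : IsClosed S := by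
    have hc : ContinuousOn (agentNet u φ 0) (Icc (p 1) L) :=
      (hca 0).mono (Icc_subset_Icc_left (hpp 1 h1))
    exact hc.preimage_isClosed_of_isClosed isClosed_Icc isClosed_singleton
  have hR : sSup S ∈ S := hScl.csSup_mem hSne hSb
  refine ⟨sSup S, (hmem 0 h0).1, hR.1.1, hR.1.2, hU_mono, hU_cont, hca, fun θ =>
    ((hv θ).mono hsub).add hcont, fun m hm x hx y hy hxy => ?_, hanti, fun m hm l hl => ?_,
    fun m hm x hx y hy hxy => ?_, hR.2, fun l hl hle => le_csSup hSb ⟨hl, hle⟩⟩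
  · exact (agentNet_le_of_le hu hφ hU_peak hm ((hmem 0 h0).1.trans hx.1) hxy hy.2
      (hft x ⟨hx.1, hx.2.trans (hmem m hm).2⟩)).2
  · have hl' : l ∈ Icc (p 0) L := ⟨(hpp m hm).trans hl.1.le, hl.2⟩
    have hpm' : p m ∈ Icc (p 0) L := ⟨hpp m hm, (hmem m hm).2⟩
    -- Equality would make `l` a maximizer later than the latest one.
    refine lt_of_le_of_ne (hanti m hm ⟨le_rfl, (hmem m hm).2⟩ ⟨hl.1.le, hl.2⟩ hl.1.le) fun he => ?_
    refine hl.1.not_ge (le_oneShot (hsub hl') fun k hk => ?_)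
    refine (isMaxOn_iff.1 (hmax m hm) k hk).trans (le_of_eq ?_)
    rw [agentE_eq_coe (hfb _ hl') (hft _ hl'), agentE_eq_coe (hfb _ hpm') (hft _ hpm'), he]
  · have hle := hpref m hm
    have hx' := Icc_subset_Icc_left (hpp m hm) hx
    have hy' := Icc_subset_Icc_left (hpp m hm) hy
    have := (hV_peak m hm).antitoneOn (Icc_subset_Icc_left hle hx) (Icc_subset_Icc_left hle hy) hxy
    rwa [principalE_eq_coe (hfb _ hx') (hft _ hx'), principalE_eq_coe (hfb _ hy') (hft _ hy'),
      EReal.coe_le_coe_iff] at this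

end Reduction

/-! ### Integrals of monotone slopes -/

/-- On a partition into `n + 1` equal pieces the errors telescope to `(b - a) * (g b - g a) / (n +
1)`, which tends to `0`. This replaces differentiation in the envelope formula. -/
lemma le_of_sub_le_mul_sub {D g : ℝ → ℝ} {a b : ℝ} (hab : a ≤ b)
    (h : ∀ x ∈ Icc a b, ∀ y ∈ Icc a b, x ≤ y → D x - D y ≤ (y - x) * (g y - g x)) :
    D a ≤ D b := by
  have key : ∀ n : ℕ, D a - D b ≤ (b - a) * (g b - g a) * (1 / ((n : ℝ) + 1)) := by
    intro n
    have hn : (0 : ℝ) < (n : ℝ) + 1 := by positivity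
    set x : ℕ → ℝ := fun i => a + (b - a) * (i / (n + 1)) with hx
    have hmem : ∀ i ≤ n + 1, x i ∈ Icc a b := by
      intro i hi
      have h1 : (i : ℝ) / (n + 1) ≤ 1 := by
        rw [div_le_one hn]; exact_mod_cast hi
      have h2 : (0 : ℝ) ≤ (i : ℝ) / (n + 1) := by positivity
      constructor <;> simp only [hx] <;> nlinarith
    have hstep : ∀ i, x (i + 1) - x i = (b - a) * (1 / (n + 1)) := by
      intro i; simp only [hx]; push_cast; ring
    have hs := Finset.sum_le_sum (s := Finset.range (n + 1))
      (f := fun i => D (x i) - D (x (i + 1)))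
      (g := fun i => (b - a) * (1 / (n + 1)) * (g (x (i + 1)) - g (x i))) fun i hi => by
        have hi' := Finset.mem_range.1 hi
        rw [← hstep i]
        refine h _ (hmem i hi'.le) _ (hmem (i + 1) hi') ?_
        have : 0 ≤ (b - a) * (1 / ((n : ℝ) + 1)) := mul_nonneg (by linarith) (by positivity)
        linarith [hstep i]
    rw [Finset.sum_range_sub', ← Finset.mul_sum, Finset.sum_range_sub (fun i => g (x i))] at hs
    have e0 : x 0 = a := by simp [hx]
    have e1 : x (n + 1) = b := by simp only [hx]; push_cast; field_simp; ring
    rw [e0, e1] at hs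
    linarith
  have hlim : Tendsto (fun n : ℕ => (b - a) * (g b - g a) * (1 / ((n : ℝ) + 1))) atTop (𝓝 0) := by
    simpa using tendsto_one_div_add_atTop_nhds_zero_nat.const_mul ((b - a) * (g b - g a))
  linarith [ge_of_tendsto' hlim key]

lemma MonotoneOn.intervalIntegral_bounds {g : ℝ → ℝ} {a b x y : ℝ} (hg : MonotoneOn g (Icc a b))
    (hx : x ∈ Icc a b) (hy : y ∈ Icc a b) (hxy : x ≤ y) :
    g x * (y - x) ≤ ∫ z in x..y, g z ∧ ∫ z in x..y, g z ≤ g y * (y - x) := by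
  have hsub : Icc x y ⊆ Icc a b := Icc_subset_Icc hx.1 hy.2
  have hi : IntervalIntegrable g volume x y :=
    MonotoneOn.intervalIntegrable (by rw [uIcc_of_le hxy]; exact hg.mono hsub)
  constructor
  · have := intervalIntegral.integral_mono_on hxy intervalIntegrable_const hi
      (f := fun _ => g x) fun z hz => hg hx (hsub hz) hz.1
    simp only [intervalIntegral.integral_const, smul_eq_mul] at this
    linarith
  · have := intervalIntegral.integral_mono_on hxy hi intervalIntegrable_const
      (g := fun _ => g y) fun z hz => hg (hsub hz) hy hz.2
    simp only [intervalIntegral.integral_const, smul_eq_mul] at this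
    linarith

lemma sub_integral_sub {g : ℝ → ℝ} {a b x y : ℝ} (hg : MonotoneOn g (Icc a b))
    (hx : x ∈ Icc a b) (hy : y ∈ Icc a b) :
    (∫ z in a..y, g z) - ∫ z in a..x, g z = ∫ z in x..y, g z := by
  have hi : ∀ c ∈ Icc a b, IntervalIntegrable g volume a c := fun c hc =>
    MonotoneOn.intervalIntegrable (by
      rw [uIcc_of_le hc.1]; exact hg.mono (Icc_subset_Icc_right hc.2))
  exact intervalIntegral.integral_interval_sub_left (hi y hy) (hi x hx)

/-- A function whose increments dominate those with the left slopes `g` dominates `∫ g`. -/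
lemma integral_le_sub_of_le_slope {g k : ℝ → ℝ} {a b : ℝ} (hab : a ≤ b)
    (hg : MonotoneOn g (Icc a b))
    (h : ∀ x ∈ Icc a b, ∀ y ∈ Icc a b, x ≤ y → g x * (y - x) ≤ k y - k x) :
    ∫ z in a..b, g z ≤ k b - k a := by
  have := le_of_sub_le_mul_sub (D := fun x => k x - ∫ z in a..x, g z) (g := g) hab
    fun x hx y hy hxy => by
      have h1 := h x hx y hy hxy
      have h2 := (MonotoneOn.intervalIntegral_bounds hg hx hy hxy).2
      have h3 := sub_integral_sub hg hx hy
      linarith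
  simp only [intervalIntegral.integral_same] at this
  linarith

/-- A function whose increments are below those with the right slopes `g` is below `∫ g`. -/
lemma sub_le_integral_of_slope_le {g k : ℝ → ℝ} {a b : ℝ} (hab : a ≤ b)
    (hg : MonotoneOn g (Icc a b))
    (h : ∀ x ∈ Icc a b, ∀ y ∈ Icc a b, x ≤ y → k y - k x ≤ g y * (y - x)) :
    k b - k a ≤ ∫ z in a..b, g z := by
  have := le_of_sub_le_mul_sub (D := fun x => (∫ z in a..x, g z) - k x) (g := g) hab
    fun x hx y hy hxy => by
      have h1 := h x hx y hy hxy
      have h2 := (MonotoneOn.intervalIntegral_bounds hg hx hy hxy).1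
      have h3 := sub_integral_sub hg hx hy
      linarith
  simp only [intervalIntegral.integral_same] at this
  linarith

/-! ### Gradual revelation of state `0` -/

/-- The principal's payoff in state `0` if bad news arrives at `s`: the agent then stops, unless
`s = p 1`, when she goes on to `R`. -/
noncomputable def badNewsPayoff (b : Fin 2 → ℝ → ℝ) (p : ℝ → ℝ) (R s : ℝ) : ℝ :=
  if s < p 1 then b 0 s else b 0 R

/-- The arrival level of bad news when, from level `x` on, the belief in the absence of news is kept
such that the agent is just willing to continue: `z` is the mass of state `0` left, and `m` that of
state `1`. -/
noncomputable def arrival (p : ℝ → ℝ) (m x z : ℝ) : ℝ := max x (p (m / (m + z)))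

namespace Regular

variable {L : ℝ} {a b : Fin 2 → ℝ → ℝ} {p : ℝ → ℝ} {R : ℝ} (h : Regular L a b p R)

include h

lemma le_peak_zero {m : ℝ} (hm : m ∈ Icc (0 : ℝ) 1) : p 0 ≤ p m := h.mono (by simp) hm hm.1

lemma peak_le_one {m : ℝ} (hm : m ∈ Icc (0 : ℝ) 1) : p m ≤ p 1 := h.mono hm (by simp) hm.2

lemma peak_zero_le_one : p 0 ≤ p 1 := h.le_peak_zero (by simp)

lemma one_le : p 1 ≤ L := h.le_R.trans h.R_le

lemma anti_a_zero : AntitoneOn (a 0) (Icc (p 0) L) := by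
  have := h.anti_a 0 (by simp)
  intro x hx y hy hxy
  simpa only [indirect_zero] using this hx hy hxy

lemma anti_b_zero : AntitoneOn (b 0) (Icc (p 0) L) := by
  have := h.anti_b 0 (by simp)
  intro x hx y hy hxy
  simpa only [indirect_zero] using this hx hy hxy

lemma mono_a_one : MonotoneOn (a 1) (Icc (p 0) (p 1)) := by
  have := h.mono_a 1 (by simp)
  intro x hx y hy hxy
  simpa only [indirect_one] using this hx hy hxy

lemma a_one_lt {l : ℝ} (hl : l ∈ Ioc (p 1) L) : a 1 l < a 1 (p 1) := by
  simpa only [indirect_one] using h.lt_peak 1 (by simp) l hl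

/-- In state `0` the agent is strictly harmed by delay between `p 0` and `p 1`. -/
lemma a_zero_lt {x y : ℝ} (hx : x ∈ Ico (p 0) (p 1)) (hxy : x < y) (hy : y ≤ L) :
    a 0 y < a 0 x := by
  have key : ∀ y, x < y → y ≤ p 1 → a 0 y < a 0 x := by
    intro y hxy hy
    -- By continuity of `p`, `x` is the one-shot level of some belief `m`. Delay beyond `x` strictly
    -- hurts at belief `m` but not in state `1`, so the loss must occur in state `0`.
    obtain ⟨m, hm, hpm⟩ := intermediate_value_Icc (zero_le_one (α := ℝ)) h.cont ⟨hx.1, hx.2.le⟩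
    by_contra! hle
    have h1 := h.mono_a_one ⟨hx.1, hx.2.le⟩ ⟨hx.1.trans hxy.le, hy⟩ hxy.le
    have h2 := h.lt_peak m hm y ⟨by rw [hpm]; exact hxy, hy.trans h.one_le⟩
    rw [hpm] at h2
    simp only [indirect] at h2
    have := hm.1
    have := hm.2
    nlinarith
  refine (h.anti_a_zero ⟨hx.1.trans (lt_min hxy hx.2).le, (min_le_left _ _).trans hy⟩
    ⟨hx.1.trans hxy.le, hy⟩ (min_le_left y (p 1))).trans_lt
    (key _ (lt_min hxy hx.2) (min_le_right _ _))

/-- The latest maximizer of the agent's payoff over `[x, L]`. -/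
lemma indirect_le_max {m x l : ℝ} (hm : m ∈ Icc (0 : ℝ) 1) (hx : p 0 ≤ x) (hl : l ∈ Icc x L) :
    indirect a m l ≤ indirect a m (max x (p m)) := by
  have hpm : p m ≤ L := (h.peak_le_one hm).trans h.one_le
  rcases le_total l (max x (p m)) with hle | hle
  · rcases le_total x (p m) with hxp | hxp
    · rw [max_eq_right hxp] at hle ⊢
      exact h.mono_a m hm ⟨hx.trans hl.1, hle⟩ ⟨hx.trans hxp, le_rfl⟩ hle
    · rw [max_eq_left hxp] at hle ⊢
      rw [le_antisymm hle hl.1]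
  · exact h.anti_a m hm ⟨le_max_right _ _, max_le (hl.1.trans hl.2) hpm⟩
      ⟨(le_max_right _ _).trans hle, hl.2⟩ hle

omit h in
lemma div_add_mem {m z : ℝ} (hm : 0 ≤ m) (hz : 0 ≤ z) : m / (m + z) ∈ Icc (0 : ℝ) 1 :=
  ⟨by positivity, div_le_one_of_le₀ (by linarith) (by linarith)⟩

omit h in
-- Passes from beliefs to unnormalized masses `m` and `z` of the states. With total mass zero both
-- sides vanish, whatever the value of `0 / 0`.
lemma add_mul_indirect (f : Fin 2 → ℝ → ℝ) {m z : ℝ} (hm : 0 ≤ m) (hz : 0 ≤ z) (l : ℝ) :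
    (m + z) * indirect f (m / (m + z)) l = m * f 1 l + z * f 0 l := by
  rcases eq_or_ne (m + z) 0 with h0 | h0
  · have hm0 : m = 0 := by linarith
    have hz0 : z = 0 := by linarith
    simp [hm0, hz0]
  · simp only [indirect]; field_simp; ring

lemma arrival_mem {m x z : ℝ} (hm : 0 ≤ m) (hz : 0 ≤ z) (hx : x ∈ Icc (p 0) (p 1)) :
    arrival p m x z ∈ Icc x (p 1) :=
  ⟨le_max_left _ _, max_le hx.2 (h.peak_le_one (div_add_mem hm hz))⟩

/-- The less of state `0` is left, the higher is the belief without news and the later the next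
arrival. -/
lemma arrival_anti {m x : ℝ} (hm : 0 ≤ m) : AntitoneOn (arrival p m x) (Ici 0) := by
  intro y hy z hz hyz
  have hy' : 0 ≤ y := hy
  have hz' : 0 ≤ z := hz
  refine max_le_max le_rfl (h.mono (div_add_mem hm hz') (div_add_mem hm hy') ?_)
  rcases hm.eq_or_lt with rfl | hm0
  · simp
  · exact div_le_div_of_nonneg_left hm (by linarith) (by linarith)

lemma comp_arrival_mono {f : ℝ → ℝ} {m x : ℝ} (hm : 0 ≤ m) (hx : x ∈ Icc (p 0) (p 1))
    (hf : AntitoneOn f (Icc (p 0) (p 1))) : MonotoneOn (fun z => f (arrival p m x z)) (Ici 0) := by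
  intro y hy z hz hyz
  have h1 := h.arrival_mem hm hy hx
  have h2 := h.arrival_mem hm hz hx
  exact hf ⟨hx.1.trans h2.1, h2.2⟩ ⟨hx.1.trans h1.1, h1.2⟩ (h.arrival_anti hm hy hz hyz)

/-- The arrival level at `z` maximizes over `[x, L]` the payoff weighted by the masses `m` and `z`.
This revealed preference drives the envelope formula. -/
lemma weighted_le_arrival {m x z l : ℝ} (hm : 0 ≤ m) (hz : 0 ≤ z) (hx : p 0 ≤ x)
    (hl : l ∈ Icc x L) :
    m * a 1 l + z * a 0 l ≤ m * a 1 (arrival p m x z) + z * a 0 (arrival p m x z) := by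
  rw [← add_mul_indirect a hm hz, ← add_mul_indirect a hm hz]
  exact mul_le_mul_of_nonneg_left (h.indirect_le_max (div_add_mem hm hz) hx hl) (by linarith)

omit h in
-- With no mass of state `0` left the belief is `1`. The factor `m` covers the degenerate case `m =
-- 0`, where `0 / 0` need not give `p 1`.
lemma mul_arrival_zero {m x : ℝ} (hx : x ≤ p 1) (f : ℝ → ℝ) :
    m * f (arrival p m x 0) = m * f (p 1) := by
  rcases eq_or_ne m 0 with rfl | hm
  · simp
  · rw [arrival, add_zero, div_self hm, max_eq_right hx]

/-- Envelope formula for the agent's payoff under gradual revelation. -/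
lemma integral_a_arrival {m x c : ℝ} (hm : 0 ≤ m) (hc : 0 ≤ c) (hx : x ∈ Icc (p 0) (p 1)) :
    ∫ z in (0 : ℝ)..c, a 0 (arrival p m x z) =
      m * a 1 (arrival p m x c) + c * a 0 (arrival p m x c) - m * a 1 (p 1) := by
  have hmono : MonotoneOn (fun z => a 0 (arrival p m x z)) (Icc 0 c) :=
    (h.comp_arrival_mono hm hx (h.anti_a_zero.mono (Icc_subset_Icc_right h.one_le))).mono
      fun z hz => hz.1
  have hle : ∀ y ∈ Icc 0 c, ∀ z ∈ Icc 0 c,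
      m * a 1 (arrival p m x z) + y * a 0 (arrival p m x z) ≤
      m * a 1 (arrival p m x y) + y * a 0 (arrival p m x y) := fun y hy z hz =>
    h.weighted_le_arrival hm hy.1 hx.1
      (Icc_subset_Icc_right h.one_le (h.arrival_mem hm hz.1 hx))
  -- As the mass of state `0` grows from `y` to `z`, the optimal weighted payoff grows at least at
  -- the rate of the old optimizer and at most at that of the new one. The two bounds squeeze it to
  -- the integral.
  have h1 := integral_le_sub_of_le_slope (k := fun z => m * a 1 (arrival p m x z) +
    z * a 0 (arrival p m x z)) hc hmono fun y hy z hz _ => by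
      have := hle z hz y hy
      linarith
  have h2 := sub_le_integral_of_slope_le (k := fun z => m * a 1 (arrival p m x z) +
    z * a 0 (arrival p m x z)) hc hmono fun y hy z hz _ => by
      have := hle y hy z hz
      linarith
  simp only [zero_mul, add_zero, mul_arrival_zero hx.2] at h1 h2
  linarith

/-- Stopping at `x` is one of the alternatives over which the envelope payoff is maximal, so gradual
revelation from `x` does not hurt the agent, whether or not `x` is beyond `p m`. -/
lemma le_integral_a_arrival {m x c : ℝ} (hm : 0 ≤ m) (hc : 0 ≤ c) (hx : x ∈ Icc (p 0) (p 1)) :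
    m * a 1 x + c * a 0 x ≤ m * a 1 (p 1) + ∫ z in (0 : ℝ)..c, a 0 (arrival p m x z) := by
  rw [h.integral_a_arrival hm hc hx]
  linarith [h.weighted_le_arrival hm hc hx.1 (⟨le_rfl, hx.2.trans h.one_le⟩ : x ∈ Icc x L)]

/-- All arrivals are at or beyond the agent's one-shot level at the current belief, where the
principal wants to stop earlier. So, with masses `m` and `z`, she prefers the arrival for `z` to the
later one for `y ≤ z`, which is half of the envelope argument. The condition on `p` makes the
process start exactly at `x`. -/
lemma integral_b_arrival_le {m x c : ℝ} (hm : 0 ≤ m) (hc : 0 ≤ c) (hx : x ∈ Icc (p 0) (p 1))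
    (hpx : p (m / (m + c)) ≤ x) :
    m * b 1 (p 1) + ∫ z in (0 : ℝ)..c, b 0 (arrival p m x z) ≤ m * b 1 x + c * b 0 x := by
  have hmono : MonotoneOn (fun z => b 0 (arrival p m x z)) (Icc 0 c) :=
    (h.comp_arrival_mono hm hx (h.anti_b_zero.mono (Icc_subset_Icc_right h.one_le))).mono
      fun z hz => hz.1
  have h1 := integral_le_sub_of_le_slope (k := fun z => m * b 1 (arrival p m x z) +
    z * b 0 (arrival p m x z)) hc hmono fun y hy z hz hyz => by
      have hy' := h.arrival_mem hm hy.1 hx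
      have hz' := h.arrival_mem hm hz.1 hx
      have : m * b 1 (arrival p m x y) + z * b 0 (arrival p m x y) ≤
          m * b 1 (arrival p m x z) + z * b 0 (arrival p m x z) := by
        rw [← add_mul_indirect b hm hz.1, ← add_mul_indirect b hm hz.1]
        exact mul_le_mul_of_nonneg_left (h.anti_b _ (div_add_mem hm hz.1)
          ⟨le_max_right _ _, hz'.2.trans h.one_le⟩
          ⟨(le_max_right _ _).trans (h.arrival_anti hm hy.1 hz.1 hyz), hy'.2.trans h.one_le⟩
          (h.arrival_anti hm hy.1 hz.1 hyz)) (by linarith [hz.1])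
      linarith
  simp only [zero_mul, add_zero, mul_arrival_zero hx.2] at h1
  have : arrival p m x c = x := max_eq_left hpx
  rw [this] at h1
  linarith

lemma badNewsPayoff_anti : AntitoneOn (badNewsPayoff b p R) (Icc (p 0) (p 1)) := by
  intro x hx y hy hxy
  have hR : R ∈ Icc (p 0) L := ⟨h.peak_zero_le_one.trans h.le_R, h.R_le⟩
  simp only [badNewsPayoff]
  split_ifs with h1 h2
  · exact h.anti_b_zero ⟨hx.1, hx.2.trans h.one_le⟩ ⟨hy.1, hy.2.trans h.one_le⟩ hxy
  · exact absurd (hxy.trans_lt h1) h2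
  · exact h.anti_b_zero ⟨hx.1, hx.2.trans h.one_le⟩ hR (hx.2.trans h.le_R)
  · exact le_rfl

lemma badNewsPayoff_le {x : ℝ} (hx : x ∈ Icc (p 0) (p 1)) : badNewsPayoff b p R x ≤ b 0 x := by
  have hR : R ∈ Icc (p 0) L := ⟨h.peak_zero_le_one.trans h.le_R, h.R_le⟩
  simp only [badNewsPayoff]
  split_ifs with h1
  · exact le_rfl
  · exact h.anti_b_zero ⟨hx.1, hx.2.trans h.one_le⟩ hR (hx.2.trans h.le_R)

/-- Gradual revelation harms the principal. -/
lemma integral_badNewsPayoff_arrival_le {m x c : ℝ} (hm : 0 ≤ m) (hc : 0 ≤ c)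
    (hx : x ∈ Icc (p 0) (p 1)) (hpx : p (m / (m + c)) ≤ x) :
    m * b 1 (p 1) + ∫ z in (0 : ℝ)..c, badNewsPayoff b p R (arrival p m x z) ≤
      m * b 1 x + c * badNewsPayoff b p R x := by
  -- If `x = p 1`, all arrivals are at `p 1` and the two sides agree. Otherwise the jump of the
  -- payoff at `p 1` affects only the integral, and lowers it.
  rcases hx.2.eq_or_lt with rfl | hlt
  · have : ∫ z in (0 : ℝ)..c, badNewsPayoff b p R (arrival p m (p 1) z) =
        ∫ z in (0 : ℝ)..c, badNewsPayoff b p R (p 1) := by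
      refine intervalIntegral.integral_congr fun z hz => ?_
      rw [uIcc_of_le hc] at hz
      have := h.arrival_mem hm hz.1 hx
      simp only [le_antisymm this.2 this.1]
    rw [this]
    simp
  · refine le_trans ?_ ((h.integral_b_arrival_le hm hc hx hpx).trans (le_of_eq ?_))
    · refine add_le_add le_rfl (intervalIntegral.integral_mono_on hc ?_ ?_ fun z hz => ?_)
      · refine MonotoneOn.intervalIntegrable ?_
        rw [uIcc_of_le hc]
        exact (h.comp_arrival_mono hm hx h.badNewsPayoff_anti).mono fun z hz => hz.1
      · refine MonotoneOn.intervalIntegrable ?_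
        rw [uIcc_of_le hc]
        exact (h.comp_arrival_mono hm hx
          (h.anti_b_zero.mono (Icc_subset_Icc_right h.one_le))).mono fun z hz => hz.1
      · have := h.arrival_mem hm hz.1 hx
        exact h.badNewsPayoff_le ⟨hx.1.trans this.1, this.2⟩
    · simp [badNewsPayoff, hlt]

end Regular

/-! ### Integrability of functions that are measurable and bounded on an interval -/

/-- The projection of the line to `[A, B]`. -/
def clamp (A B x : ℝ) : ℝ := max A (min x B)

lemma clamp_mem {A B : ℝ} (hAB : A ≤ B) (x : ℝ) : clamp A B x ∈ Icc A B :=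
  ⟨le_max_left _ _, max_le hAB (min_le_right _ _)⟩

lemma clamp_of_mem {A B x : ℝ} (hx : x ∈ Icc A B) : clamp A B x = x := by
  rw [clamp, min_eq_left hx.2, max_eq_right hx.1]

lemma continuous_clamp (A B : ℝ) : Continuous (clamp A B) := by unfold clamp; fun_prop

lemma monotone_clamp (A B : ℝ) : Monotone (clamp A B) := fun _ _ hxy =>
  max_le_max le_rfl (min_le_min hxy le_rfl)

/-- `f` is measurable and bounded on `[A, B]`. -/
structure BoundedMeasurableOn (f : ℝ → ℝ) (A B : ℝ) : Prop where
  measurable : Measurable fun x => f (clamp A B x)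
  bounded : ∃ C, ∀ x ∈ Icc A B, |f x| ≤ C

lemma boundedMeasurableOn_of_continuousOn {f : ℝ → ℝ} {A B : ℝ} (hAB : A ≤ B)
    (hf : ContinuousOn f (Icc A B)) : BoundedMeasurableOn f A B := by
  refine ⟨(hf.comp_continuous (continuous_clamp A B) (clamp_mem hAB)).measurable, ?_⟩
  obtain ⟨C, hC⟩ := isCompact_Icc.exists_bound_of_continuousOn hf
  exact ⟨C, hC⟩

lemma boundedMeasurableOn_of_antitoneOn {f : ℝ → ℝ} {A B : ℝ} (hAB : A ≤ B)
    (hf : AntitoneOn f (Icc A B)) : BoundedMeasurableOn f A B := by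
  refine ⟨Antitone.measurable fun x y hxy => hf (clamp_mem hAB x) (clamp_mem hAB y)
    (monotone_clamp A B hxy), max |f A| |f B|, fun x hx => ?_⟩
  have h1 := hf ⟨le_rfl, hAB⟩ hx hx.1
  have h2 := hf hx ⟨hAB, le_rfl⟩ hx.2
  exact abs_le_max_abs_abs h2 h1 |>.trans (max_comm _ _).le

section

variable {Ω : Type*} [MeasurableSpace Ω] {P : Measure Ω} [IsFiniteMeasure P]

lemma BoundedMeasurableOn.integrable_comp {f X : Ω → ℝ} {g : ℝ → ℝ} {A B : ℝ} (hAB : A ≤ B)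
    (hg : BoundedMeasurableOn g A B) (hX : AEMeasurable X P) (hXm : ∀ᵐ ω ∂P, X ω ∈ Icc A B)
    (hf : ∀ᵐ ω ∂P, f ω = g (X ω)) : Integrable f P := by
  obtain ⟨C, hC⟩ := hg.bounded
  have h1 : Integrable (fun ω => g (clamp A B (X ω))) P :=
    Integrable.of_bound (hg.measurable.comp_aemeasurable hX).aestronglyMeasurable C
      (ae_of_all _ fun ω => hC _ (clamp_mem hAB _))
  refine h1.congr ?_
  filter_upwards [hXm, hf] with ω h2 h3
  rw [h3, clamp_of_mem h2]

lemma integrable_of_mem_unit {m : Ω → ℝ} (hm : AEMeasurable m P)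
    (hm01 : ∀ᵐ ω ∂P, m ω ∈ Icc (0 : ℝ) 1) : Integrable m P :=
  Integrable.of_bound hm.aestronglyMeasurable 1 (by
    filter_upwards [hm01] with ω h
    rw [Real.norm_eq_abs, abs_le]; constructor <;> linarith [h.1, h.2])

omit [IsFiniteMeasure P] in
lemma integrable_unit_mul {m f : Ω → ℝ} (hm : AEMeasurable m P)
    (hm01 : ∀ᵐ ω ∂P, m ω ∈ Icc (0 : ℝ) 1) (hf : Integrable f P) :
    Integrable (fun ω => m ω * f ω) P :=
  Integrable.bdd_mul (c := 1) hf hm.aestronglyMeasurable (by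
    filter_upwards [hm01] with ω h
    rw [Real.norm_eq_abs, abs_le]; constructor <;> linarith [h.1, h.2])

omit [IsFiniteMeasure P] in
lemma integrable_indirect {m : Ω → ℝ} {f : Fin 2 → Ω → ℝ} (hm : AEMeasurable m P)
    (hm01 : ∀ᵐ ω ∂P, m ω ∈ Icc (0 : ℝ) 1) (hf : ∀ θ, Integrable (f θ) P) :
    Integrable (fun ω => m ω * f 1 ω + (1 - m ω) * f 0 ω) P := by
  refine (integrable_unit_mul hm hm01 (hf 1)).add
    (integrable_unit_mul (aemeasurable_const.sub hm) ?_ (hf 0))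
  filter_upwards [hm01] with ω h
  exact ⟨by linarith [h.2], by linarith [h.1]⟩

/-- Averages over the part of mass `1 - m ω` of the fibres of `Ω × (0, 1]`. -/
lemma integral_restrict_prod {m : Ω → ℝ} (hm : Measurable m)
    (hm01 : ∀ᵐ ω ∂P, m ω ∈ Icc (0 : ℝ) 1) {g : Ω × ℝ → ℝ} (hg : Measurable g) {C : ℝ}
    (hC : ∀ q, |g q| ≤ C) :
    Integrable (fun ω => ∫ z in (0 : ℝ)..(1 - m ω), g (ω, z)) P ∧
    ∫ q, g q ∂((P.prod (volume.restrict (Ioc (0 : ℝ) 1))).restrict {q | q.2 ≤ 1 - m q.1}) =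
      ∫ ω, (∫ z in (0 : ℝ)..(1 - m ω), g (ω, z)) ∂P := by
  have hS : MeasurableSet {q : Ω × ℝ | q.2 ≤ 1 - m q.1} :=
    measurableSet_le measurable_snd (measurable_const.sub (hm.comp measurable_fst))
  have hint : Integrable (indicator {q : Ω × ℝ | q.2 ≤ 1 - m q.1} g)
      (P.prod (volume.restrict (Ioc (0 : ℝ) 1))) :=
    (Integrable.of_bound hg.aestronglyMeasurable C (ae_of_all _ hC)).indicator hS
  have hin : ∀ᵐ ω ∂P, ∫ z in Ioc (0 : ℝ) 1, indicator {q : Ω × ℝ | q.2 ≤ 1 - m q.1} g (ω, z) =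
      ∫ z in (0 : ℝ)..(1 - m ω), g (ω, z) := by
    filter_upwards [hm01] with ω hω
    rw [intervalIntegral.integral_of_le (by linarith [hω.2])]
    have e1 : (fun z => indicator {q : Ω × ℝ | q.2 ≤ 1 - m q.1} g (ω, z)) =
        indicator (Iic (1 - m ω)) fun z => g (ω, z) := by
      ext z
      by_cases hz : z ≤ 1 - m ω <;> simp [indicator, hz]
    rw [e1, integral_indicator measurableSet_Iic, Measure.restrict_restrict measurableSet_Iic]
    congr 2
    ext z
    simp only [mem_inter_iff, mem_Iic, mem_Ioc]
    constructor
    · rintro ⟨h1, h2, -⟩; exact ⟨h2, h1⟩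
    · rintro ⟨h1, h2⟩; exact ⟨h2, h1, by linarith [hω.1]⟩
  refine ⟨hint.integral_prod_left.congr hin, ?_⟩
  rw [← integral_indicator hS, integral_prod _ hint]
  exact integral_congr_ae hin

end

/-! ### Obedient laws of the arrival level -/

/-- A law `ν` on `[p 0, p 1]` of the arrival level of bad news in state `0` under which the agent, in
the absence of news, is willing to continue until `p 1`. -/
structure Obedient (μ₀ : ℝ) (a : Fin 2 → ℝ → ℝ) (p : ℝ → ℝ) (ν : Measure ℝ) : Prop where
  prob : IsProbabilityMeasure ν
  supp : ∀ᵐ s ∂ν, s ∈ Icc (p 0) (p 1)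
  obey : ∀ l ∈ Icc (p 0) (p 1),
    0 ≤ μ₀ * (a 1 (p 1) - a 1 l) + (1 - μ₀) * ∫ s, (a 0 (max l s) - a 0 l) ∂ν

/-- The principal's payoff from the bad news process with arrival law `ν`. -/
noncomputable def badNewsValue (μ₀ : ℝ) (b : Fin 2 → ℝ → ℝ) (p : ℝ → ℝ) (R : ℝ)
    (ν : Measure ℝ) : ℝ :=
  μ₀ * b 1 (p 1) + (1 - μ₀) * ∫ s, badNewsPayoff b p R s ∂ν

namespace Regular

variable {L : ℝ} {a b : Fin 2 → ℝ → ℝ} {p : ℝ → ℝ} {R : ℝ} (h : Regular L a b p R)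

include h

lemma peak_mem {m : ℝ} (hm : m ∈ Icc (0 : ℝ) 1) : p m ∈ Icc (p 0) (p 1) :=
  ⟨h.le_peak_zero hm, h.peak_le_one hm⟩

lemma boundedMeasurableOn_a (θ : Fin 2) : BoundedMeasurableOn (a θ) (p 0) L :=
  boundedMeasurableOn_of_continuousOn (h.peak_zero_le_one.trans h.one_le) (h.cont_a θ)

lemma boundedMeasurableOn_b (θ : Fin 2) : BoundedMeasurableOn (b θ) (p 0) L :=
  boundedMeasurableOn_of_continuousOn (h.peak_zero_le_one.trans h.one_le) (h.cont_b θ)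

lemma boundedMeasurableOn_payoff : BoundedMeasurableOn (badNewsPayoff b p R) (p 0) (p 1) :=
  boundedMeasurableOn_of_antitoneOn h.peak_zero_le_one h.badNewsPayoff_anti

lemma continuousOn_gain {l : ℝ} (hl : l ∈ Icc (p 0) (p 1)) :
    ContinuousOn (fun s => a 0 (max l s) - a 0 l) (Icc (p 0) (p 1)) := by
  refine ContinuousOn.sub ((h.cont_a 0).comp (by fun_prop) fun s hs => ?_) continuousOn_const
  exact ⟨hl.1.trans (le_max_left _ _), (max_le hl.2 hs.2).trans h.one_le⟩

omit h in
/-- The law of the arrival level when the belief `m` at level `y` is followed by gradual revelation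
of state `0`; it is stated through the integrals that it gives. -/
lemma exists_arrival_law (h : Regular L a b p R) {Ω : Type*} [MeasurableSpace Ω] {P : Measure Ω}
    [IsProbabilityMeasure P]
    {m y : Ω → ℝ} (hm : Measurable m) (hy : Measurable y) (hm01 : ∀ᵐ ω ∂P, m ω ∈ Icc (0 : ℝ) 1)
    (hym : ∀ᵐ ω ∂P, y ω ∈ Icc (p 0) (p 1)) {μ₀ : ℝ} (hμ₀ : μ₀ ∈ Ioo (0 : ℝ) 1)
    (hmean : ∫ ω, m ω ∂P = μ₀) :
    ∃ ν : Measure ℝ, IsProbabilityMeasure ν ∧ (∀ᵐ s ∂ν, s ∈ Icc (p 0) (p 1)) ∧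
      ∀ g, BoundedMeasurableOn g (p 0) (p 1) →
        Integrable (fun ω => ∫ z in (0 : ℝ)..(1 - m ω), g (arrival p (m ω) (y ω) z)) P ∧
        (1 - μ₀) * ∫ s, g s ∂ν =
          ∫ ω, (∫ z in (0 : ℝ)..(1 - m ω), g (arrival p (m ω) (y ω) z)) ∂P := by
  have hpc : Measurable fun x => p (clamp 0 1 x) :=
    (boundedMeasurableOn_of_continuousOn zero_le_one h.cont).measurable
  -- The clamps make `F` jointly measurable and `[p 0, p 1]`-valued everywhere, although `p` is
  -- controlled only on `[0, 1]`. Almost surely, and for `z ≥ 0`, they change nothing.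
  set F : Ω × ℝ → ℝ := fun q => clamp (p 0) (p 1)
    (max (y q.1) (p (clamp 0 1 (m q.1 / (m q.1 + q.2))))) with hF
  have hFm : Measurable F := by
    refine (continuous_clamp _ _).measurable.comp ((hy.comp measurable_fst).max ?_)
    exact hpc.comp ((hm.comp measurable_fst).div ((hm.comp measurable_fst).add measurable_snd))
  have hFmem : ∀ q, F q ∈ Icc (p 0) (p 1) := fun q => clamp_mem h.peak_zero_le_one _
  have hFeq : ∀ᵐ ω ∂P, ∀ z, 0 ≤ z → F (ω, z) = arrival p (m ω) (y ω) z := by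
    filter_upwards [hm01, hym] with ω h1 h2 z hz
    have h3 := h.arrival_mem h1.1 hz h2
    simp only [hF]
    rw [clamp_of_mem (div_add_mem h1.1 hz)]
    exact clamp_of_mem ⟨h2.1.trans h3.1, h3.2⟩
  -- The fibre over `ω` keeps mass `1 - m ω`, the conditional probability of state `0`. The total is
  -- `1 - μ₀`, which is divided out in `ν`.
  set Q := (P.prod (volume.restrict (Ioc (0 : ℝ) 1))).restrict {q | q.2 ≤ 1 - m q.1} with hQ
  have hcomp : ∀ g, BoundedMeasurableOn g (p 0) (p 1) →
      Integrable (fun ω => ∫ z in (0 : ℝ)..(1 - m ω), g (arrival p (m ω) (y ω) z)) P ∧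
      ∫ q, g (F q) ∂Q = ∫ ω, (∫ z in (0 : ℝ)..(1 - m ω), g (arrival p (m ω) (y ω) z)) ∂P := by
    intro g hg
    obtain ⟨C, hC⟩ := hg.bounded
    have hgm : Measurable fun q => g (F q) := by
      have e : (fun q => g (F q)) = fun q => g (clamp (p 0) (p 1) (F q)) := by
        ext q; rw [clamp_of_mem (hFmem q)]
      rw [e]
      exact hg.measurable.comp hFm
    obtain ⟨i1, i2⟩ := integral_restrict_prod hm hm01 hgm fun q => hC _ (hFmem q)
    have e : (fun ω => ∫ z in (0 : ℝ)..(1 - m ω), g (F (ω, z))) =ᵐ[P]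
        fun ω => ∫ z in (0 : ℝ)..(1 - m ω), g (arrival p (m ω) (y ω) z) := by
      filter_upwards [hFeq, hm01] with ω h1 h2
      refine intervalIntegral.integral_congr fun z hz => ?_
      rw [uIcc_of_le (by linarith [h2.2])] at hz
      simp only [h1 z hz.1]
    exact ⟨i1.congr e, i2.trans (integral_congr_ae e)⟩
  have hpos : 0 < 1 - μ₀ := by linarith [hμ₀.2]
  have hmass : Q.real univ = 1 - μ₀ := by
    have h1 := (hcomp (fun _ => 1) ⟨measurable_const, 1, fun _ _ => by simp⟩).2
    simp only [integral_const, smul_eq_mul, mul_one, intervalIntegral.integral_const,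
      sub_zero] at h1
    rw [h1, integral_sub (integrable_const _) (integrable_of_mem_unit hm.aemeasurable hm01), hmean]
    simp
  set ν := ENNReal.ofReal (1 - μ₀)⁻¹ • Q.map F with hν
  have hνint : ∀ g, BoundedMeasurableOn g (p 0) (p 1) →
      (1 - μ₀) * ∫ s, g s ∂ν = ∫ q, g (F q) ∂Q := by
    intro g hg
    have hae : ∀ᵐ s ∂(Q.map F), s ∈ Icc (p 0) (p 1) :=
      (ae_map_iff hFm.aemeasurable measurableSet_Icc).2 (ae_of_all _ hFmem)
    rw [hν, integral_smul_measure, ENNReal.toReal_ofReal (by positivity), smul_eq_mul,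
      integral_map hFm.aemeasurable, mul_inv_cancel_left₀ hpos.ne']
    exact (hg.integrable_comp h.peak_zero_le_one aemeasurable_id hae
      (ae_of_all _ fun _ => rfl)).aestronglyMeasurable
  refine ⟨ν, ⟨?_⟩, ?_, fun g hg => ⟨(hcomp g hg).1, (hνint g hg).trans (hcomp g hg).2⟩⟩
  · rw [hν, Measure.smul_apply, Measure.map_apply hFm MeasurableSet.univ, preimage_univ,
      ← ofReal_measureReal (measure_ne_top Q _), hmass, smul_eq_mul,
      ← ENNReal.ofReal_mul (by positivity), inv_mul_cancel₀ hpos.ne', ENNReal.ofReal_one]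
  · rw [hν]
    refine Measure.ae_smul_measure ?_ _
    exact (ae_map_iff hFm.aemeasurable measurableSet_Icc).2 (ae_of_all _ hFmem)

omit h in
/-- Delaying the revelation of state `0` in a stopping problem: the resulting law of bad news is
obedient and worse for the principal. -/
theorem exists_obedient_le (h : Regular L a b p R) {Ω : Type*} [MeasurableSpace Ω]
    {P : Measure Ω} [IsProbabilityMeasure P]
    {m y : Ω → ℝ} (hm : Measurable m) (hy : Measurable y) (hm01 : ∀ᵐ ω ∂P, m ω ∈ Icc (0 : ℝ) 1)
    (hym : ∀ᵐ ω ∂P, y ω ∈ Icc (p 0) (p 1)) (hpy : ∀ᵐ ω ∂P, p (m ω) ≤ y ω)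
    {μ₀ : ℝ} (hμ₀ : μ₀ ∈ Ioo (0 : ℝ) 1) (hmean : ∫ ω, m ω ∂P = μ₀)
    (hob : ∀ l ∈ Icc (p 0) (p 1), 0 ≤ ∫ ω, (indirect a (m ω) (y ω) -
      indirect a (m ω) (min (y ω) l)) ∂P) :
    ∃ ν : Measure ℝ, Obedient μ₀ a p ν ∧ badNewsValue μ₀ b p R ν ≤
      ∫ ω, (m ω * b 1 (y ω) + (1 - m ω) * badNewsPayoff b p R (y ω)) ∂P := by
  obtain ⟨ν, hprob, hsupp, hν⟩ := exists_arrival_law h hm hy hm01 hym hμ₀ hmean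
  have hL : Icc (p 0) (p 1) ⊆ Icc (p 0) L := Icc_subset_Icc_right h.one_le
  have hmi := integrable_of_mem_unit hm.aemeasurable hm01
  refine ⟨ν, ⟨hprob, hsupp, fun l hl => ?_⟩, ?_⟩
  · obtain ⟨i1, i2⟩ := hν _ (boundedMeasurableOn_of_continuousOn h.peak_zero_le_one
      (h.continuousOn_gain hl))
    rw [i2, ← hmean, ← integral_mul_const, ← integral_add (hmi.mul_const _) i1]
    refine (hob l hl).trans (integral_mono_ae ?_ ((hmi.mul_const _).add i1) ?_)
    · have j1 : ∀ θ, Integrable (fun ω => a θ (y ω)) P := fun θ =>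
        (h.boundedMeasurableOn_a θ).integrable_comp (h.peak_zero_le_one.trans h.one_le)
          hy.aemeasurable (hym.mono fun ω hω => hL hω) (ae_of_all _ fun _ => rfl)
      have j2 : ∀ θ, Integrable (fun ω => a θ (min (y ω) l)) P := fun θ =>
        (h.boundedMeasurableOn_a θ).integrable_comp (h.peak_zero_le_one.trans h.one_le)
          (hy.min measurable_const).aemeasurable
          (hym.mono fun ω hω => hL ⟨le_min hω.1 hl.1, (min_le_left _ _).trans hω.2⟩)
          (ae_of_all _ fun _ => rfl)
      exact (integrable_indirect hm.aemeasurable hm01 j1).sub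
        (integrable_indirect hm.aemeasurable hm01 j2)
    · filter_upwards [hm01, hym] with ω h1 h2
      have hx : max (y ω) l ∈ Icc (p 0) (p 1) := ⟨h2.1.trans (le_max_left _ _), max_le h2.2 hl.2⟩
      have h3 := h.le_integral_a_arrival h1.1 (by linarith [h1.2] : 0 ≤ 1 - m ω) hx
      -- Delaying all arrivals to at least `l` is again gradual revelation, started at `max (y ω)
      -- l`. Hence the bound on the agent's payoff applies to each deviation `l`.
      have e : ∀ z, max l (arrival p (m ω) (y ω) z) = arrival p (m ω) (max (y ω) l) z := by
        intro z
        rw [arrival, arrival, ← max_assoc, max_comm l]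
      have hc : IntervalIntegrable (fun z => a 0 (arrival p (m ω) (max (y ω) l) z)) volume 0
          (1 - m ω) := by
        refine MonotoneOn.intervalIntegrable ?_
        rw [uIcc_of_le (by linarith [h1.2])]
        exact (h.comp_arrival_mono h1.1 hx (h.anti_a_zero.mono hL)).mono fun z hz => hz.1
      simp only [e]
      rw [intervalIntegral.integral_sub hc intervalIntegrable_const]
      simp only [intervalIntegral.integral_const, smul_eq_mul, sub_zero]
      -- The gain over stopping at `l` in the given problem is that of stopping at `max (y ω) l`
      -- instead of `l`, since the two numbers `y ω` and `l` are merely rearranged.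
      have e2 : ∀ θ, a θ (y ω) - a θ (min (y ω) l) = a θ (max (y ω) l) - a θ l := by
        intro θ
        rcases le_total (y ω) l with hle | hle
        · rw [min_eq_left hle, max_eq_right hle]; ring
        · rw [min_eq_right hle, max_eq_left hle]
      have e3 : indirect a (m ω) (y ω) - indirect a (m ω) (min (y ω) l) =
          m ω * (a 1 (max (y ω) l) - a 1 l) + (1 - m ω) * (a 0 (max (y ω) l) - a 0 l) := by
        rw [← e2 1, ← e2 0]; simp only [indirect]; ring
      rw [e3]
      linarith
  · obtain ⟨i1, i2⟩ := hν _ h.boundedMeasurableOn_payoff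
    rw [badNewsValue, i2, ← hmean, ← integral_mul_const, ← integral_add (hmi.mul_const _) i1]
    refine integral_mono_ae ((hmi.mul_const _).add i1) ?_ ?_
    · have j1 : Integrable (fun ω => b 1 (y ω)) P :=
        (h.boundedMeasurableOn_b 1).integrable_comp (h.peak_zero_le_one.trans h.one_le)
          hy.aemeasurable (hym.mono fun ω hω => hL hω) (ae_of_all _ fun _ => rfl)
      have j0 : Integrable (fun ω => badNewsPayoff b p R (y ω)) P :=
        h.boundedMeasurableOn_payoff.integrable_comp h.peak_zero_le_one
          hy.aemeasurable hym (ae_of_all _ fun _ => rfl)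
      refine (integrable_unit_mul hm.aemeasurable hm01 j1).add (integrable_unit_mul
        (m := fun ω => 1 - m ω) (measurable_const.sub hm).aemeasurable ?_ j0)
      filter_upwards [hm01] with ω hω
      exact ⟨by linarith [hω.2], by linarith [hω.1]⟩
    · filter_upwards [hm01, hym, hpy] with ω h1 h2 h3
      refine h.integral_badNewsPayoff_arrival_le h1.1 (by linarith [h1.2]) h2 ?_
      rwa [add_sub_cancel, div_one]

/-- Obedient laws exist. -/
lemma exists_obedient {μ₀ : ℝ} (hμ₀ : μ₀ ∈ Ioo (0 : ℝ) 1) : ∃ ν, Obedient μ₀ a p ν := by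
  have hμ : μ₀ ∈ Icc (0 : ℝ) 1 := ⟨hμ₀.1.le, hμ₀.2.le⟩
  -- Start from no learning at all: the belief stays at the prior, and the agent stops at `p μ₀`.
  obtain ⟨ν, hν, -⟩ := h.exists_obedient_le (P := (Measure.dirac () : Measure Unit))
    (m := fun _ => μ₀) (y := fun _ => p μ₀) measurable_const measurable_const
    (ae_of_all _ fun _ => hμ) (ae_of_all _ fun _ => h.peak_mem hμ) (ae_of_all _ fun _ => le_rfl)
    hμ₀ (by simp) fun l hl => by
      simp only [integral_const, probReal_univ, one_smul]
      have hmin : min (p μ₀) l ∈ Icc (p 0) L :=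
        ⟨le_min (h.le_peak_zero hμ) hl.1, (min_le_right _ _).trans (hl.2.trans h.one_le)⟩
      have := h.indirect_le_max hμ le_rfl hmin
      rw [max_eq_right (h.le_peak_zero hμ)] at this
      linarith
  exact ⟨ν, hν⟩

end Regular

/-! ### Existence of a worst obedient law -/

/-- Integrals of a function that is continuous on `[A, B]`, as a function of the law on `[A, B]`. -/
lemma continuous_integral_of_continuousOn {A B : ℝ} {f : ℝ → ℝ} (hf : ContinuousOn f (Icc A B)) :
    Continuous fun ν : ProbabilityMeasure (Icc A B) => ∫ s, f s ∂(ν : Measure (Icc A B)) :=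
  ProbabilityMeasure.continuous_integral_boundedContinuousFunction
    (BoundedContinuousFunction.mkOfCompact ⟨fun s : Icc A B => f s, hf.domRestrict⟩)

lemma integral_map_coe {A B : ℝ} (ν : Measure (Icc A B)) (f : ℝ → ℝ) :
    ∫ s, f s ∂(ν.map Subtype.val) = ∫ s : Icc A B, f s ∂ν :=
  (MeasurableEmbedding.subtype_coe measurableSet_Icc).integral_map f

lemma exists_map_coe {A B : ℝ} {ν : Measure ℝ} [IsProbabilityMeasure ν]
    (hν : ∀ᵐ s ∂ν, s ∈ Icc A B) :
    ∃ ν' : ProbabilityMeasure (Icc A B), (ν' : Measure (Icc A B)).map Subtype.val = ν := by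
  have he : (ν.comap (Subtype.val : Icc A B → ℝ)).map Subtype.val = ν := by
    rw [(MeasurableEmbedding.subtype_coe measurableSet_Icc).map_comap, Subtype.range_coe]
    exact Measure.restrict_eq_self_of_ae_mem hν
  refine ⟨⟨ν.comap (Subtype.val : Icc A B → ℝ), ⟨?_⟩⟩, he⟩
  have := congrArg (fun κ => κ univ) he
  simpa [Measure.map_apply measurable_subtype_coe MeasurableSet.univ] using this

namespace Regular

variable {L : ℝ} {a b : Fin 2 → ℝ → ℝ} {p : ℝ → ℝ} {R : ℝ} (h : Regular L a b p R)

include h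

/-- The integral of the discontinuous payoff from bad news is lower semicontinuous. -/
lemma lowerSemicontinuous_integral_payoff :
    LowerSemicontinuous fun ν : ProbabilityMeasure (Icc (p 0) (p 1)) =>
      ∫ s : Icc (p 0) (p 1), badNewsPayoff b p R s ∂(ν : Measure (Icc (p 0) (p 1))) := by
  have hR : R ∈ Icc (p 0) L := ⟨h.peak_zero_le_one.trans h.le_R, h.R_le⟩
  have hgap : 0 ≤ b 0 (p 1) - b 0 R := by
    linarith [h.anti_b_zero ⟨h.peak_zero_le_one, h.one_le⟩ hR h.le_R]
  -- Continuous minorants that ramp the downward jump at `p 1` over a width `1 / n`. They agree with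
  -- the payoff at `p 1` and, eventually, at each earlier point.
  set W : ℕ → ℝ → ℝ := fun n s =>
    b 0 s - (b 0 (p 1) - b 0 R) * max 0 (1 - n * (p 1 - s)) with hW
  have hWc : ∀ n, ContinuousOn (W n) (Icc (p 0) (p 1)) := fun n =>
    ((h.cont_b 0).mono (Icc_subset_Icc_right h.one_le)).sub (by fun_prop)
  have hWle : ∀ n, ∀ s ∈ Icc (p 0) (p 1), W n s ≤ badNewsPayoff b p R s := by
    intro n s hs
    simp only [hW, badNewsPayoff]
    split_ifs with h1
    · have : 0 ≤ max 0 (1 - n * (p 1 - s)) := le_max_left _ _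
      nlinarith
    · have : s = p 1 := le_antisymm hs.2 (not_lt.1 h1)
      subst this
      simp
  have hlim : ∀ s ∈ Icc (p 0) (p 1),
      Tendsto (fun n => W n s) atTop (𝓝 (badNewsPayoff b p R s)) := by
    intro s hs
    refine tendsto_const_nhds.congr' ?_
    rcases hs.2.eq_or_lt with he | hlt
    · refine Eventually.of_forall fun n => ?_
      simp [hW, badNewsPayoff, he]
    · obtain ⟨N, hN⟩ := exists_nat_gt (1 / (p 1 - s))
      have hpos : 0 < p 1 - s := by linarith
      filter_upwards [eventually_ge_atTop N] with n hn
      have h1 : 1 / (p 1 - s) < n := hN.trans_le (by exact_mod_cast hn)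
      rw [div_lt_iff₀ hpos] at h1
      simp only [hW, badNewsPayoff, hlt, if_true]
      rw [max_eq_left (by linarith)]
      ring
  obtain ⟨C, hC⟩ := (h.boundedMeasurableOn_b 0).bounded
  intro ν y hy
  have hmem : ∀ s : Icc (p 0) (p 1), (s : ℝ) ∈ Icc (p 0) L := fun s =>
    Icc_subset_Icc_right h.one_le s.2
  have hWi : ∀ n (ν' : ProbabilityMeasure (Icc (p 0) (p 1))),
      Integrable (fun s : Icc (p 0) (p 1) => W n s) (ν' : Measure (Icc (p 0) (p 1))) := by
    intro n ν'
    exact (boundedMeasurableOn_of_continuousOn h.peak_zero_le_one (hWc n)).integrable_comp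
      h.peak_zero_le_one measurable_subtype_coe.aemeasurable (ae_of_all _ fun s => s.2)
      (ae_of_all _ fun _ => rfl)
  have hbi : ∀ ν' : ProbabilityMeasure (Icc (p 0) (p 1)),
      Integrable (fun s : Icc (p 0) (p 1) => badNewsPayoff b p R s)
        (ν' : Measure (Icc (p 0) (p 1))) := fun ν' =>
    h.boundedMeasurableOn_payoff.integrable_comp
      h.peak_zero_le_one measurable_subtype_coe.aemeasurable (ae_of_all _ fun s => s.2)
      (ae_of_all _ fun _ => rfl)
  have htend := tendsto_integral_of_dominated_convergence
    (μ := (ν : Measure (Icc (p 0) (p 1)))) (F := fun n s => W n s)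
    (f := fun s => badNewsPayoff b p R s) (fun _ => C + (b 0 (p 1) - b 0 R))
    (fun n => (hWi n ν).aestronglyMeasurable) (integrable_const _)
    (fun n => ae_of_all _ fun s => by
      have h1 := abs_le.1 (hC s (hmem s))
      have h2 : max 0 (1 - n * (p 1 - (s : ℝ))) ≤ 1 := by
        have : 0 ≤ (n : ℝ) * (p 1 - s) := mul_nonneg (Nat.cast_nonneg n) (by linarith [s.2.2])
        exact max_le zero_le_one (by linarith)
      have h3 : 0 ≤ max 0 (1 - n * (p 1 - (s : ℝ))) := le_max_left _ _
      rw [Real.norm_eq_abs, abs_le]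
      constructor <;> simp only [hW] <;> nlinarith)
    (ae_of_all _ fun s => hlim s s.2)
  obtain ⟨n, hn⟩ := (htend.eventually_const_lt hy).exists
  filter_upwards [(continuous_integral_of_continuousOn (hWc n)).continuousAt.eventually_const_lt hn]
    with ν' hν'
  exact hν'.trans_le (integral_mono (hWi n ν') (hbi ν') fun s => hWle n s s.2)

/-- Each obedience constraint is a closed condition on the integral of a continuous function, so
obedient laws form a compact set in the weak topology of laws on `[p 0, p 1]`. On it a lower
semicontinuous functional attains its minimum. -/
theorem exists_minimizer {μ₀ : ℝ} (hμ₀ : μ₀ ∈ Ioo (0 : ℝ) 1) :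
    ∃ ν, Obedient μ₀ a p ν ∧ ∀ ν', Obedient μ₀ a p ν' →
      badNewsValue μ₀ b p R ν ≤ badNewsValue μ₀ b p R ν' := by
  set K : Set (ProbabilityMeasure (Icc (p 0) (p 1))) :=
    {ν | ∀ l ∈ Icc (p 0) (p 1), 0 ≤ μ₀ * (a 1 (p 1) - a 1 l) + (1 - μ₀) *
      ∫ s : Icc (p 0) (p 1), (a 0 (max l s) - a 0 l) ∂(ν : Measure (Icc (p 0) (p 1)))} with hK
  have hKcl : IsClosed K := by
    have : K = ⋂ l ∈ Icc (p 0) (p 1), {ν : ProbabilityMeasure (Icc (p 0) (p 1)) | 0 ≤ μ₀ * (a 1 (p 1) - a 1 l) + (1 - μ₀) *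
        ∫ s : Icc (p 0) (p 1), (a 0 (max l s) - a 0 l) ∂(ν : Measure (Icc (p 0) (p 1)))} := by
      ext ν; simp [hK]
    rw [this]
    refine isClosed_biInter fun l hl => isClosed_le continuous_const ?_
    exact continuous_const.add (continuous_const.mul
      (continuous_integral_of_continuousOn (h.continuousOn_gain hl)))
  have hKob : ∀ ν ∈ K, Obedient μ₀ a p ((ν : Measure (Icc (p 0) (p 1))).map Subtype.val) := by
    intro ν hν
    refine ⟨Measure.isProbabilityMeasure_map measurable_subtype_coe.aemeasurable, ?_,
      fun l hl => ?_⟩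
    · exact (ae_map_iff measurable_subtype_coe.aemeasurable measurableSet_Icc).2
        (ae_of_all _ fun s => s.2)
    · rw [integral_map_coe (f := fun s => a 0 (max l s) - a 0 l)]
      exact hν l hl
  have hobK : ∀ ν, Obedient μ₀ a p ν →
      ∃ ν' ∈ K, (ν' : Measure (Icc (p 0) (p 1))).map Subtype.val = ν := by
    intro ν hν
    have := hν.prob
    obtain ⟨ν', hν'⟩ := exists_map_coe hν.supp
    refine ⟨ν', fun l hl => ?_, hν'⟩
    have := hν.obey l hl
    rwa [← hν', integral_map_coe (f := fun s => a 0 (max l s) - a 0 l)] at this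
  obtain ⟨ν₀, hν₀⟩ := h.exists_obedient hμ₀
  obtain ⟨ν₁, hν₁, -⟩ := hobK ν₀ hν₀
  obtain ⟨ν, hν, hmin⟩ := LowerSemicontinuousOn.exists_isMinOn ⟨ν₁, hν₁⟩ hKcl.isCompact
    (h.lowerSemicontinuous_integral_payoff.lowerSemicontinuousOn K)
  refine ⟨_, hKob ν hν, fun ν' hν' => ?_⟩
  obtain ⟨ν'', hK'', rfl⟩ := hobK ν' hν'
  rw [badNewsValue, badNewsValue, integral_map_coe, integral_map_coe]
  have h1 := isMinOn_iff.1 hmin ν'' hK''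
  have h2 : 0 ≤ 1 - μ₀ := by linarith [hμ₀.2]
  linarith [mul_le_mul_of_nonneg_left h1 h2]

end Regular

universe w

/-! ### Stopping levels of learning processes and optional sampling -/

/-- The last level. -/
def lastLevel {L : ℝ} (hL : 0 < L) : Level L := ⟨L, hL.le, le_rfl⟩

lemma le_lastLevel {L : ℝ} (hL : 0 < L) (t : Level L) : t ≤ lastLevel hL := t.2.2

namespace LearningProcess

variable {L μ₀ : ℝ} {Ω : Type w} [MeasurableSpace Ω] (M : LearningProcess L μ₀ Ω)

/-- The natural filtration of the beliefs. -/
noncomputable def nat : Filtration (Level L) (inferInstance : MeasurableSpace Ω) :=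
  Filtration.natural M.belief M.meas

lemma measurable_belief_nat (t : Level L) : Measurable[M.nat t] (M.belief t) :=
  (Filtration.stronglyAdapted_natural M.meas t).measurable

lemma measurable_belief_nat_of_le {s t : Level L} (hst : s ≤ t) : Measurable[M.nat t] (M.belief s) :=
  (M.measurable_belief_nat s).mono (M.nat.mono hst) le_rfl

lemma measurable_belief (t : Level L) : Measurable (M.belief t) := (M.meas t).measurable

/-- The event `τ ≤ i` is the intersection of `τ < s` over countably many `s` just above `i`, hence
known at every later level. At the maximal level there is nothing above, but there the event is
everything. -/
lemma isStoppingTime_of_lt {τ : Ω → Level L} (hτ : ∀ t, MeasurableSet[M.nat t] {ω | τ ω < t}) :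
    IsStoppingTime M.info (fun ω => (τ ω : WithTop (Level L))) := by
  intro i
  have e : {ω | (τ ω : WithTop (Level L)) ≤ i} = {ω | τ ω ≤ i} := by
    ext ω; simp [WithTop.coe_le_coe]
  rw [e, LearningProcess.info]
  by_cases hi : IsMax i
  · have : {ω | τ ω ≤ i} = univ := by
      ext ω
      simp only [mem_ofPred_eq, mem_univ, iff_true]
      rcases le_total (τ ω) i with h | h
      · exact h
      · exact hi h
    rw [this]
    exact MeasurableSet.univ
  · rw [Filtration.rightCont_eq_of_not_isMax _ hi]
    simp only [MeasurableSpace.measurableSet_iInf]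
    intro j hj
    obtain ⟨D, hDc, hD⟩ := TopologicalSpace.exists_countable_dense (Level L)
    have e : {ω | τ ω ≤ i} = ⋂ s ∈ {s ∈ D | i < s ∧ s < j}, {ω | τ ω < s} := by
      ext ω
      simp only [mem_ofPred_eq, mem_iInter]
      refine ⟨fun h s hs => h.trans_lt hs.2.1, fun h => ?_⟩
      by_contra! hlt
      obtain ⟨s, hs, h1, h2⟩ := hD.exists_between (lt_min hlt hj)
      exact absurd (h s ⟨hs, h1, h2.trans_le (min_le_right _ _)⟩)
        (not_lt.2 (h2.le.trans (min_le_left _ _)))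
    rw [e]
    exact MeasurableSet.biInter (hDc.mono fun s hs => hs.1) fun s hs =>
      M.nat.mono hs.2.2.le _ (hτ s)

lemma info_le_nat {s t : Level L} (hst : s < t) : M.info s ≤ M.nat t := by
  rw [LearningProcess.info, Filtration.rightCont_eq_of_not_isMax _ (not_isMax_of_lt hst)]
  exact iInf₂_le t hst

/-- `τ < t` is the union of `τ ≤ s` over countably many `s < t`, each known by `t` in the natural
filtration itself. Right-continuous information is thereby traded for strict inequalities. -/
lemma lt_of_isStoppingTime {τ : Ω → Level L}
    (hτ : IsStoppingTime M.info (fun ω => (τ ω : WithTop (Level L)))) (t : Level L) :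
    MeasurableSet[M.nat t] {ω | τ ω < t} := by
  obtain ⟨D, hDc, hD⟩ := TopologicalSpace.exists_countable_dense (Level L)
  have hle : ∀ i, MeasurableSet[M.info i] {ω | τ ω ≤ i} := by
    intro i
    have := hτ i
    simpa only [WithTop.coe_le_coe] using this
  have hmin : ∀ i j : Level L, i < j → MeasurableSet[M.nat j] {ω | τ ω ≤ i} := fun i j hij =>
    M.info_le_nat hij _ (hle i)
  by_cases hbot : ∃ s, s < t
  · have e : {ω | τ ω < t} = ⋃ s ∈ {s ∈ D ∪ {⟨0, by
        obtain ⟨s, -⟩ := hbot; exact ⟨le_rfl, s.2.1.trans s.2.2⟩⟩} | s < t}, {ω | τ ω ≤ s} := by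
      ext ω
      simp only [mem_ofPred_eq, mem_iUnion, exists_prop]
      constructor
      · intro h
        obtain ⟨s, hs, h1, h2⟩ := hD.exists_between h
        exact ⟨s, ⟨Or.inl hs, h2⟩, h1.le⟩
      · rintro ⟨s, hs, h⟩
        exact h.trans_lt hs.2
    rw [e]
    exact MeasurableSet.biUnion ((hDc.union (countable_singleton _)).mono fun s hs => hs.1)
      fun s hs => hmin s t hs.2
  · have : {ω | τ ω < t} = ∅ := by
      ext ω
      simp only [mem_ofPred_eq, mem_empty_iff_false, iff_false]
      exact fun h => hbot ⟨_, h⟩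
    rw [this]
    exact @MeasurableSet.empty _ (M.nat t)

/-- A level at which to stop that is known strictly after it is reached. -/
def IsOptional (τ : Ω → Level L) : Prop := ∀ t, MeasurableSet[M.nat t] {ω | τ ω < t}

variable {M}

lemma isOptional_iff {τ : Ω → Level L} : M.IsOptional τ ↔
    IsStoppingTime M.info (fun ω => (τ ω : WithTop (Level L))) :=
  ⟨M.isStoppingTime_of_lt, M.lt_of_isStoppingTime⟩

/-- The events known immediately after `τ`. -/
@[reducible] def IsOptional.past {τ : Ω → Level L} (hτ : M.IsOptional τ) : MeasurableSpace Ω where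
  MeasurableSet' A := MeasurableSet A ∧ ∀ t, MeasurableSet[M.nat t] (A ∩ {ω | τ ω < t})
  measurableSet_empty := ⟨MeasurableSet.empty, fun t => by
    rw [empty_inter]; exact @MeasurableSet.empty _ (M.nat t)⟩
  measurableSet_compl A hA := ⟨hA.1.compl, fun t => by
    have : Aᶜ ∩ {ω | τ ω < t} = {ω | τ ω < t} \ (A ∩ {ω | τ ω < t}) := by
      ext ω; simp only [mem_inter_iff, mem_compl_iff, Set.mem_sdiff]; tauto
    rw [this]
    exact (hτ t).diff (hA.2 t)⟩
  measurableSet_iUnion A hA := ⟨MeasurableSet.iUnion fun i => (hA i).1, fun t => by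
    rw [iUnion_inter]
    exact MeasurableSet.iUnion fun i => (hA i).2 t⟩

variable {τ : Ω → Level L} (hτ : M.IsOptional τ)

include hτ

lemma IsOptional.past_le : hτ.past ≤ (inferInstance : MeasurableSpace Ω) := fun _ hA => hA.1

lemma IsOptional.measurableSet_past {A : Set Ω} : MeasurableSet[hτ.past] A ↔
    MeasurableSet A ∧ ∀ t, MeasurableSet[M.nat t] (A ∩ {ω | τ ω < t}) := Iff.rfl

lemma IsOptional.measurable_past : Measurable[hτ.past] τ := by
  refine @measurable_of_Iio _ _ _ _ _ hτ.past _ _ _ _ fun s => ?_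
  refine ⟨M.nat.le s _ (hτ s), fun t => ?_⟩
  have : τ ⁻¹' Iio s ∩ {ω | τ ω < t} = {ω | τ ω < min s t} := by
    ext ω; simp
  rw [this]
  rcases le_total s t with h | h
  · rw [min_eq_left h]; exact M.nat.mono h _ (hτ s)
  · rw [min_eq_right h]; exact hτ t

lemma IsOptional.measurable : Measurable τ := hτ.measurable_past.mono hτ.past_le le_rfl

omit hτ

/-! ### Optional sampling by discretization from the right -/

section Grid

variable (hL : 0 < L)

/-- The `k`-th level of the grid with mesh `L / (N + 1)`. -/
noncomputable def grid (N k : ℕ) : Level L :=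
  ⟨min L (L * ((k + 1) / (N + 1))), le_min hL.le (by positivity), min_le_left _ _⟩

/-- The index of the grid cell of a level. -/
noncomputable def cell (N : ℕ) (t : Level L) : ℕ := ⌊((N : ℝ) + 1) * (t / L)⌋₊

include hL

lemma cell_le (N : ℕ) (t : Level L) : cell N t ≤ N + 1 := by
  have h1 : (t : ℝ) / L ≤ 1 := by rw [div_le_one hL]; exact t.2.2
  refine Nat.floor_le_of_le ?_
  push_cast
  have : (0 : ℝ) ≤ (N : ℝ) + 1 := by positivity
  nlinarith

/-- `grid` takes the right end of a cell, capped at `L`, so levels are approximated from the side on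
which beliefs are continuous. -/
lemma le_grid_cell (N : ℕ) (t : Level L) : t ≤ grid hL N (cell N t) := by
  have hN : (0 : ℝ) < (N : ℝ) + 1 := by positivity
  refine Subtype.coe_le_coe.1 (le_min t.2.2 ?_)
  have h := (Nat.lt_floor_add_one (((N : ℝ) + 1) * (t / L))).le
  rw [← le_div_iff₀' hN, div_le_iff₀ hL] at h
  simp only [cell]
  linarith

/-- Strictness is what makes the events of the cell known at the grid level, since the past of `τ`
is known only strictly after `τ`. -/
lemma lt_grid_cell (N : ℕ) {t : Level L} (ht : t < lastLevel hL) : t < grid hL N (cell N t) := by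
  have hN : (0 : ℝ) < (N : ℝ) + 1 := by positivity
  refine Subtype.coe_lt_coe.1 (lt_min ht ?_)
  have h := (Nat.lt_floor_add_one (((N : ℝ) + 1) * (t / L)))
  rw [← lt_div_iff₀' hN, div_lt_iff₀ hL] at h
  simp only [cell]
  linarith

lemma tendsto_grid_cell (t : Level L) :
    Tendsto (fun N => grid hL N (cell N t)) atTop (𝓝[Ici t] t) := by
  refine tendsto_nhdsWithin_iff.2 ⟨?_, Eventually.of_forall fun N => le_grid_cell hL N t⟩
  rw [tendsto_subtype_rng]
  have hub : Tendsto (fun N : ℕ => (t : ℝ) + L * (1 / ((N : ℝ) + 1))) atTop (𝓝 (t : ℝ)) := by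
    simpa using tendsto_const_nhds.add
      (tendsto_one_div_add_atTop_nhds_zero_nat (𝕜 := ℝ) |>.const_mul L)
  refine tendsto_of_tendsto_of_tendsto_of_le_of_le tendsto_const_nhds hub
    (fun N => le_grid_cell hL N t) fun N => (min_le_right _ _).trans ?_
  have hN : (0 : ℝ) < (N : ℝ) + 1 := by positivity
  have h : (cell N t : ℝ) ≤ ((N : ℝ) + 1) * (t / L) :=
    Nat.floor_le (mul_nonneg hN.le (div_nonneg t.2.1 hL.le))
  rw [← div_le_iff₀' hN, le_div_iff₀ hL] at h
  rw [add_div, mul_add]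
  linarith

omit hL in
lemma tendsto_belief (ω : Ω) {t : Level L} {s : ℕ → Level L} (hs : Tendsto s atTop (𝓝[Ici t] t)) :
    Tendsto (fun N => M.belief (s N) ω) atTop (𝓝 (M.belief t ω)) :=
  (M.right_cont ω t).tendsto.comp hs

omit hL in
lemma measurable_cell (N : ℕ) : Measurable (cell N : Level L → ℕ) :=
  Nat.measurable_floor.comp ((measurable_subtype_coe.div_const L).const_mul _)

include hτ

/-- On `τ < t`, the belief at `τ` is the limit of beliefs at grid levels to the right of `τ`.
Capping these at `t` keeps every approximation known at `t`. -/
lemma IsOptional.measurable_indicator_belief (t : Level L) :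
    Measurable[M.nat t] (indicator {ω | τ ω < t} fun ω => M.belief (τ ω) ω) := by
  set G : ℕ → Ω → ℝ := fun N ω => ∑ k ∈ Finset.range (N + 2),
    indicator ({ω | cell N (τ ω) = k} ∩ {ω | τ ω < t}) (M.belief (min (grid hL N k) t)) ω with hG
  have hGm : ∀ N, Measurable[M.nat t] (G N) := by
    intro N
    refine Finset.measurable_sum _ fun k _ => ?_
    refine Measurable.indicator (M.measurable_belief_nat_of_le (min_le_right _ _)) ?_
    exact (hτ.measurableSet_past.1 (((measurable_cell N).comp hτ.measurable_past)
      (measurableSet_singleton k))).2 t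
  refine @measurable_of_tendsto_metrizable _ _ (M.nat t) _ _ _ _ G _ hGm ?_
  rw [tendsto_pi_nhds]
  intro ω
  by_cases hω : τ ω < t
  · have e : ∀ N, G N ω = M.belief (min (grid hL N (cell N (τ ω))) t) ω := by
      intro N
      simp only [hG]
      rw [Finset.sum_eq_single_of_mem (cell N (τ ω))
        (Finset.mem_range.2 (Nat.lt_succ_of_le (cell_le hL N _)))]
      · rw [indicator_of_mem (by exact ⟨rfl, hω⟩)]
      · intro k _ hk
        exact indicator_of_notMem (fun h => hk h.1.symm) _
    simp only [e]
    rw [indicator_of_mem (by exact hω)]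
    refine tendsto_belief ω (tendsto_nhdsWithin_iff.2 ⟨?_, Eventually.of_forall fun N =>
      le_min (le_grid_cell hL N _) hω.le⟩)
    have h1 := ((tendsto_grid_cell hL (τ ω)).mono_right nhdsWithin_le_nhds).min
      (tendsto_const_nhds (x := t))
    rwa [min_eq_left hω.le] at h1
  · have e : ∀ N, G N ω = 0 := fun N => Finset.sum_eq_zero fun k _ =>
      indicator_of_notMem (fun h => hω h.2) _
    simp only [e]
    rw [indicator_of_notMem (by exact hω)]
    exact tendsto_const_nhds

lemma IsOptional.measurable_belief : Measurable (fun ω => M.belief (τ ω) ω) := by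
  have h1 := (hτ.measurable_indicator_belief hL (lastLevel hL)).mono (M.nat.le _) le_rfl
  have h2 : Measurable (indicator {ω | τ ω < lastLevel hL}ᶜ (M.belief (lastLevel hL))) :=
    (M.measurable_belief _).indicator (M.nat.le _ _ (hτ _)).compl
  convert h1.add h2 using 1
  ext ω
  by_cases hω : τ ω < lastLevel hL
  · simp [hω]
  · simp [le_antisymm (le_lastLevel hL _) (not_lt.1 hω)]

lemma IsOptional.measurable_belief_past : Measurable[hτ.past] (fun ω => M.belief (τ ω) ω) := by
  intro B hB
  refine ⟨hτ.measurable_belief hL hB, fun t => ?_⟩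
  have : (fun ω => M.belief (τ ω) ω) ⁻¹' B ∩ {ω | τ ω < t} =
      (indicator {ω | τ ω < t} fun ω => M.belief (τ ω) ω) ⁻¹' B ∩ {ω | τ ω < t} := by
    ext ω
    by_cases hω : τ ω < t <;> simp [hω]
  rw [this]
  exact (hτ.measurable_indicator_belief hL t hB).inter (hτ t)

omit hL hτ

lemma integrable_belief (t : Level L) : Integrable (M.belief t) M.P :=
  have := M.isProb
  integrable_of_mem_unit (M.measurable_belief t).aemeasurable (ae_of_all _ (M.mem_Icc t))

include hL hτ

/-- Optional sampling on events. -/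
lemma IsOptional.setIntegral_belief {A : Set Ω} (hA : MeasurableSet[hτ.past] A) :
    ∫ ω in A, M.belief (τ ω) ω ∂M.P = ∫ ω in A, M.belief (lastLevel hL) ω ∂M.P := by
  have := M.isProb
  set X : ℕ → Ω → ℝ := fun N ω => M.belief (grid hL N (cell N (τ ω))) ω with hX
  set B : ℕ → ℕ → Set Ω := fun N k => A ∩ {ω | cell N (τ ω) = k} with hB
  have hBm : ∀ N k, MeasurableSet[hτ.past] (B N k) := fun N k => hA.inter
    (((measurable_cell N).comp hτ.measurable_past) (measurableSet_singleton k))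
  have hAB : ∀ N, A = ⋃ k ∈ Finset.range (N + 2), B N k := by
    intro N
    ext ω
    simp only [hB, mem_iUnion, mem_inter_iff, mem_ofPred_eq, Finset.mem_range, exists_prop]
    exact ⟨fun h => ⟨_, Nat.lt_succ_of_le (cell_le hL N (τ ω)), h, rfl⟩, fun ⟨k, _, h, _⟩ => h⟩
  have hdisj : ∀ N, (↑(Finset.range (N + 2)) : Set ℕ).Pairwise (Function.onFun Disjoint (B N)) := by
    intro N i _ j _ hij
    refine Set.disjoint_left.2 fun ω h1 h2 => hij (h1.2.symm.trans h2.2)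
  have hXm : ∀ N, Measurable (X N) := by
    intro N
    have e : X N = fun ω => ∑ k ∈ Finset.range (N + 2),
        indicator {ω | cell N (τ ω) = k} (M.belief (grid hL N k)) ω := by
      ext ω
      rw [Finset.sum_eq_single_of_mem (cell N (τ ω))
        (Finset.mem_range.2 (Nat.lt_succ_of_le (cell_le hL N _)))]
      · rw [indicator_of_mem (by exact rfl)]
      · intro k _ hk
        exact indicator_of_notMem (fun h => hk h.symm) _
    rw [e]
    refine Finset.measurable_sum _ fun k _ => (M.measurable_belief _).indicator ?_
    exact ((measurable_cell N).comp hτ.measurable) (measurableSet_singleton k)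
  have hXi : ∀ N, Integrable (X N) M.P := fun N => integrable_of_mem_unit (hXm N).aemeasurable
    (ae_of_all _ fun ω => M.mem_Icc _ ω)
  have hstep : ∀ N, ∫ ω in A, X N ω ∂M.P = ∫ ω in A, M.belief (lastLevel hL) ω ∂M.P := by
    intro N
    rw [hAB N, integral_biUnion_finset _ (fun k _ => (hBm N k).1) (hdisj N)
      fun k _ => (hXi N).integrableOn, integral_biUnion_finset _ (fun k _ => (hBm N k).1) (hdisj N)
      fun k _ => (integrable_belief _).integrableOn]
    refine Finset.sum_congr rfl fun k hk => ?_
    have e1 : ∫ ω in B N k, X N ω ∂M.P = ∫ ω in B N k, M.belief (grid hL N k) ω ∂M.P := by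
      refine setIntegral_congr_fun (hBm N k).1 fun ω hω => ?_
      have : cell N (τ ω) = k := hω.2
      simp only [hX, this]
    rw [e1]
    -- Cell `N + 1` consists of the last level alone. In every other cell `τ` lies strictly below
    -- the grid level, so the event is known there and the martingale property applies.
    rcases (Nat.lt_succ_iff.1 (Finset.mem_range.1 hk)).lt_or_eq with hk' | hk'
    · have e2 : B N k ∩ {ω | τ ω < grid hL N k} = B N k := by
        refine inter_eq_left.2 fun ω hω => ?_
        have hc : cell N (τ ω) = k := hω.2
        have hlt : τ ω < lastLevel hL := by
          refine lt_of_le_of_ne (le_lastLevel hL _) fun he => ?_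
          rw [he, cell, lastLevel] at hc
          simp only [div_self hL.ne', mul_one] at hc
          have : ((N : ℝ) + 1) = ((N + 1 : ℕ) : ℝ) := by push_cast; ring
          rw [this, Nat.floor_natCast] at hc
          omega
        have := lt_grid_cell hL N hlt
        rwa [hc] at this
      have hm : MeasurableSet[M.nat (grid hL N k)] (B N k) := by
        have := (hBm N k).2 (grid hL N k)
        rwa [e2] at this
      exact M.martingale.setIntegral_eq (le_lastLevel hL _) hm
    · have : grid hL N k = lastLevel hL := by
        refine le_antisymm (le_lastLevel hL _) (Subtype.coe_le_coe.1 (le_min le_rfl ?_))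
        have h1 : (1 : ℝ) ≤ ((k : ℝ) + 1) / (N + 1) := by
          rw [one_le_div (by positivity), hk']; push_cast; linarith
        simp only [lastLevel]
        nlinarith
      rw [this]
  have hlim : Tendsto (fun N => ∫ ω in A, X N ω ∂M.P) atTop
      (𝓝 (∫ ω in A, M.belief (τ ω) ω ∂M.P)) :=
    tendsto_integral_of_dominated_convergence (fun _ => 1)
      (fun N => (hXm N).aestronglyMeasurable) (integrable_const _)
      (fun N => ae_of_all _ fun ω => by
        have := M.mem_Icc (grid hL N (cell N (τ ω))) ω
        rw [Real.norm_eq_abs, abs_le]; constructor <;> linarith [this.1, this.2])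
      (ae_of_all _ fun ω => tendsto_belief ω (tendsto_grid_cell hL _))
  simp only [hstep] at hlim
  exact tendsto_nhds_unique hlim tendsto_const_nhds

lemma IsOptional.integrable_belief : Integrable (fun ω => M.belief (τ ω) ω) M.P :=
  have := M.isProb
  integrable_of_mem_unit (hτ.measurable_belief hL).aemeasurable
    (ae_of_all _ fun ω => M.mem_Icc _ ω)

/-- Optional sampling. -/
lemma IsOptional.integral_belief_mul {X : Ω → ℝ} (hX : Measurable[hτ.past] X)
    (hXi : Integrable X M.P) :
    ∫ ω, M.belief (τ ω) ω * X ω ∂M.P = ∫ ω, M.belief (lastLevel hL) ω * X ω ∂M.P := by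
  have := M.isProb
  -- The belief at `τ` is the conditional expectation of the last belief given the past of `τ`;
  -- factors known at `τ` can then be pulled out.
  have hce : (fun ω => M.belief (τ ω) ω) =ᵐ[M.P] M.P[M.belief (lastLevel hL)|hτ.past] :=
    ae_eq_condExp_of_forall_setIntegral_eq hτ.past_le (LearningProcess.integrable_belief _)
      (fun s _ _ => (hτ.integrable_belief hL).integrableOn)
      (fun s hs _ => hτ.setIntegral_belief hL hs)
      (hτ.measurable_belief_past hL).stronglyMeasurable.aestronglyMeasurable
  have hmul : Integrable (X * M.belief (lastLevel hL)) M.P := by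
    have := integrable_unit_mul (M.measurable_belief (lastLevel hL)).aemeasurable
      (ae_of_all _ (M.mem_Icc _)) hXi
    exact this.congr (ae_of_all _ fun ω => by simp [mul_comm])
  have h1 := condExp_mul_of_stronglyMeasurable_left (hX.stronglyMeasurable) hmul
    (LearningProcess.integrable_belief _)
  calc ∫ ω, M.belief (τ ω) ω * X ω ∂M.P
      = ∫ ω, (M.P[X * M.belief (lastLevel hL)|hτ.past]) ω ∂M.P := by
        refine integral_congr_ae ?_
        filter_upwards [hce, h1] with ω e1 e2
        rw [e1, e2, Pi.mul_apply, mul_comm]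
    _ = ∫ ω, M.belief (lastLevel hL) ω * X ω ∂M.P := by
        rw [integral_condExp hτ.past_le]
        exact integral_congr_ae (ae_of_all _ fun ω => by simp [mul_comm])

/-- Optional sampling for payoffs that are linear in beliefs. -/
lemma IsOptional.integral_indirect {X : Fin 2 → Ω → ℝ} (hX : ∀ θ, Measurable[hτ.past] (X θ))
    (hXi : ∀ θ, Integrable (X θ) M.P) :
    ∫ ω, (M.belief (τ ω) ω * X 1 ω + (1 - M.belief (τ ω) ω) * X 0 ω) ∂M.P =
      ∫ ω, (M.belief (lastLevel hL) ω * X 1 ω + (1 - M.belief (lastLevel hL) ω) * X 0 ω) ∂M.P := by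
  have hd : Integrable (fun ω => X 1 ω - X 0 ω) M.P := (hXi 1).sub (hXi 0)
  have e : ∀ m x y : ℝ, m * x + (1 - m) * y = m * (x - y) + y := fun m x y => by ring
  simp only [e]
  rw [integral_add (integrable_unit_mul (hτ.measurable_belief hL).aemeasurable
      (ae_of_all _ fun ω => M.mem_Icc _ ω) hd) (hXi 0),
    integral_add (integrable_unit_mul (M.measurable_belief _).aemeasurable
      (ae_of_all _ fun ω => M.mem_Icc _ ω) hd) (hXi 0),
    hτ.integral_belief_mul hL (X := fun ω => X 1 ω - X 0 ω) ((hX 1).sub (hX 0)) hd]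

end Grid

end LearningProcess

/-- The facts about the primitives that the analysis of learning processes uses; `p` gives the
agent's one-shot levels. -/
structure Setting (L : ℝ) (u v : Fin 2 → ℝ → ℝ) (φ : ℝ → EReal) (p : ℝ → ℝ) (R : ℝ) : Prop where
  pos : 0 < L
  cont_u : ∀ θ, ContinuousOn (u θ) (Icc 0 L)
  cont_v : ∀ θ, ContinuousOn (v θ) (Icc 0 L)
  reg : Regular L (agentNet u φ) (principalNet v φ) p R
  ne_top : ∀ l ∈ Icc (p 0) L, φ l ≠ ⊤
  cont_transfer : ContinuousOn (fun l => (φ l).toReal) (Icc (p 0) L)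
  le_of_le : ∀ m ∈ Icc (0 : ℝ) 1, ∀ x y, 0 ≤ x → x ≤ y → y ≤ p m → φ x ≠ ⊤ →
    indirect (agentNet u φ) m x ≤ indirect (agentNet u φ) m y

namespace LearningProcess

variable {L μ₀ : ℝ} {Ω : Type w} [MeasurableSpace Ω] {M : LearningProcess L μ₀ Ω}

omit [MeasurableSpace Ω] in
lemma measurable_comp_level {m : MeasurableSpace Ω} {f : ℝ → ℝ} (hf : ContinuousOn f (Icc 0 L))
    {σ : Ω → Level L} (hσ : Measurable[m] σ) : Measurable[m] fun ω => f (σ ω) := by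
  have h1 : Measurable fun t : Level L => f t := hf.domRestrict.measurable
  exact h1.comp hσ

lemma integrable_comp_level {P : Measure Ω} [IsFiniteMeasure P] {f : ℝ → ℝ}
    (hf : ContinuousOn f (Icc 0 L)) {σ : Ω → Level L} (hσ : Measurable σ) :
    Integrable (fun ω => f (σ ω)) P := by
  obtain ⟨C, hC⟩ := isCompact_Icc.exists_bound_of_continuousOn hf
  exact Integrable.of_bound (measurable_comp_level hf hσ).aestronglyMeasurable C
    (ae_of_all _ fun ω => hC _ (σ ω).2)

/-- Levels that are known when `τ` is reached, and are not earlier, are optional. -/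
lemma IsOptional.of_le {τ σ : Ω → Level L} (hτ : M.IsOptional τ) (hσ : Measurable[hτ.past] σ)
    (hle : ∀ ω, τ ω ≤ σ ω) : M.IsOptional σ := by
  intro t
  have h1 : MeasurableSet[hτ.past] (σ ⁻¹' Iio t) := hσ measurableSet_Iio
  have h2 := (hτ.measurableSet_past.1 h1).2 t
  have e : σ ⁻¹' Iio t ∩ {ω | τ ω < t} = {ω | σ ω < t} := by
    ext ω
    exact ⟨fun h => h.1, fun h => ⟨h, (hle ω).trans_lt h⟩⟩
  rwa [e] at h2

lemma IsOptional.min_const {τ : Ω → Level L} (hτ : M.IsOptional τ) (l : Level L) :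
    M.IsOptional fun ω => min (τ ω) l := by
  intro t
  by_cases h : l < t
  · have : {ω | min (τ ω) l < t} = univ := by ext ω; simp [h]
    rw [this]; exact MeasurableSet.univ
  · have : {ω | min (τ ω) l < t} = {ω | τ ω < t} := by ext ω; simp [h]
    rw [this]; exact hτ t

/-- Optional sampling for payoffs with a state-independent part. -/
lemma IsOptional.integral_indirect_add (hL : 0 < L) {τ σ : Ω → Level L} (hτ : M.IsOptional τ)
    (hσ : Measurable[hτ.past] σ) {f : Fin 2 → ℝ → ℝ} (hf : ∀ θ, ContinuousOn (f θ) (Icc 0 L))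
    {k : ℝ → ℝ} (hk : Integrable (fun ω => k (σ ω)) M.P) :
    Integrable (fun ω => indirect (fun θ l => f θ l + k l) (M.belief (τ ω) ω) (σ ω)) M.P ∧
    Integrable (fun ω => indirect (fun θ l => f θ l + k l) (M.belief (lastLevel hL) ω) (σ ω)) M.P ∧
    ∫ ω, indirect (fun θ l => f θ l + k l) (M.belief (τ ω) ω) (σ ω) ∂M.P =
      ∫ ω, indirect (fun θ l => f θ l + k l) (M.belief (lastLevel hL) ω) (σ ω) ∂M.P := by
  have := M.isProb
  -- The state-independent part drops out of the mixture over states. So the transfer need only be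
  -- integrable along `σ`; it need not be continuous or bounded.
  have e : ∀ m x : ℝ, indirect (fun θ l => f θ l + k l) m x =
      (m * f 1 x + (1 - m) * f 0 x) + k x := fun m x => by simp only [indirect]; ring
  simp only [e]
  have hfi : ∀ θ, Integrable (fun ω => f θ (σ ω)) M.P := fun θ =>
    integrable_comp_level (hf θ) (hσ.mono hτ.past_le le_rfl)
  have i1 := integrable_indirect (f := fun θ ω => f θ (σ ω)) (hτ.measurable_belief hL).aemeasurable
    (ae_of_all _ fun ω => M.mem_Icc _ ω) hfi
  have i2 := integrable_indirect (f := fun θ ω => f θ (σ ω))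
    (M.measurable_belief (lastLevel hL)).aemeasurable (ae_of_all _ fun ω => M.mem_Icc _ ω) hfi
  refine ⟨i1.add hk, i2.add hk, ?_⟩
  rw [integral_add i1 hk, integral_add i2 hk,
    hτ.integral_indirect hL (X := fun θ ω => f θ (σ ω)) (fun θ => measurable_comp_level (hf θ) hσ) hfi]

end LearningProcess

open LearningProcess

lemma agentNet_eq_add (u : Fin 2 → ℝ → ℝ) (φ : ℝ → EReal) :
    agentNet u φ = fun θ l => u θ l + -(φ l).toReal := by
  funext θ l; simp [agentNet, sub_eq_add_neg]

/-! ### What optimality and late tie-breaking imply for the agent's choice -/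

namespace Setting

variable {L μ₀ : ℝ} {u v : Fin 2 → ℝ → ℝ} {φ : ℝ → EReal} {p : ℝ → ℝ} {R : ℝ}
  (S : Setting L u v φ p R) {Ω : Type w} [MeasurableSpace Ω] {M : LearningProcess L μ₀ Ω}

include S

/-- Levels from `p 0` on are admissible. -/
lemma isStoppingLevel {τ : Ω → Level L} (hτ : M.IsOptional τ)
    (hp : ∀ᵐ ω ∂M.P, p 0 ≤ τ ω) : IsStoppingLevel φ M τ := by
  have := M.isProb
  refine ⟨isOptional_iff.1 hτ, hp.mono fun ω h => S.ne_top _ ⟨h, (τ ω).2.2⟩, ?_⟩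
  exact (boundedMeasurableOn_of_continuousOn (S.reg.peak_zero_le_one.trans S.reg.one_le)
    S.cont_transfer).integrable_comp (S.reg.peak_zero_le_one.trans S.reg.one_le)
    (X := fun ω => (τ ω : ℝ)) (measurable_subtype_coe.comp hτ.measurable).aemeasurable
    (hp.mono fun ω h => ⟨h, (τ ω).2.2⟩) (ae_of_all _ fun _ => rfl)

/-- The agent's payoff from a level `σ` that is known at `τ`. -/
lemma agentValue_eq {τ σ : Ω → Level L} (hτ : M.IsOptional τ) (hσ : Measurable[hτ.past] σ)
    (hadm : IsStoppingLevel φ M σ) :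
    Integrable (fun ω => indirect (agentNet u φ) (M.belief (τ ω) ω) (σ ω)) M.P ∧
    Integrable (fun ω => indirect (agentNet u φ) (M.belief (lastLevel S.pos) ω) (σ ω)) M.P ∧
    agentValue u φ M σ = ∫ ω, indirect (agentNet u φ) (M.belief (τ ω) ω) (σ ω) ∂M.P ∧
    agentValue u φ M σ =
      ∫ ω, indirect (agentNet u φ) (M.belief (lastLevel S.pos) ω) (σ ω) ∂M.P := by
  have hσo : M.IsOptional σ := isOptional_iff.2 hadm.stopping
  obtain ⟨i1, i2, i3⟩ := hτ.integral_indirect_add S.pos hσ S.cont_u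
    (k := fun l => -(φ l).toReal) hadm.integrable.neg
  obtain ⟨-, -, j3⟩ := hσo.integral_indirect_add S.pos hσo.measurable_past S.cont_u
    (k := fun l => -(φ l).toReal) hadm.integrable.neg
  rw [← agentNet_eq_add] at i1 i2 i3 j3
  simp only [agentValue, agentR_eq]
  exact ⟨i1, i2, j3.trans i3.symm, j3⟩

lemma principalValue_eq {τ : Ω → Level L} (hadm : IsStoppingLevel φ M τ) :
    Integrable (fun ω => indirect (principalNet v φ) (M.belief (τ ω) ω) (τ ω)) M.P ∧
    principalValue v φ M τ = ∫ ω, indirect (principalNet v φ) (M.belief (τ ω) ω) (τ ω) ∂M.P ∧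
    principalValue v φ M τ =
      ∫ ω, indirect (principalNet v φ) (M.belief (lastLevel S.pos) ω) (τ ω) ∂M.P := by
  have hτ : M.IsOptional τ := isOptional_iff.2 hadm.stopping
  obtain ⟨i1, -, i3⟩ := hτ.integral_indirect_add S.pos hτ.measurable_past S.cont_v
    (k := fun l => (φ l).toReal) hadm.integrable
  have e : (fun θ l => v θ l + (φ l).toReal) = principalNet v φ := rfl
  rw [e] at i1 i3
  simp only [principalValue, principalR_eq]
  exact ⟨i1, trivial, i3⟩

/-- The agent's choice is not earlier than her one-shot level at the belief where she stops. -/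
lemma peak_le_choice {τ : Ω → Level L} (hc : IsAgentChoice u φ M τ) :
    ∀ᵐ ω ∂M.P, p (M.belief (τ ω) ω) ≤ τ ω := by
  have hτ : M.IsOptional τ := isOptional_iff.2 hc.admissible.stopping
  have hmem : ∀ ω, p (M.belief (τ ω) ω) ∈ Icc (p 0) L := fun ω =>
    Icc_subset_Icc_right S.reg.one_le (S.reg.peak_mem (M.mem_Icc _ ω))
  -- The deviation: upon stopping at `τ`, go on to the one-shot level at the current belief if that
  -- is later. It is known at `τ` and does not lower the payoff, so the latest optimal choice cannot
  -- precede it.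
  set σ : Ω → Level L := fun ω => ⟨max (τ ω : ℝ) (p (M.belief (τ ω) ω)),
    (τ ω).2.1.trans (le_max_left _ _), max_le (τ ω).2.2 (hmem ω).2⟩ with hσ
  have hle : ∀ ω, τ ω ≤ σ ω := fun ω => Subtype.coe_le_coe.1 (le_max_left _ _)
  have hpm : Measurable[hτ.past] fun ω => p (M.belief (τ ω) ω) := by
    have h1 : Measurable fun x => p (clamp 0 1 x) :=
      (boundedMeasurableOn_of_continuousOn zero_le_one S.reg.cont).measurable
    have h2 := h1.comp (hτ.measurable_belief_past S.pos)
    refine (congrArg (fun f => Measurable[hτ.past] f) ?_).mp h2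
    funext ω
    simp only [Function.comp]
    rw [clamp_of_mem (M.mem_Icc _ ω)]
  have hσm : Measurable[hτ.past] σ :=
    Measurable.subtype_mk ((measurable_subtype_coe.comp hτ.measurable_past).max hpm)
  have hσa : IsStoppingLevel φ M σ := S.isStoppingLevel (hτ.of_le hσm hle)
    (ae_of_all _ fun ω => (hmem ω).1.trans (le_max_right _ _))
  obtain ⟨i1, -, i3, -⟩ := S.agentValue_eq hτ hσm hσa
  obtain ⟨j1, -, j3, -⟩ := S.agentValue_eq hτ hτ.measurable_past hc.admissible
  have hge : agentValue u φ M τ ≤ agentValue u φ M σ := by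
    rw [i3, j3]
    refine integral_mono_ae j1 i1 ?_
    filter_upwards [hc.admissible.finite] with ω hω
    rcases le_total (p (M.belief (τ ω) ω)) (τ ω) with h | h
    · simp only [hσ, max_eq_left h]; exact le_rfl
    · simp only [hσ, max_eq_right h]
      exact S.le_of_le _ (M.mem_Icc _ ω) _ _ (τ ω).2.1 h le_rfl hω
  filter_upwards [hc.latest σ hσa (le_antisymm (hc.optimal σ hσa) hge)] with ω hω
  exact (le_max_right _ _).trans hω

/-- Stopping at a fixed level is not profitable. -/
lemma integral_sub_min_nonneg {τ : Ω → Level L} (hc : IsAgentChoice u φ M τ) {l : ℝ}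
    (hl : l ∈ Icc (p 0) (p 1)) :
    Integrable (fun ω => indirect (agentNet u φ) (M.belief (τ ω) ω) (τ ω) -
      indirect (agentNet u φ) (M.belief (τ ω) ω) (min (τ ω : ℝ) l)) M.P ∧
    0 ≤ ∫ ω, (indirect (agentNet u φ) (M.belief (τ ω) ω) (τ ω) -
      indirect (agentNet u φ) (M.belief (τ ω) ω) (min (τ ω : ℝ) l)) ∂M.P := by
  have hτ : M.IsOptional τ := isOptional_iff.2 hc.admissible.stopping
  have hl' : l ∈ Icc 0 L := ⟨S.reg.nonneg.trans hl.1, hl.2.trans S.reg.one_le⟩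
  have hσm : Measurable[hτ.past] fun ω => min (τ ω) (⟨l, hl'⟩ : Level L) :=
    hτ.measurable_past.min measurable_const
  have hcoe : ∀ ω, ((min (τ ω) (⟨l, hl'⟩ : Level L) : Level L) : ℝ) = min (τ ω : ℝ) l := fun ω =>
    (Subtype.mono_coe _).map_min
  have hσa : IsStoppingLevel φ M fun ω => min (τ ω) (⟨l, hl'⟩ : Level L) := by
    refine S.isStoppingLevel (hτ.min_const _) ?_
    filter_upwards [S.peak_le_choice hc] with ω hω
    rw [hcoe]
    exact le_min ((S.reg.le_peak_zero (M.mem_Icc _ ω)).trans hω) hl.1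
  obtain ⟨i1, -, i3, -⟩ := S.agentValue_eq hτ hσm hσa
  obtain ⟨j1, -, j3, -⟩ := S.agentValue_eq hτ hτ.measurable_past hc.admissible
  simp only [hcoe] at i1 i3
  refine ⟨j1.sub i1, ?_⟩
  rw [integral_sub j1 i1, ← i3, ← j3, sub_nonneg]
  exact hc.optimal _ hσa

/-- The agent goes beyond `p 1` only if she is certain of state `0`, and not beyond `R`. -/
lemma eq_zero_of_one_lt_choice {τ : Ω → Level L} (hc : IsAgentChoice u φ M τ) :
    ∀ᵐ ω ∂M.P, p 1 < τ ω → M.belief (τ ω) ω = 0 ∧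
      agentNet u φ 0 (τ ω) = agentNet u φ 0 (p 1) := by
  obtain ⟨i1, i2⟩ := S.integral_sub_min_nonneg hc (l := p 1) ⟨S.reg.peak_zero_le_one, le_rfl⟩
  have key : ∀ ω, p 1 < τ ω → agentNet u φ 1 (τ ω) < agentNet u φ 1 (p 1) ∧
      agentNet u φ 0 (τ ω) ≤ agentNet u φ 0 (p 1) := fun ω h =>
    ⟨S.reg.a_one_lt ⟨h, (τ ω).2.2⟩, S.reg.anti_a_zero ⟨S.reg.peak_zero_le_one, S.reg.one_le⟩
      ⟨S.reg.peak_zero_le_one.trans h.le, (τ ω).2.2⟩ h.le⟩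
  -- Beyond `p 1` delay is harmful at every belief, strictly so if state `1` is possible. Since the
  -- mean gain over stopping at `p 1` is nonnegative, it vanishes almost surely, which leaves belief
  -- `0` and a tie in state `0`.
  have hle : ∀ ω, indirect (agentNet u φ) (M.belief (τ ω) ω) (τ ω) -
      indirect (agentNet u φ) (M.belief (τ ω) ω) (min (τ ω : ℝ) (p 1)) ≤ 0 := by
    intro ω
    rcases le_or_gt (τ ω : ℝ) (p 1) with h | h
    · rw [min_eq_left h, sub_self]
    · rw [min_eq_right h.le]
      obtain ⟨h1, h2⟩ := key ω h
      have := M.mem_Icc (τ ω) ω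
      simp only [indirect]
      nlinarith [this.1, this.2]
  have hzero := (integral_eq_zero_iff_of_nonneg (fun ω => neg_nonneg.2 (hle ω)) i1.neg).1 (by
    simp only [integral_neg]
    exact neg_eq_zero.2 (le_antisymm (integral_nonpos hle) i2))
  filter_upwards [hzero] with ω hω h
  obtain ⟨h1, h2⟩ := key ω h
  have hm := M.mem_Icc (τ ω) ω
  simp only [Pi.zero_apply, neg_eq_zero, min_eq_right h.le, indirect] at hω
  have h3 : M.belief (τ ω) ω = 0 := by
    by_contra hne
    have : 0 < M.belief (τ ω) ω := lt_of_le_of_ne hm.1 (Ne.symm hne)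
    nlinarith [hm.2]
  rw [h3] at hω
  exact ⟨h3, by linarith⟩

/-- The principal's payoff from any learning process is at least that from bad news with some
obedient law. -/
theorem exists_obedient_le_principalValue (hμ₀ : μ₀ ∈ Ioo (0 : ℝ) 1) {τ : Ω → Level L}
    (hc : IsAgentChoice u φ M τ) :
    ∃ ν, Obedient μ₀ (agentNet u φ) p ν ∧
      badNewsValue μ₀ (principalNet v φ) p R ν ≤ principalValue v φ M τ := by
  have := M.isProb
  have hreg := S.reg
  have hτ : M.IsOptional τ := isOptional_iff.2 hc.admissible.stopping
  have hpeak := S.peak_le_choice hc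
  have hlate := S.eq_zero_of_one_lt_choice hc
  have hmean : ∫ ω, M.belief (τ ω) ω ∂M.P = μ₀ := by
    have := hτ.setIntegral_belief S.pos (A := univ) MeasurableSet.univ
    rwa [setIntegral_univ, setIntegral_univ, M.prior] at this
  -- The choice is truncated at `p 1`. Where this matters, the belief is `0` and the agent is
  -- indifferent between `τ` and `p 1`; the principal's loss from the longer stay is accounted for
  -- by `badNewsPayoff` at `p 1`.
  obtain ⟨ν, hν, hle⟩ := hreg.exists_obedient_le (m := fun ω => M.belief (τ ω) ω)
    (y := fun ω => min (τ ω : ℝ) (p 1)) (hτ.measurable_belief S.pos)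
    ((measurable_subtype_coe.comp hτ.measurable).min measurable_const)
    (ae_of_all _ fun ω => M.mem_Icc _ ω)
    (by
      filter_upwards [hpeak] with ω hω
      exact ⟨le_min ((hreg.le_peak_zero (M.mem_Icc _ ω)).trans hω) hreg.peak_zero_le_one,
        min_le_right _ _⟩)
    (by
      filter_upwards [hpeak] with ω hω
      exact le_min hω (hreg.peak_le_one (M.mem_Icc _ ω)))
    hμ₀ hmean
    (by
      intro l hl
      refine (S.integral_sub_min_nonneg hc hl).2.trans (le_of_eq (integral_congr_ae ?_))
      filter_upwards [hlate] with ω hω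
      rcases le_or_gt (τ ω : ℝ) (p 1) with h | h
      · simp only [min_eq_left h]
      · obtain ⟨h1, h2⟩ := hω h
        simp only [min_eq_right h.le, min_eq_right hl.2, min_eq_right (hl.2.trans h.le), h1,
          indirect_zero, h2])
  refine ⟨ν, hν, hle.trans ?_⟩
  obtain ⟨i1, i2, -⟩ := S.principalValue_eq hc.admissible
  rw [i2]
  have hyi : ∀ f, BoundedMeasurableOn f (p 0) (p 1) →
      Integrable (fun ω => f (min (τ ω : ℝ) (p 1))) M.P := fun f hf =>
    hf.integrable_comp hreg.peak_zero_le_one (X := fun ω => min (τ ω : ℝ) (p 1))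
      ((measurable_subtype_coe.comp hτ.measurable).min measurable_const).aemeasurable
      (by
        filter_upwards [hpeak] with ω hω
        exact ⟨le_min ((hreg.le_peak_zero (M.mem_Icc _ ω)).trans hω) hreg.peak_zero_le_one,
          min_le_right _ _⟩) (ae_of_all _ fun _ => rfl)
  refine integral_mono_ae ?_ i1 ?_
  · refine (integrable_unit_mul (hτ.measurable_belief S.pos).aemeasurable
      (ae_of_all _ fun ω => M.mem_Icc _ ω) (hyi _ (boundedMeasurableOn_of_continuousOn
        hreg.peak_zero_le_one ((hreg.cont_b 1).mono (Icc_subset_Icc_right hreg.one_le))))).add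
      (integrable_unit_mul (m := fun ω => 1 - M.belief (τ ω) ω)
        (measurable_const.sub (hτ.measurable_belief S.pos)).aemeasurable
        (ae_of_all _ fun ω => ?_) (hyi _ hreg.boundedMeasurableOn_payoff))
    have := M.mem_Icc (τ ω) ω
    exact ⟨by linarith [this.2], by linarith [this.1]⟩
  · filter_upwards [hpeak, hlate] with ω h1 h2
    have hm := M.mem_Icc (τ ω) ω
    have hp0 : p 0 ≤ τ ω := (hreg.le_peak_zero hm).trans h1
    rcases le_or_gt (τ ω : ℝ) (p 1) with h | h
    · rw [min_eq_left h, indirect]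
      have := hreg.badNewsPayoff_le ⟨hp0, h⟩
      nlinarith [hm.2]
    · obtain ⟨h3, h4⟩ := h2 h
      have h5 := hreg.le_R_of_eq _ ⟨h.le, (τ ω).2.2⟩ h4
      rw [min_eq_right h.le, h3, indirect_zero, badNewsPayoff, if_neg (lt_irrefl _)]
      have := hreg.anti_b_zero ⟨hp0, (τ ω).2.2⟩ ⟨hp0.trans h5, hreg.R_le⟩ h5
      linarith

end Setting

/-! ### The distribution function and the existence of bad news processes -/

/-- The distribution function with total mass `1 - μ₀` of the arrival law `ν`. -/
noncomputable def arrivalCDF (μ₀ : ℝ) (ν : Measure ℝ) : StieltjesFunction ℝ :=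
  Real.toNNReal (1 - μ₀) • cdf ν

section ArrivalCDF

variable {L μ₀ A B : ℝ} {ν : Measure ℝ} [IsProbabilityMeasure ν]

lemma arrivalCDF_apply (hμ₀ : μ₀ ∈ Ioo (0 : ℝ) 1) (l : ℝ) :
    arrivalCDF μ₀ ν l = (1 - μ₀) * ν.real (Iic l) := by
  rw [← cdf_eq_real, arrivalCDF]
  change ((1 - μ₀).toNNReal : ℝ) * cdf ν l = _
  rw [Real.coe_toNNReal _ (by linarith [hμ₀.2])]

lemma arrivalCDF_le (hμ₀ : μ₀ ∈ Ioo (0 : ℝ) 1) (l : ℝ) : arrivalCDF μ₀ ν l ≤ 1 - μ₀ := by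
  rw [arrivalCDF_apply hμ₀]
  have := measureReal_le_one (μ := ν) (s := Iic l)
  nlinarith [hμ₀.2]

lemma arrivalCDF_nonneg (hμ₀ : μ₀ ∈ Ioo (0 : ℝ) 1) (l : ℝ) : 0 ≤ arrivalCDF μ₀ ν l := by
  rw [arrivalCDF_apply hμ₀]
  exact mul_nonneg (by linarith [hμ₀.2]) measureReal_nonneg

lemma arrivalCDF_of_lt (hμ₀ : μ₀ ∈ Ioo (0 : ℝ) 1) (hν : ∀ᵐ s ∂ν, s ∈ Icc A B) {l : ℝ}
    (hl : l < A) : arrivalCDF μ₀ ν l = 0 := by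
  have : ν (Iic l) = 0 := by
    refine measure_mono_null (fun s hs => ?_) hν
    exact fun h : s ∈ Icc A B => absurd (h.1.trans hs) (not_le.2 hl)
  rw [arrivalCDF_apply hμ₀, measureReal_def, this]
  simp

lemma arrivalCDF_of_ge (hμ₀ : μ₀ ∈ Ioo (0 : ℝ) 1) (hν : ∀ᵐ s ∂ν, s ∈ Icc A B) {l : ℝ}
    (hl : B ≤ l) : arrivalCDF μ₀ ν l = 1 - μ₀ := by
  have : ν (Iic l) = 1 := by
    rw [← measure_univ (μ := ν)]
    refine measure_congr ?_
    filter_upwards [hν] with s hs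
    exact propext ⟨fun _ => trivial, fun _ => hs.2.trans hl⟩
  rw [arrivalCDF_apply hμ₀, measureReal_def, this]
  simp

lemma isBadNewsCDF (hμ₀ : μ₀ ∈ Ioo (0 : ℝ) 1) (hν : ∀ᵐ s ∂ν, s ∈ Icc A B) (hA : 0 ≤ A)
    (hB : B ≤ L) : IsBadNewsCDF L μ₀ (arrivalCDF μ₀ ν) :=
  ⟨fun _ hl => arrivalCDF_of_lt hμ₀ hν (hl.trans_le hA),
    fun _ hl => arrivalCDF_of_ge hμ₀ hν (hB.trans hl)⟩

lemma noNewsBelief_mem (hμ₀ : μ₀ ∈ Ioo (0 : ℝ) 1) (l : ℝ) :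
    noNewsBelief μ₀ (arrivalCDF μ₀ ν) l ∈ Icc μ₀ 1 := by
  have h1 := arrivalCDF_le (ν := ν) hμ₀ l
  have h2 := arrivalCDF_nonneg (ν := ν) hμ₀ l
  have h3 : 0 < 1 - arrivalCDF μ₀ ν l := by linarith [hμ₀.1]
  exact ⟨(le_div_iff₀ h3).2 (by nlinarith [hμ₀.1]), (div_le_one h3).2 (by linarith)⟩

lemma noNewsBelief_mono (hμ₀ : μ₀ ∈ Ioo (0 : ℝ) 1) :
    Monotone (noNewsBelief μ₀ (arrivalCDF μ₀ ν)) := by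
  intro x y hxy
  have h1 := arrivalCDF_le (ν := ν) hμ₀ y
  exact div_le_div_of_nonneg_left hμ₀.1.le (by linarith [hμ₀.1])
    (by linarith [(arrivalCDF μ₀ ν).mono hxy])

lemma noNewsBelief_rightCont (hμ₀ : μ₀ ∈ Ioo (0 : ℝ) 1) (l : ℝ) :
    ContinuousWithinAt (noNewsBelief μ₀ (arrivalCDF μ₀ ν)) (Ici l) l := by
  have h1 := arrivalCDF_le (ν := ν) hμ₀ l
  exact continuousWithinAt_const.div
    (continuousWithinAt_const.sub ((arrivalCDF μ₀ ν).right_continuous l)) (by linarith [hμ₀.1])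

lemma noNewsBelief_mul (hμ₀ : μ₀ ∈ Ioo (0 : ℝ) 1) (l : ℝ) :
    noNewsBelief μ₀ (arrivalCDF μ₀ ν) l * (1 - arrivalCDF μ₀ ν l) = μ₀ :=
  div_mul_cancel₀ _ (by linarith [arrivalCDF_le (ν := ν) hμ₀ l, hμ₀.1])

/-- The law of the arrival level, with the value `L + 1` in state `1`. -/
noncomputable def arrivalLaw (L μ₀ : ℝ) (ν : Measure ℝ) : Measure ℝ :=
  ENNReal.ofReal (1 - μ₀) • ν + ENNReal.ofReal μ₀ • Measure.dirac (L + 1)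

/-- The canonical bad news process. -/
noncomputable def canonicalBelief (L μ₀ : ℝ) (ν : Measure ℝ) (l : Level L) (ω : ℝ) : ℝ :=
  (Ioi (l : ℝ)).indicator (fun _ => noNewsBelief μ₀ (arrivalCDF μ₀ ν) l) ω

lemma isProbabilityMeasure_arrivalLaw (hμ₀ : μ₀ ∈ Ioo (0 : ℝ) 1) :
    IsProbabilityMeasure (arrivalLaw L μ₀ ν) := by
  constructor
  have : 0 ≤ 1 - μ₀ := by linarith [hμ₀.2]
  simp only [arrivalLaw, Measure.add_apply, Measure.smul_apply, measure_univ, smul_eq_mul, mul_one]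
  rw [← ENNReal.ofReal_add this hμ₀.1.le]
  simp

lemma arrivalLaw_Ioi (hμ₀ : μ₀ ∈ Ioo (0 : ℝ) 1) {l : ℝ} (hl : l ≤ L) :
    (arrivalLaw L μ₀ ν).real (Ioi l) = 1 - arrivalCDF μ₀ ν l := by
  have h0 : 0 ≤ 1 - μ₀ := by linarith [hμ₀.2]
  have h1 : (Measure.dirac (L + 1) : Measure ℝ) (Ioi l) = 1 := by
    rw [Measure.dirac_apply' _ measurableSet_Ioi, indicator_of_mem (by exact (by linarith : l < L + 1))]
    rfl
  have h2 : ν.real (Ioi l) = 1 - ν.real (Iic l) := by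
    rw [← compl_Iic, probReal_compl_eq_one_sub measurableSet_Iic]
  rw [measureReal_def, arrivalLaw, Measure.add_apply, Measure.smul_apply, Measure.smul_apply, h1,
    smul_eq_mul, smul_eq_mul, mul_one, ENNReal.toReal_add (by finiteness) (by finiteness),
    ENNReal.toReal_mul, ENNReal.toReal_ofReal h0, ENNReal.toReal_ofReal hμ₀.1.le,
    ← measureReal_def, h2, arrivalCDF_apply hμ₀]
  ring

omit [IsProbabilityMeasure ν] in
lemma measurable_canonicalBelief (l : Level L) : Measurable (canonicalBelief L μ₀ ν l) :=
  measurable_const.indicator measurableSet_Ioi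

lemma canonicalBelief_mem (hμ₀ : μ₀ ∈ Ioo (0 : ℝ) 1) (l : Level L) (ω : ℝ) :
    canonicalBelief L μ₀ ν l ω ∈ Icc (0 : ℝ) 1 := by
  have h := noNewsBelief_mem (ν := ν) hμ₀ (l : ℝ)
  rw [canonicalBelief]
  by_cases hω : ω ∈ Ioi (l : ℝ)
  · rw [indicator_of_mem hω]; exact ⟨hμ₀.1.le.trans h.1, h.2⟩
  · rw [indicator_of_notMem hω]; simp

omit [IsProbabilityMeasure ν] in
lemma setIntegral_canonicalBelief (l : Level L) (A : Set ℝ) :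
    ∫ ω in A, canonicalBelief L μ₀ ν l ω ∂(arrivalLaw L μ₀ ν) =
      (arrivalLaw L μ₀ ν).real (A ∩ Ioi (l : ℝ)) * noNewsBelief μ₀ (arrivalCDF μ₀ ν) l := by
  simp only [canonicalBelief]
  rw [setIntegral_indicator measurableSet_Ioi, setIntegral_const, smul_eq_mul]

/-- The events that contain `S` or are disjoint from it. -/
@[reducible] def constantOn {α : Type*} (S : Set α) : MeasurableSpace α where
  MeasurableSet' A := S ⊆ A ∨ Disjoint A S
  measurableSet_empty := Or.inr (empty_disjoint _)
  measurableSet_compl A hA := by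
    rcases hA with h | h
    · exact Or.inr (disjoint_compl_left_iff_subset.2 h)
    · exact Or.inl h.symm.subset_compl_right
  measurableSet_iUnion A hA := by
    by_cases h : ∃ i, S ⊆ A i
    · obtain ⟨i, hi⟩ := h
      exact Or.inl (hi.trans (subset_iUnion A i))
    · push Not at h
      exact Or.inr (disjoint_iUnion_left.2 fun i => (hA i).resolve_left (h i))

omit [IsProbabilityMeasure ν] in
/-- The events known at `l` do not distinguish later arrivals. -/
lemma canonical_trivial (hm : ∀ l, StronglyMeasurable (canonicalBelief L μ₀ ν l)) (l : Level L)
    {A : Set ℝ} (hA : MeasurableSet[Filtration.natural (canonicalBelief L μ₀ ν) hm l] A) :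
    Ioi (l : ℝ) ⊆ A ∨ Disjoint A (Ioi (l : ℝ)) := by
  have hle : Filtration.natural (canonicalBelief L μ₀ ν) hm l ≤ constantOn (Ioi (l : ℝ)) := by
    refine iSup₂_le fun s hs => ?_
    rintro _ ⟨B, -, rfl⟩
    have hc : ∀ ω ∈ Ioi (l : ℝ),
        canonicalBelief L μ₀ ν s ω = noNewsBelief μ₀ (arrivalCDF μ₀ ν) s := fun ω hω =>
      indicator_of_mem (lt_of_le_of_lt (show (s : ℝ) ≤ l from hs) hω) _
    by_cases hB : noNewsBelief μ₀ (arrivalCDF μ₀ ν) s ∈ B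
    · exact Or.inl fun ω hω => by rw [mem_preimage, hc ω hω]; exact hB
    · refine Or.inr (disjoint_left.2 fun ω h1 h2 => hB ?_)
      rwa [mem_preimage, hc ω h2] at h1
  exact hle A hA

/-- The bad news process of `arrivalCDF μ₀ ν` on the line. -/
lemma exists_badNews (hμ₀ : μ₀ ∈ Ioo (0 : ℝ) 1) :
    ∃ M : LearningProcess L μ₀ ℝ, IsBadNews (arrivalCDF μ₀ ν) M := by
  have hP := isProbabilityMeasure_arrivalLaw (L := L) (ν := ν) hμ₀
  have hm : ∀ l, StronglyMeasurable (canonicalBelief L μ₀ ν l) := fun l =>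
    (measurable_canonicalBelief l).stronglyMeasurable
  have hint : ∀ l, Integrable (canonicalBelief L μ₀ ν l) (arrivalLaw L μ₀ ν) := fun l =>
    integrable_of_mem_unit (measurable_canonicalBelief l).aemeasurable
      (ae_of_all _ (canonicalBelief_mem hμ₀ l))
  have hmass : ∀ l : Level L, (arrivalLaw L μ₀ ν).real (Ioi (l : ℝ)) *
      noNewsBelief μ₀ (arrivalCDF μ₀ ν) l = μ₀ := fun l => by
    rw [arrivalLaw_Ioi hμ₀ l.2.2, mul_comm, noNewsBelief_mul hμ₀]
  refine ⟨⟨arrivalLaw L μ₀ ν, hP, canonicalBelief L μ₀ ν, hm, canonicalBelief_mem hμ₀,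
    fun ω l => ?_, fun ω l => ?_, ⟨Filtration.stronglyAdapted_natural hm, fun i j hij => ?_⟩,
    fun l => ?_⟩, fun l => ?_⟩
  · rcases le_or_gt ω (l : ℝ) with h | h
    · refine ContinuousWithinAt.congr (f := fun _ => (0 : ℝ)) continuousWithinAt_const
        (fun s hs => ?_) ?_
      · exact indicator_of_notMem (not_lt.2 (h.trans (show (l : ℝ) ≤ s from hs))) _
      · exact indicator_of_notMem (not_lt.2 h) _
    · have h1 : ContinuousWithinAt (fun s : Level L => noNewsBelief μ₀ (arrivalCDF μ₀ ν) s)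
          (Ici l) l :=
        (noNewsBelief_rightCont hμ₀ (l : ℝ)).comp continuous_subtype_val.continuousWithinAt
          fun s hs => hs
      refine h1.congr_of_eventuallyEq ?_ (indicator_of_mem h _)
      have : ∀ᶠ s : Level L in 𝓝 l, (s : ℝ) < ω :=
        continuous_subtype_val.continuousAt.eventually_lt_const h
      filter_upwards [nhdsWithin_le_nhds this] with s hs
      exact indicator_of_mem hs _
  · rcases lt_or_ge ω (l : ℝ) with h | h
    · refine ⟨0, tendsto_const_nhds.congr' ?_⟩
      have : ∀ᶠ s : Level L in 𝓝 l, ω < (s : ℝ) :=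
        continuous_subtype_val.continuousAt.eventually_const_lt h
      filter_upwards [nhdsWithin_le_nhds this] with s hs
      exact (indicator_of_notMem (s := Ioi (s : ℝ)) (not_lt.2 hs.le)
        (fun _ => noNewsBelief μ₀ (arrivalCDF μ₀ ν) s)).symm
    · have h1 := (noNewsBelief_mono (ν := ν) hμ₀).tendsto_leftLim (l : ℝ)
      have h2 : Tendsto (fun s : Level L => (s : ℝ)) (𝓝[<] l) (𝓝[<] (l : ℝ)) :=
        tendsto_nhdsWithin_iff.2 ⟨(continuous_subtype_val.tendsto l).mono_left nhdsWithin_le_nhds,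
          eventually_mem_nhdsWithin⟩
      refine ⟨_, (h1.comp h2).congr' ?_⟩
      filter_upwards [self_mem_nhdsWithin] with s hs
      exact (indicator_of_mem (s := Ioi (s : ℝ)) (lt_of_lt_of_le (show (s : ℝ) < l from hs) h)
        (fun _ => noNewsBelief μ₀ (arrivalCDF μ₀ ν) s)).symm
  -- An event known at `i` contains all later arrivals or none. In the first case both integrals are
  -- `μ₀`, in the second both vanish.
  · refine (ae_eq_condExp_of_forall_setIntegral_eq (Filtration.le _ i) (hint j)
      (fun s _ _ => (hint i).integrableOn) (fun A hA _ => ?_)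
      ((Filtration.stronglyAdapted_natural hm i).aestronglyMeasurable)).symm
    have hsub : Ioi (j : ℝ) ⊆ Ioi (i : ℝ) := Ioi_subset_Ioi hij
    rw [setIntegral_canonicalBelief, setIntegral_canonicalBelief]
    rcases canonical_trivial hm i hA with h | h
    · rw [inter_eq_right.2 h, inter_eq_right.2 (hsub.trans h), hmass, hmass]
    · rw [h.inter_eq, (h.mono_right hsub).inter_eq]
      simp
  · have := setIntegral_canonicalBelief (ν := ν) (μ₀ := μ₀) l univ
    rwa [setIntegral_univ, univ_inter, hmass] at this
  · refine ae_of_all _ fun ω => ?_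
    by_cases h : ω ∈ Ioi (l : ℝ)
    · exact Or.inr (indicator_of_mem h (fun _ => noNewsBelief μ₀ (arrivalCDF μ₀ ν) l))
    · exact Or.inl (indicator_of_notMem h (fun _ => noNewsBelief μ₀ (arrivalCDF μ₀ ν) l))

end ArrivalCDF

/-! ### The arrival level of bad news -/

lemma Level.exists_between_dense {L : ℝ} {D : Set (Level L)} (hD : Dense D) {x y : ℝ}
    (hx : 0 ≤ x) (hxy : x < y) (hy : y ≤ L) : ∃ q ∈ D, x < (q : ℝ) ∧ (q : ℝ) < y := by
  obtain ⟨q, hq, h1, h2⟩ := hD.exists_between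
    (x := (⟨x, hx, hxy.le.trans hy⟩ : Level L)) (y := ⟨y, hx.trans hxy.le, hy⟩) hxy
  exact ⟨q, hq, h1, h2⟩

/-- `β` is the level at which bad news with arrival law `ν` on `[A, B]` arrives; it exceeds `L` if
the news never arrives. -/
structure IsArrival {L μ₀ : ℝ} {Ω : Type w} [MeasurableSpace Ω] (hL : 0 < L)
    (M : LearningProcess L μ₀ Ω) (ν : Measure ℝ) (A B : ℝ) (β : Ω → ℝ) : Prop where
  nonneg : ∀ ω, 0 ≤ β ω
  measurable : Measurable β
  lt_nat : ∀ (t : Level L) (x : ℝ), x ≤ t → MeasurableSet[M.nat t] {ω | β ω < x}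
  eq_zero_iff : ∀ᵐ ω ∂M.P, ∀ t : Level L, M.belief t ω = 0 ↔ β ω ≤ t
  belief_eq : ∀ t : Level L, ∀ᵐ ω ∂M.P, (t : ℝ) < β ω →
    M.belief t ω = noNewsBelief μ₀ (arrivalCDF μ₀ ν) t
  last_eq : ∀ᵐ ω ∂M.P, M.belief (lastLevel hL) ω ≠ 0 → M.belief (lastLevel hL) ω = 1
  mem : ∀ᵐ ω ∂M.P, M.belief (lastLevel hL) ω = 0 → β ω ∈ Icc A B
  law : (M.P.restrict {ω | M.belief (lastLevel hL) ω = 0}).map β = ENNReal.ofReal (1 - μ₀) • ν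

section Arrival

variable {L μ₀ A B : ℝ} {ν : Measure ℝ} [IsProbabilityMeasure ν] {Ω : Type w} [MeasurableSpace Ω]
  {M : LearningProcess L μ₀ Ω}

omit [IsProbabilityMeasure ν] in
/-- Once the belief is `0`, it stays there. -/
lemma LearningProcess.ae_eq_zero_of_le (M : LearningProcess L μ₀ Ω) {s t : Level L} (hst : s ≤ t) :
    ∀ᵐ ω ∂M.P, M.belief s ω = 0 → M.belief t ω = 0 := by
  have := M.isProb
  have hm : MeasurableSet[M.nat s] {ω | M.belief s ω = 0} :=
    M.measurable_belief_nat s (measurableSet_singleton 0)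
  have hm' := M.nat.le s _ hm
  -- The later belief has integral zero over the event that the earlier one is zero; being
  -- nonnegative, it vanishes there.
  have h1 := M.martingale.setIntegral_eq hst hm
  rw [setIntegral_congr_fun hm' (g := fun _ => (0 : ℝ)) (fun ω hω => hω), integral_zero] at h1
  have h2 := (setIntegral_eq_zero_iff_of_nonneg_ae (ae_of_all _ fun ω => (M.mem_Icc t ω).1)
    (LearningProcess.integrable_belief t).integrableOn).1 h1.symm
  exact (ae_restrict_iff' hm').1 h2

/-- There are two possible values and the mean is `μ₀`, so the probability of each is determined. -/
lemma measure_eq_zero_eq (hμ₀ : μ₀ ∈ Ioo (0 : ℝ) 1) (hM : IsBadNews (arrivalCDF μ₀ ν) M)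
    (t : Level L) : M.P.real {ω | M.belief t ω = 0} = arrivalCDF μ₀ ν t := by
  have := M.isProb
  have hm : MeasurableSet {ω | M.belief t ω = 0} :=
    M.measurable_belief t (measurableSet_singleton 0)
  have hpos := (noNewsBelief_mem (ν := ν) hμ₀ (t : ℝ)).1
  have h1 : ∫ ω, M.belief t ω ∂M.P =
      ∫ ω, {ω | M.belief t ω = 0}ᶜ.indicator
        (fun _ => noNewsBelief μ₀ (arrivalCDF μ₀ ν) t) ω ∂M.P := by
    refine integral_congr_ae ?_
    filter_upwards [hM t] with ω hω
    by_cases h0 : M.belief t ω = 0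
    · simp [h0]
    · rw [indicator_of_mem (by exact h0), hω.resolve_left h0]
  rw [M.prior, integral_indicator hm.compl, setIntegral_const, smul_eq_mul,
    probReal_compl_eq_one_sub hm] at h1
  have h2 := noNewsBelief_mul (ν := ν) hμ₀ (t : ℝ)
  have h3 : noNewsBelief μ₀ (arrivalCDF μ₀ ν) t ≠ 0 := (hμ₀.1.trans_le hpos).ne'
  have h4 : (1 - M.P.real {ω | M.belief t ω = 0}) = 1 - arrivalCDF μ₀ ν t := by
    apply mul_left_cancel₀ h3
    linarith
  linarith

/-- The arrival level is the infimum of the levels with belief `0`. Only countably many levels are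
inspected, so that the null sets on which beliefs misbehave can be united; right-continuity extends
the description to all levels. -/
theorem exists_isArrival (hμ₀ : μ₀ ∈ Ioo (0 : ℝ) 1) (hL : 0 < L)
    (hν : ∀ᵐ s ∂ν, s ∈ Icc A B) (hA : 0 ≤ A) (hB : B ≤ L)
    (hM : IsBadNews (arrivalCDF μ₀ ν) M) :
    ∃ β, IsArrival hL M ν A B β := by
  have := M.isProb
  obtain ⟨D₀, hDc₀, hD₀⟩ := TopologicalSpace.exists_countable_dense (Level L)
  -- Right-continuity says nothing at the last level, which is therefore inspected directly.
  set D : Set (Level L) := insert (lastLevel hL) D₀ with hDdef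
  have hDc : D.Countable := hDc₀.insert _
  have hD : Dense D := hD₀.mono (subset_insert _ _)
  have hlastD : lastLevel hL ∈ D := mem_insert _ _
  -- The default `L + 1` lies above every level and stands for news that never comes.
  set Z : Ω → Set ℝ := fun ω => insert (L + 1) {x | ∃ q ∈ D, (q : ℝ) = x ∧ M.belief q ω = 0} with hZ
  have hZne : ∀ ω, (Z ω).Nonempty := fun ω => ⟨L + 1, mem_insert _ _⟩
  have hZ0 : ∀ ω, ∀ x ∈ Z ω, 0 ≤ x := by
    rintro ω x (rfl | ⟨q, -, rfl, -⟩)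
    · linarith
    · exact q.2.1
  have hZb : ∀ ω, BddBelow (Z ω) := fun ω => ⟨0, fun x hx => hZ0 ω x hx⟩
  set β : Ω → ℝ := fun ω => sInf (Z ω) with hβ
  have hβlt : ∀ ω x, x ≤ L + 1 → (β ω < x ↔ ∃ q ∈ D, (q : ℝ) < x ∧ M.belief q ω = 0) := by
    intro ω x hx
    rw [hβ, csInf_lt_iff (hZb ω) (hZne ω)]
    constructor
    · rintro ⟨y, rfl | ⟨q, hq, rfl, h0⟩, hy⟩
      · linarith
      · exact ⟨q, hq, hy, h0⟩
    · rintro ⟨q, hq, hqx, h0⟩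
      exact ⟨q, Or.inr ⟨q, hq, rfl, h0⟩, hqx⟩
  have hβle : ∀ ω, β ω ≤ L + 1 := fun ω => csInf_le (hZb ω) (mem_insert _ _)
  have hset : ∀ x ≤ L + 1, {ω | β ω < x} = ⋃ q ∈ {q ∈ D | (q : ℝ) < x}, {ω | M.belief q ω = 0} := by
    intro x hx
    ext ω
    simp only [mem_ofPred_eq, mem_iUnion, exists_prop, hβlt ω x hx, and_assoc]
  have hltn : ∀ (t : Level L) (x : ℝ), x ≤ t → MeasurableSet[M.nat t] {ω | β ω < x} := by
    intro t x hx
    rw [hset x (by linarith [t.2.2])]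
    refine MeasurableSet.biUnion (hDc.mono fun q hq => hq.1) fun q hq => ?_
    exact M.measurable_belief_nat_of_le (Subtype.coe_le_coe.1 (hq.2.le.trans hx))
      (measurableSet_singleton 0)
  have hβm : Measurable β := by
    refine measurable_of_Iio fun x => ?_
    change MeasurableSet {ω | β ω < x}
    rcases le_or_gt x (L + 1) with hx | hx
    · rw [hset x hx]
      exact MeasurableSet.biUnion (hDc.mono fun q hq => hq.1) fun q hq =>
        M.measurable_belief q (measurableSet_singleton 0)
    · have : {ω | β ω < x} = univ := by
        ext ω; simp [(hβle ω).trans_lt hx]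
      rw [this]; exact MeasurableSet.univ
  have hval : ∀ᵐ ω ∂M.P, ∀ q ∈ D, M.belief q ω = 0 ∨
      M.belief q ω = noNewsBelief μ₀ (arrivalCDF μ₀ ν) q :=
    (ae_ball_iff hDc).2 fun q _ => hM q
  have habs : ∀ᵐ ω ∂M.P, ∀ q ∈ D, ∀ r ∈ D, q ≤ r → M.belief q ω = 0 → M.belief r ω = 0 := by
    refine (ae_ball_iff hDc).2 fun q _ => (ae_ball_iff hDc).2 fun r _ => ?_
    by_cases hqr : q ≤ r
    · filter_upwards [M.ae_eq_zero_of_le hqr] with ω h _ using h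
    · exact ae_of_all _ fun ω h => absurd h hqr
  have hiff : ∀ᵐ ω ∂M.P, ∀ t : Level L, M.belief t ω = 0 ↔ β ω ≤ t := by
    filter_upwards [hval, habs] with ω hv ha t
    have hbelow : ∀ q ∈ D, β ω < q → M.belief q ω = 0 := by
      intro q hq hlt
      obtain ⟨r, hr, hrq, h0⟩ := (hβlt ω q (by linarith [q.2.2])).1 hlt
      exact ha r hr q hq (Subtype.coe_le_coe.1 hrq.le) h0
    rcases eq_or_lt_of_le (le_lastLevel hL t) with rfl | hlt
    · constructor
      · intro h0
        exact csInf_le (hZb ω) (Or.inr ⟨_, hlastD, rfl, h0⟩)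
      · intro hle
        obtain ⟨r, hr, -, h0⟩ := (hβlt ω (L + 1) le_rfl).1
          (hle.trans_lt (by simp [lastLevel]))
        exact ha r hr _ hlastD (le_lastLevel hL r) h0
    · have hfreq : ∃ᶠ q in 𝓝[Ici t] t, q ∈ D ∧ t < q := by
        rw [frequently_iff]
        intro U hU
        obtain ⟨y, hy, hsub⟩ := (mem_nhdsGE_iff_exists_Ico_subset' hlt).1 hU
        obtain ⟨q, hq, h1, h2⟩ := hD.exists_between hy
        exact ⟨q, hsub ⟨h1.le, h2⟩, hq, h1⟩
      constructor
      · intro h0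
        refine le_of_forall_gt_imp_ge_of_dense fun x hx => ?_
        rcases le_or_gt (L + 1) x with hx' | hx'
        · exact (hβle ω).trans hx'
        -- The belief without news is at least `μ₀`, so a belief below `μ₀` at an inspected level
        -- must be `0`.
        have hev : ∀ᶠ q in 𝓝[Ici t] t, M.belief q ω < μ₀ :=
          (M.right_cont ω t).tendsto.eventually_lt_const (by rw [h0]; exact hμ₀.1)
        have hev2 : ∀ᶠ q : Level L in 𝓝[Ici t] t, (q : ℝ) < x :=
          nhdsWithin_le_nhds (continuous_subtype_val.continuousAt.eventually_lt_const hx)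
        obtain ⟨q, ⟨hq, -⟩, hq1, hq2⟩ := (hfreq.and_eventually (hev.and hev2)).exists
        have h0q : M.belief q ω = 0 := by
          refine (hv q hq).resolve_right fun he => ?_
          have := (noNewsBelief_mem (ν := ν) hμ₀ (q : ℝ)).1
          linarith
        exact ((hβlt ω x hx'.le).2 ⟨q, hq, hq2, h0q⟩).le
      · intro hle
        by_contra hne
        have hpos : 0 < M.belief t ω := lt_of_le_of_ne (M.mem_Icc t ω).1 (Ne.symm hne)
        -- A positive belief at `t` would stay positive just after `t`, yet it is `0` at all
        -- inspected levels after the arrival.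
        have hev : ∀ᶠ q in 𝓝[Ici t] t, 0 < M.belief q ω :=
          (M.right_cont ω t).tendsto.eventually_const_lt hpos
        obtain ⟨q, ⟨hq, htq⟩, hq1⟩ := (hfreq.and_eventually hev).exists
        exact hq1.ne' (hbelow q hq (hle.trans_lt htq))
  have hlast1 : ∀ᵐ ω ∂M.P, M.belief (lastLevel hL) ω ≠ 0 → M.belief (lastLevel hL) ω = 1 := by
    filter_upwards [hM (lastLevel hL)] with ω hω h0
    rw [hω.resolve_left h0, noNewsBelief, arrivalCDF_of_ge hμ₀ hν (l := lastLevel hL) hB, sub_sub_cancel,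
      div_self hμ₀.1.ne']
  have h1μ : 0 ≤ 1 - μ₀ := by linarith [hμ₀.2]
  have hlast0 : MeasurableSet {ω | M.belief (lastLevel hL) ω = 0} :=
    M.measurable_belief _ (measurableSet_singleton 0)
  have hlaw : (M.P.restrict {ω | M.belief (lastLevel hL) ω = 0}).map β =
      ENNReal.ofReal (1 - μ₀) • ν := by
    have hfin : IsFiniteMeasure (ENNReal.ofReal (1 - μ₀) • ν) := ⟨by
      simp [Measure.smul_apply]⟩
    refine Measure.ext_of_Iic _ _ fun x => ?_
    rw [Measure.map_apply hβm measurableSet_Iic, Measure.restrict_apply (hβm measurableSet_Iic),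
      Measure.smul_apply, smul_eq_mul, ← ofReal_measureReal (μ := ν) (s := Iic x) (by finiteness),
      ← ENNReal.ofReal_mul h1μ, ← arrivalCDF_apply hμ₀,
      ← ofReal_measureReal (μ := M.P) (by finiteness)]
    congr 1
    rcases lt_or_ge x 0 with hx | hx
    · have h1 : β ⁻¹' Iic x ∩ {ω | M.belief (lastLevel hL) ω = 0} = ∅ := by
        ext ω
        simp only [mem_inter_iff, mem_preimage, mem_Iic, mem_empty_iff_false, iff_false, not_and]
        intro h
        exact absurd (Real.sInf_nonneg (hZ0 ω)) (not_le.2 (h.trans_lt hx))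
      rw [h1, measureReal_empty, arrivalCDF_of_lt hμ₀ hν (hx.trans_le hA)]
    · set t : Level L := ⟨min x L, le_min hx hL.le, min_le_right _ _⟩ with ht
      have h1 : arrivalCDF μ₀ ν x = arrivalCDF μ₀ ν t := by
        rcases le_total x L with h | h
        · simp only [ht, min_eq_left h]
        · simp only [ht, min_eq_right h]
          rw [arrivalCDF_of_ge hμ₀ hν (hB.trans h), arrivalCDF_of_ge hμ₀ hν hB]
      rw [h1, ← measure_eq_zero_eq hμ₀ hM t]
      refine measureReal_congr ?_
      filter_upwards [hiff] with ω hω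
      refine propext (?_ : (β ω ≤ x ∧ M.belief (lastLevel hL) ω = 0) ↔ M.belief t ω = 0)
      rw [hω, hω, ht, ← le_min_iff]
      rfl
  refine ⟨β, fun ω => Real.sInf_nonneg (hZ0 ω), hβm, hltn, hiff, fun t => ?_, hlast1, ?_, hlaw⟩
  · filter_upwards [hM t, hiff] with ω h1 h2 hlt
    exact h1.resolve_left fun h0 => absurd ((h2 t).1 h0) (not_le.2 hlt)
  · have h1 : ∀ᵐ s ∂((M.P.restrict {ω | M.belief (lastLevel hL) ω = 0}).map β), s ∈ Icc A B := by
      rw [hlaw]; exact Measure.ae_smul_measure hν _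
    exact (ae_restrict_iff' hlast0).1 ((ae_map_iff hβm.aemeasurable measurableSet_Icc).1 h1)

end Arrival

/-! ### The agent's choice under bad news -/

/-- The events that, up to null sets, contain `S` or are disjoint from it. -/
@[reducible] def aeConstantOn {α : Type*} [MeasurableSpace α] (P : Measure α) (S : Set α) :
    MeasurableSpace α where
  MeasurableSet' A := (∀ᵐ ω ∂P, ω ∈ S → ω ∈ A) ∨ (∀ᵐ ω ∂P, ω ∈ S → ω ∉ A)
  measurableSet_empty := Or.inr (ae_of_all _ fun _ _ => notMem_empty _)
  measurableSet_compl A hA := by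
    rcases hA with h | h
    · exact Or.inr (h.mono fun ω h hS => not_not.2 (h hS))
    · exact Or.inl (h.mono fun ω h hS => h hS)
  measurableSet_iUnion A hA := by
    by_cases h : ∃ i, ∀ᵐ ω ∂P, ω ∈ S → ω ∈ A i
    · obtain ⟨i, hi⟩ := h
      exact Or.inl (hi.mono fun ω h hS => mem_iUnion.2 ⟨i, h hS⟩)
    · refine Or.inr ?_
      have := ae_all_iff.2 fun i => (hA i).resolve_left (not_exists.1 h i)
      filter_upwards [this] with ω hω hS
      simp only [mem_iUnion, not_exists]
      exact fun i => hω i hS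

namespace IsArrival

variable {L μ₀ A B : ℝ} {ν : Measure ℝ} {Ω : Type w} [MeasurableSpace Ω]
  {M : LearningProcess L μ₀ Ω} {hL : 0 < L} {β : Ω → ℝ} (hβ : IsArrival hL M ν A B β)

include hβ

/-- In the absence of bad news nothing else is learnt. -/
lemma trivial_of_lt {t : Level L} {E : Set Ω} (hE : MeasurableSet[M.nat t] E) :
    (∀ᵐ ω ∂M.P, (t : ℝ) < β ω → ω ∈ E) ∨ (∀ᵐ ω ∂M.P, (t : ℝ) < β ω → ω ∉ E) := by
  have hle : M.nat t ≤ aeConstantOn M.P {ω | (t : ℝ) < β ω} := by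
    refine iSup₂_le fun s hs => ?_
    rintro _ ⟨F, -, rfl⟩
    have hc : ∀ᵐ ω ∂M.P, (t : ℝ) < β ω →
        M.belief s ω = noNewsBelief μ₀ (arrivalCDF μ₀ ν) s :=
      (hβ.belief_eq s).mono fun ω h hlt => h (lt_of_le_of_lt (show (s : ℝ) ≤ t from hs) hlt)
    by_cases hF : noNewsBelief μ₀ (arrivalCDF μ₀ ν) s ∈ F
    · refine Or.inl (hc.mono fun ω h hω => ?_)
      rw [mem_preimage, h hω]; exact hF
    · refine Or.inr (hc.mono fun ω h hω => ?_)
      rw [mem_preimage, h hω]; exact hF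
  exact hle E hE

/-- A stopping level is deterministic before bad news arrives. -/
lemma exists_deterministic {τ : Ω → Level L} (hτ : M.IsOptional τ) :
    ∃ c ∈ Icc 0 L, ∀ᵐ ω ∂M.P, (c < β ω → (τ ω : ℝ) = c) ∧ (β ω ≤ c → β ω ≤ τ ω) := by
  obtain ⟨D, hDc, hD⟩ := TopologicalSpace.exists_countable_dense (Level L)
  -- The levels before which the agent has almost surely stopped when no news has come; their
  -- infimum is the planned level `c`. Before it, triviality of information forces her almost surely
  -- not to stop, and `L` is the default if there is no such level.
  set Z : Set ℝ := insert L {x | ∃ t : Level L, (t : ℝ) = x ∧ ∀ᵐ ω ∂M.P, (t : ℝ) < β ω → τ ω < t}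
    with hZ
  have hZ0 : ∀ x ∈ Z, 0 ≤ x := by
    rintro x (rfl | ⟨t, rfl, -⟩)
    · exact hL.le
    · exact t.2.1
  have hZb : BddBelow Z := ⟨0, fun x hx => hZ0 x hx⟩
  have hZne : Z.Nonempty := ⟨L, mem_insert _ _⟩
  have hcL : sInf Z ≤ L := csInf_le hZb (mem_insert _ _)
  have hc0 : 0 ≤ sInf Z := Real.sInf_nonneg hZ0
  have h1 : ∀ᵐ ω ∂M.P, ∀ q ∈ D, (q : ℝ) < sInf Z → (q : ℝ) < β ω → q ≤ τ ω := by
    refine (ae_ball_iff hDc).2 fun q _ => ?_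
    by_cases hq : (q : ℝ) < sInf Z
    · rcases hβ.trivial_of_lt (hτ q) with h | h
      · exact absurd (csInf_le hZb (Or.inr ⟨q, rfl, h⟩)) (not_le.2 hq)
      · exact h.mono fun _ h _ hlt => not_lt.1 (h hlt)
    · exact ae_of_all _ fun ω h => absurd h hq
  have h2 : ∀ᵐ ω ∂M.P, ∀ q ∈ D, sInf Z < (q : ℝ) → (q : ℝ) < β ω → τ ω < q := by
    refine (ae_ball_iff hDc).2 fun q _ => ?_
    by_cases hq : sInf Z < (q : ℝ)
    · obtain ⟨x, hx, hxq⟩ := (csInf_lt_iff hZb hZne).1 hq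
      rcases hx with rfl | ⟨t, rfl, ht⟩
      · exact absurd hxq (not_lt.2 q.2.2)
      · exact ht.mono fun _ h _ hlt => (h (hxq.trans hlt)).trans hxq
    · exact ae_of_all _ fun ω h => absurd h hq
  refine ⟨sInf Z, ⟨hc0, hcL⟩, ?_⟩
  filter_upwards [h1, h2] with ω g1 g2
  refine ⟨fun hlt => le_antisymm ?_ ?_, fun hle => ?_⟩
  · by_contra! hcon
    obtain ⟨q, hq, hq1, hq2⟩ := Level.exists_between_dense hD hc0 (lt_min hcon hlt)
      ((min_le_left _ _).trans (τ ω).2.2)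
    have : (τ ω : ℝ) < q := g2 q hq hq1 (hq2.trans_le (min_le_right _ _))
    exact absurd (hq2.trans_le (min_le_left _ _)) (not_lt.2 this.le)
  · by_contra! hcon
    obtain ⟨q, hq, hq1, hq2⟩ := Level.exists_between_dense hD (τ ω).2.1 hcon hcL
    have : (q : ℝ) ≤ τ ω := g1 q hq hq2 (hq2.trans hlt)
    linarith
  · by_contra! hcon
    obtain ⟨q, hq, hq1, hq2⟩ := Level.exists_between_dense hD (τ ω).2.1 hcon (hle.trans hcL)
    have : (q : ℝ) ≤ τ ω := g1 q hq (hq2.trans_le hle) hq2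
    linarith

lemma lt_of_ne_zero : ∀ᵐ ω ∂M.P, M.belief (lastLevel hL) ω ≠ 0 → L < β ω :=
  hβ.eq_zero_iff.mono fun _ h hne => not_le.1 fun hle => hne ((h (lastLevel hL)).2 hle)

/-- Expectations of functions of the arrival level. -/
lemma integral_ite [IsProbabilityMeasure ν] (hμ₀ : μ₀ ∈ Ioo (0 : ℝ) 1) (hAB : A ≤ B)
    {f : ℝ → ℝ} (hf : BoundedMeasurableOn f A B) (k : ℝ) :
    Integrable (fun ω => if M.belief (lastLevel hL) ω = 0 then f (β ω) else k) M.P ∧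
    ∫ ω, (if M.belief (lastLevel hL) ω = 0 then f (β ω) else k) ∂M.P =
      μ₀ * k + (1 - μ₀) * ∫ s, f s ∂ν := by
  classical
  have := M.isProb
  have h1μ : 0 ≤ 1 - μ₀ := by linarith [hμ₀.2]
  set E := {ω | M.belief (lastLevel hL) ω = 0} with hE
  have hEm : MeasurableSet E := M.measurable_belief _ (measurableSet_singleton 0)
  have hPE : M.P.real E = 1 - μ₀ := by
    have := congrArg (fun κ => κ univ) hβ.law
    simp only [Measure.map_apply hβ.measurable MeasurableSet.univ, preimage_univ,
      Measure.restrict_apply_univ, Measure.smul_apply, measure_univ, smul_eq_mul, mul_one] at this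
    rw [measureReal_def, this, ENNReal.toReal_ofReal h1μ]
  set F : Ω → ℝ := fun ω => if M.belief (lastLevel hL) ω = 0 then f (clamp A B (β ω)) else k with hF
  have hFm : Measurable F := Measurable.ite hEm (hf.measurable.comp hβ.measurable) measurable_const
  obtain ⟨C, hC⟩ := hf.bounded
  have hFi : Integrable F M.P := Integrable.of_bound hFm.aestronglyMeasurable (max C |k|)
    (ae_of_all _ fun ω => by
      simp only [hF]
      split_ifs
      · exact (hC _ (clamp_mem hAB _)).trans (le_max_left _ _)
      · exact le_max_right _ _)
  have hFe : F =ᵐ[M.P] fun ω => if M.belief (lastLevel hL) ω = 0 then f (β ω) else k := by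
    filter_upwards [hβ.mem] with ω hω
    simp only [hF]
    split_ifs with h0
    · rw [clamp_of_mem (hω h0)]
    · rfl
  refine ⟨hFi.congr hFe, ?_⟩
  rw [← integral_congr_ae hFe, ← integral_add_compl hEm hFi]
  have e1 : ∫ ω in E, F ω ∂M.P = (1 - μ₀) * ∫ s, f s ∂ν := by
    have e : ∫ ω in E, F ω ∂M.P = ∫ ω in E, f (clamp A B (β ω)) ∂M.P :=
      setIntegral_congr_fun hEm fun ω hω => if_pos hω
    rw [e, ← integral_map (f := fun s => f (clamp A B s)) hβ.measurable.aemeasurable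
      hf.measurable.aestronglyMeasurable, hβ.law, integral_smul_measure,
      ENNReal.toReal_ofReal h1μ, smul_eq_mul]
    congr 1
    refine integral_congr_ae ?_
    have h1 : ∀ᵐ s ∂(ENNReal.ofReal (1 - μ₀) • ν), s ∈ Icc A B := by
      rw [← hβ.law]
      exact (ae_map_iff hβ.measurable.aemeasurable measurableSet_Icc).2
        ((ae_restrict_iff' hEm).2 hβ.mem)
    have h2 : ∀ᵐ s ∂ν, s ∈ Icc A B := by
      rwa [Measure.ae_ennreal_smul_measure_iff (by
        simp only [ne_eq, ENNReal.ofReal_eq_zero, not_le]; linarith [hμ₀.2])] at h1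
    filter_upwards [h2] with s hs
    rw [clamp_of_mem hs]
  have e2 : ∫ ω in Eᶜ, F ω ∂M.P = μ₀ * k := by
    have e : ∫ ω in Eᶜ, F ω ∂M.P = ∫ _ in Eᶜ, k ∂M.P :=
      setIntegral_congr_fun hEm.compl fun ω hω => if_neg hω
    rw [e, setIntegral_const, smul_eq_mul, probReal_compl_eq_one_sub hEm, hPE]
    ring
  rw [e1, e2, add_comm]

end IsArrival

namespace Regular

variable {L : ℝ} {a b : Fin 2 → ℝ → ℝ} {p : ℝ → ℝ} {R : ℝ} (h : Regular L a b p R)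

include h

lemma boundedMeasurableOn_a_min {c : ℝ} (hc : p 0 ≤ c) :
    BoundedMeasurableOn (fun s => a 0 (min s c)) (p 0) (p 1) :=
  boundedMeasurableOn_of_continuousOn h.peak_zero_le_one
    ((h.cont_a 0).comp (by fun_prop) fun _ hs =>
      ⟨le_min hs.1 hc, (min_le_left _ _).trans (hs.2.trans h.one_le)⟩)

lemma integrable_of_supp {ν : Measure ℝ} [IsFiniteMeasure ν] (hν : ∀ᵐ s ∂ν, s ∈ Icc (p 0) (p 1))
    {f : ℝ → ℝ} (hf : BoundedMeasurableOn f (p 0) (p 1)) : Integrable f ν :=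
  hf.integrable_comp h.peak_zero_le_one aemeasurable_id hν (ae_of_all _ fun _ => rfl)

/-- Under an obedient law stopping at `c` in the absence of news is not profitable. -/
lemma stop_le {μ₀ : ℝ} (hμ₀ : μ₀ ∈ Ioo (0 : ℝ) 1) {ν : Measure ℝ} (hν : Obedient μ₀ a p ν) {c : ℝ}
    (hc : c ∈ Icc (p 0) L) :
    μ₀ * a 1 c + (1 - μ₀) * ∫ s, a 0 (min s c) ∂ν ≤
      μ₀ * a 1 (p 1) + (1 - μ₀) * ∫ s, a 0 s ∂ν ∧
    (p 1 < c → μ₀ * a 1 c + (1 - μ₀) * ∫ s, a 0 (min s c) ∂ν <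
      μ₀ * a 1 (p 1) + (1 - μ₀) * ∫ s, a 0 s ∂ν) := by
  have := hν.prob
  have hlate : p 1 < c → μ₀ * a 1 c + (1 - μ₀) * ∫ s, a 0 (min s c) ∂ν <
      μ₀ * a 1 (p 1) + (1 - μ₀) * ∫ s, a 0 s ∂ν := by
    intro hlt
    have h1 := h.a_one_lt ⟨hlt, hc.2⟩
    have h2 : ∫ s, a 0 (min s c) ∂ν = ∫ s, a 0 s ∂ν := by
      refine integral_congr_ae ?_
      filter_upwards [hν.supp] with s hs
      rw [min_eq_left (hs.2.trans hlt.le)]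
    rw [h2]
    nlinarith [hμ₀.1]
  refine ⟨?_, hlate⟩
  rcases lt_or_ge (p 1) c with hlt | hle
  · exact (hlate hlt).le
  · have h1 := hν.obey c ⟨hc.1, hle⟩
    -- The obedience constraint at `c` compares outcomes only for arrivals after `c`; earlier
    -- arrivals contribute zero in both forms.
    have h2 : ∫ s, (a 0 (max c s) - a 0 c) ∂ν = ∫ s, (a 0 s - a 0 (min s c)) ∂ν := by
      refine integral_congr_ae (ae_of_all _ fun s => ?_)
      rcases le_total s c with hs | hs
      · simp [hs]
      · simp [hs]
    have ha : BoundedMeasurableOn (a 0) (p 0) (p 1) :=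
      boundedMeasurableOn_of_continuousOn h.peak_zero_le_one
        ((h.cont_a 0).mono (Icc_subset_Icc_right h.one_le))
    rw [h2, integral_sub (h.integrable_of_supp hν.supp ha)
      (h.integrable_of_supp hν.supp (h.boundedMeasurableOn_a_min hc.1))] at h1
    linarith

end Regular

/-! ### Best reply to bad news with an obedient law -/

namespace Setting

variable {L μ₀ : ℝ} {u v : Fin 2 → ℝ → ℝ} {φ : ℝ → EReal} {p : ℝ → ℝ} {R : ℝ}
  (S : Setting L u v φ p R) {Ω : Type w} [MeasurableSpace Ω] {M : LearningProcess L μ₀ Ω}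
  {ν : Measure ℝ} {β : Ω → ℝ}

include S

/-- The agent's payoff from a stopping level is at most that from stopping at `c` in the absence of
news, and upon bad news otherwise. -/
lemma exists_indirect_le (hβ : IsArrival S.pos M ν (p 0) (p 1) β) {τ : Ω → Level L}
    (hadm : IsStoppingLevel φ M τ) :
    ∃ c ∈ Icc 0 L, ∀ᵐ ω ∂M.P, (c < β ω → (τ ω : ℝ) = c) ∧ (β ω ≤ c → β ω ≤ τ ω) ∧
      indirect (agentNet u φ) (M.belief (lastLevel S.pos) ω) (τ ω) ≤
        if M.belief (lastLevel S.pos) ω = 0 then agentNet u φ 0 (min (β ω) (max c (p 0)))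
        else agentNet u φ 1 (max c (p 0)) := by
  have hreg := S.reg
  obtain ⟨c, hc, hcβ⟩ := hβ.exists_deterministic (LearningProcess.isOptional_iff.2 hadm.stopping)
  refine ⟨c, hc, ?_⟩
  filter_upwards [hcβ, hadm.finite, hβ.mem, hβ.lt_of_ne_zero, hβ.last_eq]
    with ω h1 hfin hmem hlt hone
  refine ⟨h1.1, h1.2, ?_⟩
  split_ifs with h0
  · rw [h0, indirect_zero]
    obtain ⟨hβ0, hβ1⟩ := hmem h0
    -- In state `0` she cannot stop before both the news and her planned level `c`. Stopping before
    -- `p 0` is no better than at `p 0`, whence the `max c (p 0)`; from `p 0` on, delay is harmful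
    -- in state `0`.
    have hτ : min (β ω) c ≤ τ ω := by
      rcases le_or_gt (β ω) c with h | h
      · rw [min_eq_left h]; exact h1.2 h
      · rw [min_eq_right h.le, h1.1 h]
    rcases le_or_gt (p 0) (τ ω : ℝ) with hp | hp
    · refine hreg.anti_a_zero ⟨le_min hβ0 (le_max_right _ _), (min_le_left _ _).trans
        (hβ1.trans hreg.one_le)⟩ ⟨hp, (τ ω).2.2⟩ ?_
      rw [min_max_distrib_left]
      exact max_le hτ ((min_le_right _ _).trans hp)
    · have hcp : c < p 0 := by
        rcases min_le_iff.1 (hτ.trans hp.le) with h | h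
        · by_contra! hcon
          exact absurd (hτ.trans_lt hp) (not_lt.2 (le_min hβ0 hcon))
        · by_contra! hcon
          exact absurd (hτ.trans_lt hp) (not_lt.2 (le_min hβ0 hcon))
      rw [max_eq_right hcp.le, min_eq_right hβ0]
      have := S.le_of_le 0 (by simp) (τ ω) (p 0) (τ ω).2.1 hp.le le_rfl hfin
      simpa only [indirect_zero] using this
  · have hτ := h1.1 (hc.2.trans_lt (hlt h0))
    rw [hone h0, indirect_one]
    rcases le_total (p 0) c with hp | hp
    · rw [max_eq_left hp, hτ]
    · rw [max_eq_right hp]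
      have := S.le_of_le 1 (by simp) (τ ω) (p 0) (τ ω).2.1 (by rw [hτ]; exact hp)
        hreg.peak_zero_le_one hfin
      simpa only [indirect_one] using this

/-- The stopping level of the agent in the bad news process. -/
lemma exists_badNews_choice (hβ : IsArrival S.pos M ν (p 0) (p 1) β) :
    ∃ τ : Ω → Level L, M.IsOptional τ ∧ ∀ᵐ ω ∂M.P,
      (M.belief (lastLevel S.pos) ω = 0 → (τ ω : ℝ) = if β ω < p 1 then β ω else R) ∧
      (M.belief (lastLevel S.pos) ω ≠ 0 → (τ ω : ℝ) = p 1) := by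
  classical
  have hreg := S.reg
  have hT : p 1 ∈ Icc 0 L := ⟨hreg.nonneg.trans hreg.peak_zero_le_one, hreg.one_le⟩
  have hR : R ∈ Icc 0 L := ⟨hT.1.trans hreg.le_R, hreg.R_le⟩
  set T : Level L := ⟨p 1, hT⟩ with hTdef
  -- News at `p 1` itself has to be recognized at that level, so it is read off the belief there and
  -- not off the event `β ω = p 1`.
  set x : Ω → ℝ := fun ω => if β ω < p 1 then β ω else if M.belief T ω = 0 then R else p 1 with hx
  have hxmem : ∀ ω, x ω ∈ Icc 0 L := by
    intro ω
    simp only [hx]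
    split_ifs with h1 h2
    · exact ⟨hβ.nonneg ω, h1.le.trans hT.2⟩
    · exact hR
    · exact hT
  refine ⟨fun ω => ⟨x ω, hxmem ω⟩, fun t => ?_, ?_⟩
  · have e : {ω | (⟨x ω, hxmem ω⟩ : Level L) < t} = {ω | x ω < t} := rfl
    rw [e]
    rcases le_or_gt (t : ℝ) (p 1) with ht | ht
    · have : {ω | x ω < t} = {ω | β ω < t} := by
        ext ω
        simp only [mem_ofPred_eq, hx]
        constructor
        · intro h
          split_ifs at h with h1 h2
          · exact h
          · exact absurd h (not_lt.2 (ht.trans hreg.le_R))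
          · exact absurd h (not_lt.2 ht)
        · intro h
          rwa [if_pos (h.trans_le ht)]
      rw [this]
      exact hβ.lt_nat t t le_rfl
    · have hTt : T ≤ t := ht.le
      have m1 : MeasurableSet[M.nat t] {ω | β ω < p 1} := M.nat.mono hTt _ (hβ.lt_nat T _ le_rfl)
      have m2 : MeasurableSet[M.nat t] {ω | M.belief T ω = 0} :=
        M.nat.mono hTt _ (M.measurable_belief_nat T (measurableSet_singleton 0))
      rcases lt_or_ge R (t : ℝ) with hRt | hRt
      · have : {ω | x ω < t} = univ := by
          ext ω
          simp only [mem_ofPred_eq, mem_univ, iff_true, hx]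
          split_ifs with h1 h2
          · exact h1.trans ht
          · exact hRt
          · exact ht
        rw [this]; exact MeasurableSet.univ
      · have : {ω | x ω < t} = {ω | β ω < p 1} ∪ {ω | M.belief T ω = 0}ᶜ := by
          ext ω
          simp only [mem_ofPred_eq, mem_union, mem_compl_iff, hx]
          split_ifs with h1 h2
          · simp [h1, h1.trans ht]
          · simp [h1, h2, hRt]
          · simp [h2, ht]
        rw [this]
        exact m1.union m2.compl
  · filter_upwards [hβ.eq_zero_iff, hβ.mem, hβ.lt_of_ne_zero] with ω h1 h2 h3
    refine ⟨fun h0 => ?_, fun h0 => ?_⟩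
    · simp only [hx]
      split_ifs with h4 h5
      · rfl
      · rfl
      · exact absurd ((h1 T).2 (h2 h0).2) h5
    · have h4 := h3 h0
      simp only [hx]
      rw [if_neg (not_lt.2 (hT.2.trans h4.le)), if_neg fun h5 => ?_]
      exact absurd ((h1 T).1 h5) (not_le.2 (hT.2.trans_lt h4))

/-- Any plan is bounded by stopping at some fixed level without news and upon news otherwise, and
obedience says that `p 1` is the best such level. A tie forces the bound to be attained almost
surely, which leaves no room for stopping later. -/
theorem isAgentChoice_badNews (hμ₀ : μ₀ ∈ Ioo (0 : ℝ) 1) (hν : Obedient μ₀ (agentNet u φ) p ν)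
    (hβ : IsArrival S.pos M ν (p 0) (p 1) β) {τ : Ω → Level L} (hτ : M.IsOptional τ)
    (hτβ : ∀ᵐ ω ∂M.P,
      (M.belief (lastLevel S.pos) ω = 0 → (τ ω : ℝ) = if β ω < p 1 then β ω else R) ∧
      (M.belief (lastLevel S.pos) ω ≠ 0 → (τ ω : ℝ) = p 1)) :
    IsAgentChoice u φ M τ ∧
      principalValue v φ M τ = badNewsValue μ₀ (principalNet v φ) p R ν := by
  have := M.isProb
  have := hν.prob
  have hreg := S.reg
  have h01 := hreg.peak_zero_le_one
  have hadm : IsStoppingLevel φ M τ := by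
    refine S.isStoppingLevel hτ ?_
    filter_upwards [hτβ, hβ.mem] with ω h1 h2
    by_cases h0 : M.belief (lastLevel S.pos) ω = 0
    · rw [h1.1 h0]
      split_ifs
      · exact (h2 h0).1
      · exact h01.trans hreg.le_R
    · rw [h1.2 h0]; exact h01
  have ha : BoundedMeasurableOn (agentNet u φ 0) (p 0) (p 1) :=
    boundedMeasurableOn_of_continuousOn h01
      ((hreg.cont_a 0).mono (Icc_subset_Icc_right hreg.one_le))
  have hval : agentValue u φ M τ =
      μ₀ * agentNet u φ 1 (p 1) + (1 - μ₀) * ∫ s, agentNet u φ 0 s ∂ν := by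
    rw [(S.agentValue_eq hτ hτ.measurable_past hadm).2.2.2, ← (hβ.integral_ite hμ₀ h01 ha _).2]
    refine integral_congr_ae ?_
    filter_upwards [hτβ, hβ.mem, hβ.last_eq] with ω h1 h2 h3
    split_ifs with h0
    · rw [h0, indirect_zero, h1.1 h0]
      split_ifs with h4
      · rfl
      · rw [hreg.a_R, le_antisymm (h2 h0).2 (not_lt.1 h4)]
    · rw [h3 h0, indirect_one, h1.2 h0]
  refine ⟨⟨hadm, fun τ' hadm' => ?_, fun τ' hadm' heq => ?_⟩, ?_⟩
  · have hτ' : M.IsOptional τ' := LearningProcess.isOptional_iff.2 hadm'.stopping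
    obtain ⟨c, hc, hcω⟩ := S.exists_indirect_le hβ hadm'
    obtain ⟨-, i2, -, i4⟩ := S.agentValue_eq hτ' hτ'.measurable_past hadm'
    have hc' : max c (p 0) ∈ Icc (p 0) L := ⟨le_max_right _ _, max_le hc.2 (h01.trans hreg.one_le)⟩
    obtain ⟨j1, j2⟩ := hβ.integral_ite hμ₀ h01 (hreg.boundedMeasurableOn_a_min hc'.1)
      (agentNet u φ 1 (max c (p 0)))
    rw [i4, hval]
    refine (integral_mono_ae i2 j1 (hcω.mono fun ω h => h.2.2)).trans ?_
    rw [j2]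
    exact (hreg.stop_le hμ₀ hν hc').1
  · have hτ' : M.IsOptional τ' := LearningProcess.isOptional_iff.2 hadm'.stopping
    obtain ⟨c, hc, hcω⟩ := S.exists_indirect_le hβ hadm'
    obtain ⟨-, i2, -, i4⟩ := S.agentValue_eq hτ' hτ'.measurable_past hadm'
    have hc' : max c (p 0) ∈ Icc (p 0) L := ⟨le_max_right _ _, max_le hc.2 (h01.trans hreg.one_le)⟩
    obtain ⟨j1, j2⟩ := hβ.integral_ite hμ₀ h01 (hreg.boundedMeasurableOn_a_min hc'.1)
      (agentNet u φ 1 (max c (p 0)))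
    rw [i4, hval] at heq
    have hle := integral_mono_ae i2 j1 (hcω.mono fun ω h => h.2.2)
    have hvalue := hreg.stop_le hμ₀ hν hc'
    -- Planning to stop after `p 1` strictly loses in state `1`, which an optimal plan cannot
    -- afford.
    have hcT : max c (p 0) ≤ p 1 := by
      by_contra! hcon
      have := hvalue.2 hcon
      rw [← j2] at this
      linarith
    have hae := (integral_eq_iff_of_ae_le i2 j1 (hcω.mono fun ω h => h.2.2)).1
      (le_antisymm hle (by rw [heq, j2]; exact hvalue.1))
    filter_upwards [hcω, hae, hτβ, hβ.mem, hβ.lt_of_ne_zero] with ω h1 h2 h3 h4 h5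
    refine Subtype.coe_le_coe.1 ?_
    by_cases h0 : M.belief (lastLevel S.pos) ω = 0
    · obtain ⟨hβ0, hβ1⟩ := h4 h0
      rw [h3.1 h0]
      rcases lt_or_ge c (β ω) with hcβ | hcβ
      · rw [h1.1 hcβ]
        split_ifs
        · exact hcβ.le
        · exact hcβ.le.trans (hβ1.trans hreg.le_R)
      · have hle' := h1.2.1 hcβ
        simp only [h0, if_true, indirect_zero, min_eq_left (hcβ.trans (le_max_left c (p 0)))] at h2
        -- After news before `p 1` any delay is strictly costly; after news at `p 1` the ties extend
        -- exactly up to `R`.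
        split_ifs with h6
        · by_contra! hcon
          exact absurd h2 (hreg.a_zero_lt ⟨hβ0, h6⟩ hcon (τ' ω).2.2).ne
        · have hβT := le_antisymm hβ1 (not_lt.1 h6)
          rw [hβT] at h2 hle'
          exact hreg.le_R_of_eq _ ⟨hle', (τ' ω).2.2⟩ h2
    · rw [h3.2 h0, h1.1 (hc.2.trans_lt (h5 h0))]
      exact (le_max_left _ _).trans hcT
  · rw [(S.principalValue_eq hadm).2.2, badNewsValue,
      ← (hβ.integral_ite hμ₀ h01 hreg.boundedMeasurableOn_payoff _).2]
    refine integral_congr_ae ?_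
    filter_upwards [hτβ, hβ.mem, hβ.last_eq] with ω h1 h2 h3
    split_ifs with h0
    · rw [h0, indirect_zero, h1.1 h0, badNewsPayoff]
      split_ifs <;> rfl
    · rw [h3 h0, indirect_one, h1.2 h0]

/-- The bad news process of a law that is worst among the obedient ones is a worst case. -/
theorem isWorstCaseBadNews (hμ₀ : μ₀ ∈ Ioo (0 : ℝ) 1) (hν : Obedient μ₀ (agentNet u φ) p ν)
    (hmin : ∀ ν', Obedient μ₀ (agentNet u φ) p ν' →
      badNewsValue μ₀ (principalNet v φ) p R ν ≤ badNewsValue μ₀ (principalNet v φ) p R ν') :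
    IsWorstCaseBadNews.{w₁, w₂} L μ₀ u v φ (arrivalCDF μ₀ ν) := by
  have := hν.prob
  obtain ⟨M₀, hM₀⟩ := exists_badNews (L := L) (ν := ν) hμ₀
  refine ⟨⟨ℝ, inferInstance, M₀, hM₀⟩, ?_⟩
  intro Ω _ M hM
  obtain ⟨β, hβ⟩ := exists_isArrival hμ₀ S.pos hν.supp S.reg.nonneg S.reg.one_le hM
  obtain ⟨τ, hτ, hτβ⟩ := S.exists_badNews_choice hβ
  obtain ⟨h1, h2⟩ := S.isAgentChoice_badNews hμ₀ hν hβ hτ hτβ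
  refine ⟨τ, h1, ?_⟩
  intro Ω' _ M' τ' hc'
  obtain ⟨ν', hν', hle⟩ := S.exists_obedient_le_principalValue hμ₀ hc'
  rw [h2]
  exact (hmin ν' hν').trans hle

end Setting

/-! ### The law that keeps the agent indifferent -/

/-- An obedient law that, from `p μ₀` on, keeps the agent indifferent until `p 1` in the absence of
bad news. -/
structure Gradual (μ₀ : ℝ) (a : Fin 2 → ℝ → ℝ) (p : ℝ → ℝ) (ν : Measure ℝ) : Prop where
  obedient : Obedient μ₀ a p ν
  ge : ∀ᵐ s ∂ν, p μ₀ ≤ s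
  indifferent : ∀ l ∈ Icc (p μ₀) (p 1),
    μ₀ * (a 1 (p 1) - a 1 l) + (1 - μ₀) * ∫ s, (a 0 (max l s) - a 0 l) ∂ν = 0
  pos : ∀ x y, p μ₀ ≤ x → x < y → y ≤ p 1 → ν (Ioo x y) ≠ 0

namespace Regular

variable {L : ℝ} {a b : Fin 2 → ℝ → ℝ} {p : ℝ → ℝ} {R : ℝ} (h : Regular L a b p R)

include h

/-- Reveal state `0` gradually from belief `μ₀` and level `p μ₀`. By the envelope formula the
surplus over stopping at `l` is `indirect a μ₀ (max l (p μ₀)) - indirect a μ₀ l`, which is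
nonnegative and vanishes from `p μ₀` on. -/
theorem exists_gradual {μ₀ : ℝ} (hμ₀ : μ₀ ∈ Ioo (0 : ℝ) 1) : ∃ ν, Gradual μ₀ a p ν := by
  have hμ : μ₀ ∈ Icc (0 : ℝ) 1 := ⟨hμ₀.1.le, hμ₀.2.le⟩
  have hc : 0 < 1 - μ₀ := by linarith [hμ₀.2]
  have hL : Icc (p 0) (p 1) ⊆ Icc (p 0) L := Icc_subset_Icc_right h.one_le
  obtain ⟨ν, hprob, hsupp, hν⟩ := exists_arrival_law h (P := (Measure.dirac () : Measure Unit))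
    (m := fun _ => μ₀) (y := fun _ => p μ₀) measurable_const measurable_const
    (ae_of_all _ fun _ => hμ) (ae_of_all _ fun _ => h.peak_mem hμ) hμ₀ (by simp)
  have hν' : ∀ g, BoundedMeasurableOn g (p 0) (p 1) → (1 - μ₀) * ∫ s, g s ∂ν =
      ∫ z in (0 : ℝ)..(1 - μ₀), g (arrival p μ₀ (p μ₀) z) := fun g hg => by
    simpa using (hν g hg).2
  have hcm : ∀ g : ℝ → ℝ, Continuous g → BoundedMeasurableOn g (p 0) (p 1) := fun g hg =>
    boundedMeasurableOn_of_continuousOn h.peak_zero_le_one hg.continuousOn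
  have hnull : ∀ g : ℝ → ℝ, Continuous g → (∀ s, 0 ≤ g s) → ∫ s, g s ∂ν = 0 →
      ∀ᵐ s ∂ν, g s = 0 := fun g hg h0 he =>
    (integral_eq_zero_iff_of_nonneg h0 (h.integrable_of_supp hsupp (hcm g hg))).1 he
  have hvalue : ∀ l ∈ Icc (p 0) (p 1),
      μ₀ * (a 1 (p 1) - a 1 l) + (1 - μ₀) * ∫ s, (a 0 (max l s) - a 0 l) ∂ν =
        indirect a μ₀ (max l (p μ₀)) - indirect a μ₀ l := by
    intro l hl
    have hx : max l (p μ₀) ∈ Icc (p 0) (p 1) :=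
      ⟨hl.1.trans (le_max_left _ _), max_le hl.2 (h.peak_le_one hμ)⟩
    have e : ∀ z, max l (arrival p μ₀ (p μ₀) z) = arrival p μ₀ (max l (p μ₀)) z := by
      intro z
      rw [arrival, arrival, ← max_assoc]
    have hi : IntervalIntegrable (fun z => a 0 (arrival p μ₀ (max l (p μ₀)) z)) volume 0
        (1 - μ₀) := by
      refine MonotoneOn.intervalIntegrable ?_
      rw [uIcc_of_le hc.le]
      exact (h.comp_arrival_mono hμ.1 hx (h.anti_a_zero.mono hL)).mono fun z hz => hz.1
    rw [hν' _ (boundedMeasurableOn_of_continuousOn h.peak_zero_le_one (h.continuousOn_gain hl))]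
    simp only [e]
    rw [intervalIntegral.integral_sub hi intervalIntegrable_const,
      h.integral_a_arrival hμ.1 hc.le hx]
    have e1 : arrival p μ₀ (max l (p μ₀)) (1 - μ₀) = max l (p μ₀) := by
      rw [arrival, add_sub_cancel, div_one, max_assoc, max_self]
    simp only [e1, intervalIntegral.integral_const, smul_eq_mul, sub_zero, indirect]
    ring
  refine ⟨ν, ⟨hprob, hsupp, fun l hl => ?_⟩, ?_, fun l hl => ?_, fun x y hx hxy hy h0 => ?_⟩
  · rw [hvalue l hl]
    exact sub_nonneg.2 (h.indirect_le_max hμ hl.1 ⟨le_rfl, hl.2.trans h.one_le⟩)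
  · have hg : Continuous fun s => max 0 (p μ₀ - s) := by fun_prop
    have h1 := hν' _ (hcm _ hg)
    have h2 : ∫ z in (0 : ℝ)..(1 - μ₀), max 0 (p μ₀ - arrival p μ₀ (p μ₀) z) = 0 := by
      have e : ∀ z, max 0 (p μ₀ - arrival p μ₀ (p μ₀) z) = 0 := fun z =>
        max_eq_left (sub_nonpos.2 (le_max_left _ _))
      simp only [e, intervalIntegral.integral_zero]
    rw [h2, mul_eq_zero, or_iff_right hc.ne'] at h1
    filter_upwards [hnull _ hg (fun s => le_max_left _ _) h1] with s hs
    linarith [max_eq_left_iff.1 hs]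
  · rw [hvalue l ⟨(h.le_peak_zero hμ).trans hl.1, hl.2⟩, max_eq_left hl.1, sub_self]
  -- The law is available only through its integrals, so an interval is tested with a tent function.
  -- Continuity of `p` makes the arrivals sweep through all of `[p μ₀, p 1]`, hence through the top
  -- of the tent.
  · have hg : Continuous fun s => max 0 (min (s - x) (y - s)) := by fun_prop
    have h1 := hν' _ (hcm _ hg)
    have h2 : ∫ s, max 0 (min (s - x) (y - s)) ∂ν = 0 := by
      refine integral_eq_zero_of_ae ?_
      have : ∀ᵐ s ∂ν, s ∉ Ioo x y := measure_eq_zero_iff_ae_notMem.1 h0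
      filter_upwards [this] with s hs
      refine max_eq_left ?_
      by_contra! hcon
      exact hs ⟨by linarith [(lt_min_iff.1 hcon).1], by linarith [(lt_min_iff.1 hcon).2]⟩
    have hcont : ContinuousOn (arrival p μ₀ (p μ₀)) (Icc 0 (1 - μ₀)) := by
      refine ContinuousOn.sup continuousOn_const (h.cont.comp ?_ fun z hz => div_add_mem hμ.1 hz.1)
      exact continuousOn_const.div (by fun_prop) fun z hz => by linarith [hz.1, hμ₀.1]
    have e0 : arrival p μ₀ (p μ₀) 0 = p 1 := by
      rw [arrival, add_zero, div_self hμ₀.1.ne', max_eq_right (h.peak_le_one hμ)]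
    have e1 : arrival p μ₀ (p μ₀) (1 - μ₀) = p μ₀ := by
      rw [arrival, add_sub_cancel, div_one, max_self]
    obtain ⟨z, hz, hzx⟩ := intermediate_value_Icc' hc.le hcont
      (show (x + y) / 2 ∈ Icc _ _ by rw [e0, e1]; exact ⟨by linarith, by linarith⟩)
    have h3 := intervalIntegral.integral_pos hc
      (f := fun z => max 0 (min (arrival p μ₀ (p μ₀) z - x) (y - arrival p μ₀ (p μ₀) z)))
      (hg.comp_continuousOn hcont)
      (fun z _ => le_max_left _ _) ⟨z, hz, by
        rw [hzx]
        exact lt_max_of_lt_right (lt_min (by linarith) (by linarith))⟩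
    rw [h2, mul_zero] at h1
    exact h3.ne h1

end Regular

/-- The support of the law of gradual revelation. -/
lemma Gradual.support_eq {μ₀ : ℝ} {a : Fin 2 → ℝ → ℝ} {p : ℝ → ℝ} {ν : Measure ℝ}
    (h : Gradual μ₀ a p ν) (hμ₀ : μ₀ ∈ Ioo (0 : ℝ) 1) :
    (arrivalCDF μ₀ ν).measure.support ∩ Iio (p 1) = Ico (p μ₀) (p 1) := by
  have := h.obedient.prob
  have hmeas : (arrivalCDF μ₀ ν).measure = Real.toNNReal (1 - μ₀) • ν := by
    rw [arrivalCDF, StieltjesFunction.measure_smul, measure_cdf]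
  have hc : (Real.toNNReal (1 - μ₀) : ENNReal) ≠ 0 := by
    simpa using hμ₀.2
  have hzero : ∀ A : Set ℝ, (arrivalCDF μ₀ ν).measure A = 0 ↔ ν A = 0 := by
    intro A
    rw [hmeas, Measure.smul_apply, ENNReal.smul_def, smul_eq_mul, mul_eq_zero, or_iff_right hc]
  ext x
  simp only [mem_inter_iff, mem_Iio, mem_Ico]
  refine and_congr_left fun hxT => ?_
  rw [Measure.mem_support_iff_forall]
  constructor
  · intro hx
    by_contra! hlt
    refine (hx (Iio (p μ₀)) (Iio_mem_nhds hlt)).ne' ((hzero _).2 ?_)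
    exact measure_mono_null (fun s (hs : s < p μ₀) => (not_le.2 hs : ¬ p μ₀ ≤ s)) h.ge
  · intro hx U hU
    obtain ⟨ε, hε, hsub⟩ := Metric.mem_nhds_iff.1 hU
    refine pos_iff_ne_zero.2 fun h0 => ?_
    refine h.pos x (min (x + ε) (p 1)) hx (lt_min (by linarith) hxT) (min_le_right _ _) ?_
    refine measure_mono_null (fun s hs => hsub ?_) ((hzero U).1 h0)
    have := hs.2.trans_le (min_le_left _ _)
    rw [Metric.mem_ball, Real.dist_eq, abs_lt]
    exact ⟨by linarith [hs.1], by linarith⟩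

/-! ### Comparison of expectations under a monotone ratio of slopes -/

/-- A nonnegative derivative is automatically integrable, so no bound near the endpoints is needed.
The form with `∫⁻` suits the layer-cake and Tonelli arguments. -/
lemma lintegral_deriv_eq {f : ℝ → ℝ} {A T x y : ℝ} (hf : ContinuousOn f (Icc A T))
    (hd : ∀ l ∈ Ioo A T, DifferentiableAt ℝ f l) (h0 : ∀ l ∈ Ioo A T, 0 ≤ deriv f l)
    (hx : A ≤ x) (hxy : x ≤ y) (hy : y ≤ T) :
    ∫⁻ l in Ioo x y, ENNReal.ofReal (deriv f l) = ENNReal.ofReal (f y - f x) := by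
  have hsub : Ioo x y ⊆ Ioo A T := Ioo_subset_Ioo hx hy
  have hcont := hf.mono (Icc_subset_Icc hx hy)
  have hderiv : ∀ l ∈ Ioo x y, HasDerivAt f (deriv f l) l := fun l hl =>
    (hd l (hsub hl)).hasDerivAt
  have hint : IntegrableOn (deriv f) (Ioc x y) :=
    intervalIntegral.integrableOn_deriv_of_nonneg hcont hderiv fun l hl => h0 l (hsub hl)
  have hint' : IntervalIntegrable (deriv f) volume x y :=
    (intervalIntegrable_iff_integrableOn_Ioc_of_le hxy).2 hint
  rw [← intervalIntegral.integral_eq_sub_of_hasDerivAt_of_le hxy hcont hderiv hint',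
    intervalIntegral.integral_of_le hxy, integral_Ioc_eq_integral_Ioo,
    ofReal_integral_eq_lintegral_ofReal (hint.mono_set Ioo_subset_Ioc_self)]
  exact (ae_restrict_iff' measurableSet_Ioo).2 (ae_of_all _ fun l hl => h0 l (hsub hl))

/-- If the slope of `h` relative to that of `w` is nondecreasing, then `h` is a mixture of the
functions `s ↦ w (max l s) - w l`. -/
lemma exists_mixture {w h : ℝ → ℝ} {A T : ℝ} (hAT : A ≤ T) (hw : ContinuousOn w (Icc A T))
    (hh : ContinuousOn h (Icc A T)) (hwd : ∀ l ∈ Ioo A T, DifferentiableAt ℝ w l)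
    (hhd : ∀ l ∈ Ioo A T, DifferentiableAt ℝ h l) (hw0 : ∀ l ∈ Ioo A T, 0 < deriv w l)
    (hh0 : ∀ l ∈ Ioo A T, 0 ≤ deriv h l)
    (hmono : MonotoneOn (fun l => deriv h l / deriv w l) (Ioo A T)) :
    ∃ t : ℝ → ℝ, Monotone t ∧ (∀ y, t y ∈ Icc A T) ∧ ∀ s ∈ Icc A T,
      ENNReal.ofReal (h s - h A) =
        ∫⁻ y in Ioi (0 : ℝ), ENNReal.ofReal (w (max (t y) s) - w (t y)) := by
  set c : ℝ → ℝ := fun l => deriv h l / deriv w l with hc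
  have hcm : Measurable c := (measurable_deriv h).div (measurable_deriv w)
  have hc0 : ∀ l ∈ Ioo A T, 0 ≤ c l := fun l hl => div_nonneg (hh0 l hl) (hw0 l hl).le
  -- The infimum of `Z y` is the generalized inverse of the slope ratio: the level where the ratio
  -- first exceeds `y`, with `T` as default if it never does.
  set Z : ℝ → Set ℝ := fun y => insert T {l | l ∈ Ioo A T ∧ y < c l} with hZ
  have hZA : ∀ y, ∀ l ∈ Z y, A ≤ l := by
    rintro y l (rfl | hl)
    · exact hAT
    · exact hl.1.1.le
  have hZb : ∀ y, BddBelow (Z y) := fun y => ⟨A, hZA y⟩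
  have hlt : ∀ y, ∀ l ∈ Ioo A T, sInf (Z y) < l → y < c l := by
    intro y l hl hlt
    obtain ⟨k, hk, hkl⟩ := (csInf_lt_iff (hZb y) ⟨T, mem_insert _ _⟩).1 hlt
    rcases hk with rfl | ⟨hk, hyk⟩
    · exact absurd hkl (not_lt.2 hl.2.le)
    · exact hyk.trans_le (hmono hk hl hkl.le)
  have hle : ∀ y, ∀ l ∈ Ioo A T, y < c l → sInf (Z y) ≤ l := fun y l hl hy =>
    csInf_le (hZb y) (Or.inr ⟨hl, hy⟩)
  have htT : ∀ y, sInf (Z y) ≤ T := fun y => csInf_le (hZb y) (mem_insert _ _)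
  have hAt : ∀ y, A ≤ sInf (Z y) := fun y => le_csInf ⟨T, mem_insert _ _⟩ (hZA y)
  refine ⟨fun y => sInf (Z y), fun x y hxy => ?_, fun y => ⟨hAt y, htT y⟩, fun s hs => ?_⟩
  · exact csInf_le_csInf (hZb x) ⟨T, mem_insert _ _⟩
      (insert_subset_insert fun l hl => ⟨hl.1, hxy.trans_lt hl.2⟩)
  have hsub : Ioo A s ⊆ Ioo A T := Ioo_subset_Ioo_right hs.2
  have hwm : Measurable fun l => ENNReal.ofReal (deriv w l) := (measurable_deriv w).ennreal_ofReal
  set ρ := (volume.restrict (Ioo A s)).withDensity fun l => ENNReal.ofReal (deriv w l) with hρ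
  have hac : ρ ≪ volume.restrict (Ioo A s) := withDensity_absolutelyContinuous _ _
  have e1 : ENNReal.ofReal (h s - h A) = ∫⁻ l, ENNReal.ofReal (c l) ∂ρ := by
    rw [← lintegral_deriv_eq hh hhd hh0 le_rfl hs.1 hs.2, hρ,
      lintegral_withDensity_eq_lintegral_mul _ hwm hcm.ennreal_ofReal]
    refine setLIntegral_congr_fun measurableSet_Ioo fun l hl => ?_
    have h1 := hw0 l (hsub hl)
    rw [Pi.mul_apply, ← ENNReal.ofReal_mul h1.le]
    simp only [hc]
    rw [mul_div_cancel₀ _ h1.ne']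
  have hc0' : 0 ≤ᵐ[ρ] c := hac.ae_le
    ((ae_restrict_iff' measurableSet_Ioo).2 (ae_of_all _ fun l hl => hc0 l (hsub hl)))
  -- Layer-cake formula for the ratio with respect to the measure `dw`. Monotonicity makes each
  -- superlevel set an interval up to `s`, whose `dw`-measure is an increment of `w`.
  rw [e1, lintegral_eq_lintegral_meas_lt ρ hc0' hcm.aemeasurable]
  refine lintegral_congr fun y => ?_
  have hm : MeasurableSet {l | y < c l} := measurableSet_lt measurable_const hcm
  rw [hρ, withDensity_apply _ hm, Measure.restrict_restrict hm]
  have e2 : ({l | y < c l} ∩ Ioo A s : Set ℝ) =ᵐ[volume] Ioo (sInf (Z y)) s := by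
    have hne : ∀ᵐ l ∂(volume : Measure ℝ), l ≠ sInf (Z y) :=
      measure_eq_zero_iff_ae_notMem.1 (measure_singleton (sInf (Z y)))
    filter_upwards [hne] with l hl
    refine propext ⟨fun h1 => ⟨lt_of_le_of_ne (hle y l (hsub h1.2) h1.1) hl.symm, h1.2.2⟩,
      fun h1 => ?_⟩
    have h2 : l ∈ Ioo A s := ⟨(hAt y).trans_lt h1.1, h1.2⟩
    exact ⟨hlt y l (hsub h2) h1.1, h2⟩
  rw [Measure.restrict_congr_set e2]
  rcases le_total (sInf (Z y)) s with h1 | h1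
  · rw [lintegral_deriv_eq hw hwd (fun l hl => (hw0 l hl).le) (hAt y) h1 hs.2, max_eq_right h1]
  · rw [Ioo_eq_empty (not_lt.2 h1), max_eq_left h1]
    simp

/-- If the slope of `h` relative to that of `w` is nondecreasing, then an increase of all the
expectations of `w (max l s) - w l` increases that of `h`. -/
theorem integral_le_of_ratio_mono {w h : ℝ → ℝ} {A T : ℝ} (hAT : A ≤ T)
    (hw : ContinuousOn w (Icc A T)) (hh : ContinuousOn h (Icc A T))
    (hwd : ∀ l ∈ Ioo A T, DifferentiableAt ℝ w l) (hhd : ∀ l ∈ Ioo A T, DifferentiableAt ℝ h l)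
    (hwmono : MonotoneOn w (Icc A T)) (hhmono : MonotoneOn h (Icc A T))
    (hw0 : ∀ l ∈ Ioo A T, 0 < deriv w l) (hh0 : ∀ l ∈ Ioo A T, 0 ≤ deriv h l)
    (hmono : MonotoneOn (fun l => deriv h l / deriv w l) (Ioo A T))
    {ν ν' : Measure ℝ} [IsProbabilityMeasure ν] [IsProbabilityMeasure ν']
    (hν : ∀ᵐ s ∂ν, s ∈ Icc A T) (hν' : ∀ᵐ s ∂ν', s ∈ Icc A T)
    (hle : ∀ l ∈ Icc A T, ∫ s, (w (max l s) - w l) ∂ν' ≤ ∫ s, (w (max l s) - w l) ∂ν) :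
    ∫ s, h s ∂ν' ≤ ∫ s, h s ∂ν := by
  obtain ⟨t, htm, ht, hmix⟩ := exists_mixture hAT hw hh hwd hhd hw0 hh0 hmono
  have hA : A ∈ Icc A T := ⟨le_rfl, hAT⟩
  have hint : ∀ κ : Measure ℝ, IsProbabilityMeasure κ → (∀ᵐ s ∂κ, s ∈ Icc A T) →
      ∀ f : ℝ → ℝ, ContinuousOn f (Icc A T) → Integrable f κ := fun κ _ hκ f hf =>
    (boundedMeasurableOn_of_continuousOn hAT hf).integrable_comp hAT aemeasurable_id hκ
      (ae_of_all _ fun _ => rfl)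
  have hgain : ∀ l ∈ Icc A T, ContinuousOn (fun s => w (max l s) - w l) (Icc A T) := fun l hl =>
    (hw.comp (by fun_prop) fun s hs => ⟨hl.1.trans (le_max_left _ _), max_le hl.2 hs.2⟩).sub
      continuousOn_const
  have hgain0 : ∀ l ∈ Icc A T, ∀ s ∈ Icc A T, 0 ≤ w (max l s) - w l := fun l hl s hs =>
    sub_nonneg.2 (hwmono hl ⟨hl.1.trans (le_max_left _ _), max_le hl.2 hs.2⟩ (le_max_left _ _))
  -- Integrating the mixture against a law and exchanging the integrals expresses the mean of `h`
  -- through the means that are compared in the hypothesis.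
  have hrep : ∀ κ : Measure ℝ, IsProbabilityMeasure κ → (∀ᵐ s ∂κ, s ∈ Icc A T) →
      ENNReal.ofReal (∫ s, (h s - h A) ∂κ) =
        ∫⁻ y in Ioi (0 : ℝ), ENNReal.ofReal (∫ s, (w (max (t y) s) - w (t y)) ∂κ) := by
    intro κ _ hκ
    have hm : Measurable fun q : ℝ × ℝ => ENNReal.ofReal
        (w (clamp A T (max (t q.2) q.1)) - w (clamp A T (t q.2))) := by
      have hwc := (hw.comp_continuous (continuous_clamp A T) (clamp_mem hAT)).measurable
      have htq : Measurable fun q : ℝ × ℝ => t q.2 := htm.measurable.comp measurable_snd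
      exact ((hwc.comp (htq.max measurable_fst)).sub (hwc.comp htq)).ennreal_ofReal
    have hcl : ∀ s ∈ Icc A T, ∀ y, w (clamp A T (max (t y) s)) - w (clamp A T (t y)) =
        w (max (t y) s) - w (t y) := fun s hs y => by
      rw [clamp_of_mem (ht y), clamp_of_mem ⟨(ht y).1.trans (le_max_left _ _), max_le (ht y).2 hs.2⟩]
    rw [ofReal_integral_eq_lintegral_ofReal (f := fun s => h s - h A)
      ((hint κ ‹_› hκ h hh).sub (integrable_const _))
      (hκ.mono fun s hs => sub_nonneg.2 (hhmono hA hs hs.1))]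
    calc ∫⁻ s, ENNReal.ofReal (h s - h A) ∂κ
        = ∫⁻ s, (∫⁻ y in Ioi (0 : ℝ), ENNReal.ofReal
            (w (clamp A T (max (t y) s)) - w (clamp A T (t y)))) ∂κ := by
          refine lintegral_congr_ae (hκ.mono fun s hs => ?_)
          simp only [hmix s hs, hcl s hs]
      _ = ∫⁻ y in Ioi (0 : ℝ), (∫⁻ s, ENNReal.ofReal
            (w (clamp A T (max (t y) s)) - w (clamp A T (t y))) ∂κ) :=
          lintegral_lintegral_swap hm.aemeasurable
      _ = _ := by
          refine lintegral_congr fun y => ?_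
          rw [ofReal_integral_eq_lintegral_ofReal (hint κ ‹_› hκ _ (hgain _ (ht y)))
            (hκ.mono fun s hs => hgain0 _ (ht y) s hs)]
          refine lintegral_congr_ae (hκ.mono fun s hs => ?_)
          simp only [hcl s hs]
  have hfin : ENNReal.ofReal (∫ s, (h s - h A) ∂ν') ≤ ENNReal.ofReal (∫ s, (h s - h A) ∂ν) := by
    rw [hrep ν' ‹_› hν', hrep ν ‹_› hν]
    exact lintegral_mono fun y => ENNReal.ofReal_le_ofReal (hle _ (ht y))
  have h0 : 0 ≤ ∫ s, (h s - h A) ∂ν :=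
    integral_nonneg_of_ae (hν.mono fun s hs => sub_nonneg.2 (hhmono hA hs hs.1))
  have := (ENNReal.ofReal_le_ofReal_iff h0).1 hfin
  rw [integral_sub (hint ν' ‹_› hν' h hh) (integrable_const _),
    integral_sub (hint ν ‹_› hν h hh) (integrable_const _)] at this
  simpa using this

/-! ### Optimality of gradual revelation -/

lemma AntitoneOn.deriv_nonpos {f : ℝ → ℝ} {x y l : ℝ} (hf : AntitoneOn f (Icc x y))
    (hl : l ∈ Ioo x y) : deriv f l ≤ 0 := by
  rw [← derivWithin_of_mem_nhds (Icc_mem_nhds hl.1 hl.2)]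
  exact hf.derivWithin_nonpos

namespace Regular

variable {L : ℝ} {a b : Fin 2 → ℝ → ℝ} {p : ℝ → ℝ} {R : ℝ} (h : Regular L a b p R)

include h

/-- `a 0` is nonincreasing and takes the same value at `p 1` and `R`, so a gap between them would be
an interval of zero derivative. Hence the payoff from news has no jump at `p 1`. -/
lemma eq_one_of_deriv_ne_zero (hne : ∀ l ∈ Ioo 0 L, deriv (a 0) l ≠ 0) : R = p 1 := by
  by_contra hR
  have hlt : p 1 < R := lt_of_le_of_ne h.le_R (Ne.symm hR)
  have h0 := h.nonneg.trans h.peak_zero_le_one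
  obtain ⟨l, hl⟩ := exists_between hlt
  refine hne l ⟨h0.trans_lt hl.1, hl.2.trans_le h.R_le⟩ ?_
  have hev : a 0 =ᶠ[𝓝 l] fun _ => a 0 (p 1) := by
    filter_upwards [Ioo_mem_nhds hl.1 hl.2] with s hs
    have hmem : ∀ x ∈ Icc (p 1) R, x ∈ Icc (p 0) L := fun x hx =>
      ⟨h.peak_zero_le_one.trans hx.1, hx.2.trans h.R_le⟩
    refine le_antisymm (h.anti_a_zero (hmem _ ⟨le_rfl, hlt.le⟩) (hmem _ ⟨hs.1.le, hs.2.le⟩) hs.1.le) ?_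
    rw [← h.a_R]
    exact h.anti_a_zero (hmem _ ⟨hs.1.le, hs.2.le⟩) (hmem _ ⟨hlt.le, le_rfl⟩) hs.2.le
  rw [hev.deriv_eq, deriv_const]

/-- Gradual revelation is worst for the principal if the ratio of the marginal payoffs in state `0`
is nondecreasing. -/
theorem badNewsValue_gradual_le {μ₀ : ℝ} (hμ₀ : μ₀ ∈ Ioo (0 : ℝ) 1)
    (hda : ∀ l ∈ Ioo 0 L, DifferentiableAt ℝ (a 0) l)
    (hdb : ∀ l ∈ Ioo 0 L, DifferentiableAt ℝ (b 0) l)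
    (hne : ∀ l ∈ Ioo 0 L, deriv (a 0) l ≠ 0)
    (hratio : MonotoneOn (fun l => |deriv (b 0) l / deriv (a 0) l|) (Ioo 0 L))
    {ν : Measure ℝ} (hν : Gradual μ₀ a p ν) {ν' : Measure ℝ} (hν' : Obedient μ₀ a p ν') :
    badNewsValue μ₀ b p R ν ≤ badNewsValue μ₀ b p R ν' := by
  have := hν.obedient.prob
  have := hν'.prob
  have hμ : μ₀ ∈ Icc (0 : ℝ) 1 := ⟨hμ₀.1.le, hμ₀.2.le⟩
  have hc : 0 < 1 - μ₀ := by linarith [hμ₀.2]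
  have hL : Icc (p 0) (p 1) ⊆ Icc (p 0) L := Icc_subset_Icc_right h.one_le
  have hI : Ioo (p 0) (p 1) ⊆ Ioo 0 L := Ioo_subset_Ioo h.nonneg h.one_le
  have ha0 := h.anti_a_zero.mono hL
  have hb0 := h.anti_b_zero.mono hL
  have hneg : ∀ l ∈ Ioo (p 0) (p 1), deriv (a 0) l < 0 := fun l hl =>
    lt_of_le_of_ne (AntitoneOn.deriv_nonpos ha0 hl) (hne l (hI hl))
  have hpay : ∀ κ : Measure ℝ, (∀ᵐ s ∂κ, s ∈ Icc (p 0) (p 1)) →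
      ∫ s, badNewsPayoff b p R s ∂κ = ∫ s, b 0 s ∂κ := by
    intro κ hκ
    refine integral_congr_ae (hκ.mono fun s hs => ?_)
    simp only [badNewsPayoff]
    split_ifs with h1
    · rfl
    · rw [h.eq_one_of_deriv_ne_zero hne, le_antisymm hs.2 (not_lt.1 h1)]
  have hmem := h.peak_mem hμ
  have hgain : ∀ l ∈ Icc (p 0) (p 1),
      ∫ s, (a 0 (max l s) - a 0 l) ∂ν ≤ ∫ s, (a 0 (max l s) - a 0 l) ∂ν' := by
    have hlate : ∀ l ∈ Icc (p μ₀) (p 1),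
        ∫ s, (a 0 (max l s) - a 0 l) ∂ν ≤ ∫ s, (a 0 (max l s) - a 0 l) ∂ν' := by
      intro l hl
      have h1 := hν.indifferent l hl
      have h2 := hν'.obey l ⟨hmem.1.trans hl.1, hl.2⟩
      rw [← h1, add_le_add_iff_left] at h2
      exact le_of_mul_le_mul_left h2 hc
    intro l hl
    rcases le_total (p μ₀) l with h1 | h1
    · exact hlate l ⟨h1, hl.2⟩
    -- Below `p μ₀` the constraints of `ν` need not bind. But `ν` has no arrivals there, so moving
    -- from `p μ₀` down to `l` changes its integral by the constant `a 0 (p μ₀) - a 0 l`, and that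
    -- of `ν'` by at least as much.
    · have hi : ∀ κ : Measure ℝ, IsProbabilityMeasure κ → (∀ᵐ s ∂κ, s ∈ Icc (p 0) (p 1)) →
          ∀ x ∈ Icc (p 0) (p 1), Integrable (fun s => a 0 (max x s) - a 0 x) κ :=
        fun κ _ hκ x hx => h.integrable_of_supp hκ
          (boundedMeasurableOn_of_continuousOn h.peak_zero_le_one (h.continuousOn_gain hx))
      have e0 : ∀ κ : Measure ℝ, IsProbabilityMeasure κ → (∀ᵐ s ∂κ, s ∈ Icc (p 0) (p 1)) →
          ∫ s, (a 0 (max (p μ₀) s) - a 0 (p μ₀)) ∂κ + (a 0 (p μ₀) - a 0 l) =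
            ∫ s, (a 0 (max (p μ₀) s) - a 0 (p μ₀) + (a 0 (p μ₀) - a 0 l)) ∂κ := by
        intro κ _ hκ
        rw [integral_add (hi κ ‹_› hκ _ hmem) (integrable_const _)]
        simp
      have e1 : ∫ s, (a 0 (max l s) - a 0 l) ∂ν =
          ∫ s, (a 0 (max (p μ₀) s) - a 0 (p μ₀)) ∂ν + (a 0 (p μ₀) - a 0 l) := by
        rw [e0 ν ‹_› hν.obedient.supp]
        refine integral_congr_ae (hν.ge.mono fun s hs => ?_)
        simp only [max_eq_right hs, max_eq_right (h1.trans hs)]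
        ring
      have e2 : ∫ s, (a 0 (max (p μ₀) s) - a 0 (p μ₀)) ∂ν' + (a 0 (p μ₀) - a 0 l) ≤
          ∫ s, (a 0 (max l s) - a 0 l) ∂ν' := by
        rw [e0 ν' ‹_› hν'.supp]
        refine integral_mono_ae ((hi ν' ‹_› hν'.supp _ hmem).add (integrable_const _))
          (hi ν' ‹_› hν'.supp l hl) (hν'.supp.mono fun s hs => ?_)
        have := ha0 ⟨hl.1.trans (le_max_left _ _), max_le hl.2 hs.2⟩
          ⟨hmem.1.trans (le_max_left _ _), max_le hmem.2 hs.2⟩ (max_le_max h1 (le_refl s))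
        simp only
        linarith
      rw [e1]
      exact (add_le_add_left (hlate _ ⟨le_rfl, hmem.2⟩) _).trans e2
  -- Signs are reversed to have nondecreasing functions: both parties lose from delay in state `0`,
  -- so the ratio is nonnegative and the absolute value can be dropped.
  have key := integral_le_of_ratio_mono (w := fun s => -a 0 s) (h := fun s => -b 0 s)
    h.peak_zero_le_one ((h.cont_a 0).mono hL).neg ((h.cont_b 0).mono hL).neg
    (fun l hl => (hda l (hI hl)).neg) (fun l hl => (hdb l (hI hl)).neg) ha0.neg hb0.neg
    (fun l hl => by rw [deriv.fun_neg]; linarith [hneg l hl])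
    (fun l hl => by rw [deriv.fun_neg]; linarith [AntitoneOn.deriv_nonpos hb0 hl])
    (fun x hx y hy hxy => by
      have := hratio (hI hx) (hI hy) hxy
      have e : ∀ l ∈ Ioo (p 0) (p 1), |deriv (b 0) l / deriv (a 0) l| =
          deriv (fun s => -b 0 s) l / deriv (fun s => -a 0 s) l := fun l hl => by
        rw [deriv.fun_neg, deriv.fun_neg, neg_div_neg_eq, abs_of_nonneg]
        exact div_nonneg_of_nonpos (AntitoneOn.deriv_nonpos hb0 hl) (hneg l hl).le
      simpa only [e x hx, e y hy] using this)
    hν.obedient.supp hν'.supp fun l hl => by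
      have e : ∀ κ : Measure ℝ, ∫ s, (-a 0 (max l s) - -a 0 l) ∂κ =
          -∫ s, (a 0 (max l s) - a 0 l) ∂κ := fun κ => by
        rw [← integral_neg]
        congr 1
        ext s
        ring
      rw [e, e]
      exact neg_le_neg (hgain l hl)
  rw [integral_neg, integral_neg, neg_le_neg_iff] at key
  rw [badNewsValue, badNewsValue, hpay ν hν.obedient.supp, hpay ν' hν'.supp]
  exact add_le_add le_rfl (mul_le_mul_of_nonneg_left key hc.le)

end Regular

/-! ### Indifference in the absence of bad news -/

lemma BoundedMeasurableOn.ite_lt {f : ℝ → ℝ} {A B : ℝ} (hf : BoundedMeasurableOn f A B) (l : ℝ) :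
    BoundedMeasurableOn (fun s => if l < s then f s else 0) A B := by
  obtain ⟨C, hC⟩ := hf.bounded
  refine ⟨Measurable.ite (measurableSet_lt measurable_const (continuous_clamp A B).measurable)
    hf.measurable measurable_const, C, fun s hs => ?_⟩
  split_ifs
  · exact hC s hs
  · rw [abs_zero]; exact (abs_nonneg _).trans (hC s hs)

/-- Under gradual revelation the payoffs of stopping at any `c ∈ [l, p 1]` are the same, conditional
on no bad news by `l`. -/
lemma Gradual.stop_eq {L μ₀ : ℝ} {a b : Fin 2 → ℝ → ℝ} {p : ℝ → ℝ} {R : ℝ} {ν : Measure ℝ}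
    (hν : Gradual μ₀ a p ν) (h : Regular L a b p R) {l c : ℝ}
    (hl : p μ₀ ≤ l) (hp : p 0 ≤ p μ₀) (hlc : l ≤ c) (hc : c ≤ p 1) :
    μ₀ * a 1 c + (1 - μ₀) * ∫ s, (if l < s then a 0 (min s c) else 0) ∂ν =
      μ₀ * a 1 l + (1 - μ₀) * ν.real (Ioi l) * a 0 l := by
  have := hν.obedient.prob
  have hi : ∀ x, l ≤ x → x ≤ p 1 → Integrable (fun s => a 0 (max x s) - a 0 x) ν :=
    fun x hx hx' => h.integrable_of_supp hν.obedient.supp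
      (boundedMeasurableOn_of_continuousOn h.peak_zero_le_one
        (h.continuousOn_gain ⟨hp.trans (hl.trans hx), hx'⟩))
  -- The payoff from planning `c` differs from that of stopping at `l` by the difference of the
  -- constraints at `l` and `c`, and both bind.
  have e : ∫ s, (if l < s then a 0 (min s c) else 0) ∂ν =
      ∫ s, (a 0 (max l s) - a 0 l) ∂ν - ∫ s, (a 0 (max c s) - a 0 c) ∂ν +
        ν.real (Ioi l) * a 0 l := by
    rw [← integral_sub (hi l le_rfl (hlc.trans hc)) (hi c hlc hc), ← smul_eq_mul (ν.real (Ioi l)),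
      ← setIntegral_const, ← integral_indicator measurableSet_Ioi, ← integral_add
      (f := fun s => a 0 (max l s) - a 0 l - (a 0 (max c s) - a 0 c))
      ((hi l le_rfl (hlc.trans hc)).sub (hi c hlc hc))
      ((integrable_const _).indicator measurableSet_Ioi)]
    congr 1
    ext s
    by_cases hs : l < s
    · rw [if_pos hs, indicator_of_mem (show s ∈ Ioi l from hs), max_eq_right hs.le]
      rcases le_total s c with h1 | h1
      · rw [min_eq_left h1, max_eq_left h1]; ring
      · rw [min_eq_right h1, max_eq_right h1]; ring
    · rw [if_neg hs, indicator_of_notMem (show s ∉ Ioi l from hs), max_eq_left (not_lt.1 hs),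
        max_eq_left ((not_lt.1 hs).trans hlc)]
      ring
  have h1 := hν.indifferent l ⟨hl, hlc.trans hc⟩
  have h2 := hν.indifferent c ⟨hl.trans hlc, hc⟩
  rw [e]
  linarith

namespace Setting

variable {L μ₀ : ℝ} {u v : Fin 2 → ℝ → ℝ} {φ : ℝ → EReal} {p : ℝ → ℝ} {R : ℝ}
  (S : Setting L u v φ p R) {Ω : Type w} [MeasurableSpace Ω] {M : LearningProcess L μ₀ Ω}

include S

/-- Optional sampling of payoffs on past events. -/
lemma setIntegral_indirect {τ : Ω → Level L} (hτ : M.IsOptional τ) (hadm : IsStoppingLevel φ M τ)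
    {A : Set Ω} (hA : MeasurableSet[hτ.past] A) :
    ∫ ω in A, indirect (agentNet u φ) (M.belief (τ ω) ω) (τ ω) ∂M.P =
      ∫ ω in A, indirect (agentNet u φ) (M.belief (lastLevel S.pos) ω) (τ ω) ∂M.P := by
  have := M.isProb
  obtain ⟨i1, i2, -, -⟩ := S.agentValue_eq hτ hτ.measurable_past hadm
  -- The transfer cancels between the two beliefs, so only the bounded difference of gross payoffs
  -- across states has to be sampled.
  set X : Ω → ℝ := A.indicator fun ω => u 1 (τ ω) - u 0 (τ ω) with hX
  have hXm : Measurable[hτ.past] X := Measurable.indicator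
    ((LearningProcess.measurable_comp_level (S.cont_u 1) hτ.measurable_past).sub
      (LearningProcess.measurable_comp_level (S.cont_u 0) hτ.measurable_past)) hA
  have hXi : Integrable X M.P :=
    ((LearningProcess.integrable_comp_level (S.cont_u 1) hτ.measurable).sub
      (LearningProcess.integrable_comp_level (S.cont_u 0) hτ.measurable)).indicator hA.1
  rw [← sub_eq_zero, ← integral_sub i1.integrableOn i2.integrableOn, ← integral_indicator hA.1]
  have e : (A.indicator fun ω => indirect (agentNet u φ) (M.belief (τ ω) ω) (τ ω) -
      indirect (agentNet u φ) (M.belief (lastLevel S.pos) ω) (τ ω)) =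
      fun ω => M.belief (τ ω) ω * X ω - M.belief (lastLevel S.pos) ω * X ω := by
    ext ω
    by_cases hω : ω ∈ A
    · simp only [hX, indicator_of_mem hω, indirect, agentNet]; ring
    · simp only [hX, indicator_of_notMem hω]; ring
  rw [e, integral_sub (integrable_unit_mul (hτ.measurable_belief S.pos).aemeasurable
      (ae_of_all _ fun ω => M.mem_Icc _ ω) hXi)
    (integrable_unit_mul (M.measurable_belief _).aemeasurable
      (ae_of_all _ fun ω => M.mem_Icc _ ω) hXi), hτ.integral_belief_mul S.pos hXm hXi, sub_self]

end Setting

lemma LearningProcess.measurableSet_noNews {L μ₀ : ℝ} {Ω : Type w} [MeasurableSpace Ω]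
    (M : LearningProcess L μ₀ Ω) (l : Level L) : MeasurableSet[M.nat l] (noNews M l) :=
  (M.measurable_belief_nat l (measurableSet_singleton 0)).compl

/-- Whether bad news has arrived by `l` is known from `l` on. -/
lemma LearningProcess.IsOptional.measurableSet_noNews {L μ₀ : ℝ} {Ω : Type w} [MeasurableSpace Ω]
    {M : LearningProcess L μ₀ Ω} {τ : Ω → Level L} (hτ : M.IsOptional τ) {l : Level L}
    (hle : ∀ ω, l ≤ τ ω) : MeasurableSet[hτ.past] (noNews M l) := by
  refine hτ.measurableSet_past.2 ⟨M.nat.le l _ (M.measurableSet_noNews l), fun t => ?_⟩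
  rcases lt_or_ge l t with h | h
  · exact (M.nat.mono h.le _ (M.measurableSet_noNews l)).inter (hτ t)
  · have : {ω | τ ω < t} = ∅ := by
      ext ω
      simpa using h.trans (hle ω)
    rw [this, inter_empty]
    exact @MeasurableSet.empty _ (M.nat t)

namespace IsArrival

variable {L μ₀ A B : ℝ} {ν : Measure ℝ} {Ω : Type w} [MeasurableSpace Ω]
  {M : LearningProcess L μ₀ Ω} {hL : 0 < L} {β : Ω → ℝ} (hβ : IsArrival hL M ν A B β)

include hβ

lemma mem_noNews_iff (l : Level L) : ∀ᵐ ω ∂M.P, ω ∈ noNews M l ↔ (l : ℝ) < β ω :=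
  hβ.eq_zero_iff.mono fun ω h => by
    rw [← not_le, ← h l]
    rfl

/-- Expectations of functions of the arrival level on the event that there is no bad news by `l`. -/
lemma setIntegral_ite [IsProbabilityMeasure ν] (hμ₀ : μ₀ ∈ Ioo (0 : ℝ) 1) (hAB : A ≤ B)
    {f : ℝ → ℝ} (hf : BoundedMeasurableOn f A B) (k : ℝ) (l : Level L) :
    ∫ ω in noNews M l, (if M.belief (lastLevel hL) ω = 0 then f (β ω) else k) ∂M.P =
      μ₀ * k + (1 - μ₀) * ∫ s, (if (l : ℝ) < s then f s else 0) ∂ν := by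
  rw [← (hβ.integral_ite hμ₀ hAB (hf.ite_lt l) k).2,
    ← integral_indicator (M.nat.le l _ (M.measurableSet_noNews l))]
  refine integral_congr_ae ?_
  filter_upwards [hβ.mem_noNews_iff l, hβ.lt_of_ne_zero] with ω h1 h2
  by_cases h0 : M.belief (lastLevel hL) ω = 0
  · by_cases hω : ω ∈ noNews M l
    · rw [indicator_of_mem hω, if_pos h0, if_pos h0, if_pos (h1.1 hω)]
    · rw [indicator_of_notMem hω, if_pos h0, if_neg fun h => hω (h1.2 h)]
  · rw [indicator_of_mem (h1.2 (l.2.2.trans_lt (h2 h0))), if_neg h0, if_neg h0]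

end IsArrival

namespace Setting

variable {L μ₀ : ℝ} {u v : Fin 2 → ℝ → ℝ} {φ : ℝ → EReal} {p : ℝ → ℝ} {R : ℝ}
  (S : Setting L u v φ p R) {Ω : Type w} [MeasurableSpace Ω] {M : LearningProcess L μ₀ Ω}
  {ν : Measure ℝ} {β : Ω → ℝ}

include S

/-- Under gradual revelation the agent is indifferent in the absence of bad news. -/
theorem isIndifferentAt (hμ₀ : μ₀ ∈ Ioo (0 : ℝ) 1) (hν : Gradual μ₀ (agentNet u φ) p ν)
    (hM : IsBadNews (arrivalCDF μ₀ ν) M) {l : Level L} (hl : (l : ℝ) ∈ Ico (p μ₀) (p 1)) :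
    IsIndifferentAt u φ (arrivalCDF μ₀ ν) M l := by
  have := M.isProb
  have := hν.obedient.prob
  have hreg := S.reg
  have hμ : μ₀ ∈ Icc (0 : ℝ) 1 := ⟨hμ₀.1.le, hμ₀.2.le⟩
  have h01 := hreg.peak_zero_le_one
  have hp0 : p 0 ≤ p μ₀ := hreg.le_peak_zero hμ
  have hl0 : p 0 ≤ l := hp0.trans hl.1
  obtain ⟨β, hβ⟩ := exists_isArrival hμ₀ S.pos hν.obedient.supp hreg.nonneg hreg.one_le hM
  set G := arrivalCDF μ₀ ν with hG
  set a := agentNet u φ with ha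
  set N := noNews M l with hN
  have hNm : MeasurableSet N := M.nat.le l _ (M.measurableSet_noNews l)
  have hPN : M.P.real N = 1 - G l := by
    rw [← measure_eq_zero_eq hμ₀ hM l]
    exact probReal_compl_eq_one_sub (M.measurable_belief l (measurableSet_singleton 0))
  have hq : 0 < 1 - G l := by linarith [arrivalCDF_le (ν := ν) hμ₀ (l : ℝ), hμ₀.1]
  have hcond : ∀ τ : Ω → Level L, condAgentValue u φ M l τ = (1 - G l)⁻¹ *
      ∫ ω in N, indirect a (M.belief (τ ω) ω) (τ ω) ∂M.P := by
    intro τ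
    rw [condAgentValue, ProbabilityTheory.cond, integral_smul_measure, ENNReal.toReal_inv,
      ← measureReal_def, hPN, smul_eq_mul]
    simp only [agentR_eq]
    rfl
  have hvalue : agentR u φ (noNewsBelief μ₀ G l) l =
      (1 - G l)⁻¹ * (μ₀ * a 1 l + (1 - μ₀) * ν.real (Ioi (l : ℝ)) * a 0 l) := by
    have h1 : ν.real (Ioi (l : ℝ)) = 1 - ν.real (Iic (l : ℝ)) := by
      rw [← compl_Iic, probReal_compl_eq_one_sub measurableSet_Iic]
    have h2 : G l = (1 - μ₀) * ν.real (Iic (l : ℝ)) := arrivalCDF_apply hμ₀ _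
    have h3 : (1 - μ₀) * ν.real (Ioi (l : ℝ)) = 1 - G l - μ₀ := by rw [h1, h2]; ring
    rw [agentR_eq, h3, noNewsBelief, indirect, ← ha]
    field_simp
  have hmin : ∀ c, p 0 ≤ c → BoundedMeasurableOn (fun s => a 0 (min s c)) (p 0) (p 1) :=
    fun c hc => hreg.boundedMeasurableOn_a_min hc
  have hupper : ∀ c ∈ Icc (l : ℝ) L,
      μ₀ * a 1 c + (1 - μ₀) * ∫ s, (if (l : ℝ) < s then a 0 (min s c) else 0) ∂ν ≤
        μ₀ * a 1 l + (1 - μ₀) * ν.real (Ioi (l : ℝ)) * a 0 l := by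
    intro c hc
    rcases le_or_gt c (p 1) with h1 | h1
    · exact (hν.stop_eq hreg hl.1 hp0 hc.1 h1).le
    · rw [← hν.stop_eq hreg hl.1 hp0 hl.2.le le_rfl]
      have e : ∫ s, (if (l : ℝ) < s then a 0 (min s c) else 0) ∂ν =
          ∫ s, (if (l : ℝ) < s then a 0 (min s (p 1)) else 0) ∂ν := by
        refine integral_congr_ae (hν.obedient.supp.mono fun s hs => ?_)
        simp only [min_eq_left hs.2, min_eq_left (hs.2.trans h1.le)]
      rw [e]
      have := hreg.a_one_lt ⟨h1, hc.2⟩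
      have := mul_le_mul_of_nonneg_left this.le hμ.1
      linarith
  have hne : ¬ ∀ᵐ ω ∂M.P, M.belief (lastLevel S.pos) ω = 0 := fun h => by
    have := M.prior (lastLevel S.pos)
    rw [integral_congr_ae h, integral_zero] at this
    exact hμ₀.1.ne this
  refine ⟨⟨?_, ?_⟩, ?_⟩
  · rintro x ⟨τ, hadm, hle, rfl⟩
    have hτ : M.IsOptional τ := LearningProcess.isOptional_iff.2 hadm.stopping
    obtain ⟨c, hc, hcω⟩ := S.exists_indirect_le hβ hadm
    obtain ⟨-, i2, -, -⟩ := S.agentValue_eq hτ hτ.measurable_past hadm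
    -- Without news throughout she stops at `c`. If `c` were below `l`, this event would have to be
    -- null, but then the last belief would have mean zero.
    have hlc : (l : ℝ) ≤ c := by
      by_contra! hcon
      refine hne ?_
      filter_upwards [hcω, hβ.lt_of_ne_zero] with ω h1 h2
      by_contra h0
      have := h1.1 (hc.2.trans_lt (h2 h0))
      exact absurd (show (l : ℝ) ≤ τ ω from hle ω) (by rw [this]; exact not_le.2 hcon)
    have hpc : p 0 ≤ c := hl0.trans hlc
    rw [max_eq_left hpc] at hcω
    rw [hcond, hvalue, S.setIntegral_indirect hτ hadm (hτ.measurableSet_noNews hle)]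
    refine mul_le_mul_of_nonneg_left ?_ (inv_nonneg.2 hq.le)
    refine le_trans ?_ (hupper c ⟨hlc, hc.2⟩)
    rw [← hβ.setIntegral_ite hμ₀ h01 (hmin c hpc) (a 1 c) l]
    exact setIntegral_mono_ae i2.integrableOn
      (hβ.integral_ite hμ₀ h01 (hmin c hpc) (a 1 c)).1.integrableOn (hcω.mono fun ω h => h.2.2)
  · intro y hy
    refine hy ⟨fun _ => l, ?_, fun _ => le_rfl, ?_⟩
    · refine S.isStoppingLevel (fun t => ?_) (ae_of_all _ fun _ => hl0)
      exact MeasurableSet.const _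
    · rw [hcond]
      have e : ∫ ω in N, indirect a (M.belief l ω) l ∂M.P =
          ∫ _ in N, agentR u φ (noNewsBelief μ₀ G l) l ∂M.P := by
        refine setIntegral_congr_ae hNm ?_
        filter_upwards [hM l] with ω h1 h2
        rw [agentR_eq, h1.resolve_left h2]
      rw [e, setIntegral_const, hPN, smul_eq_mul, inv_mul_cancel_left₀ hq.ne']
  · intro τ hc
    -- Two choices of the agent have equal value and each is the latest, so they agree almost
    -- surely; it is enough to know the explicit one.
    obtain ⟨σ, hσ, hσβ⟩ := S.exists_badNews_choice hβ
    obtain ⟨hcσ, -⟩ := S.isAgentChoice_badNews hμ₀ hν.obedient hβ hσ hσβ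
    have hval := le_antisymm (hc.optimal σ hcσ.admissible) (hcσ.optimal τ hc.admissible)
    have hlt : ∀ᵐ ω ∂M.P, ω ∈ N → l < τ ω ∧ indirect a (M.belief (lastLevel S.pos) ω) (τ ω) =
        if M.belief (lastLevel S.pos) ω = 0 then a 0 (min (β ω) (p 1)) else a 1 (p 1) := by
      filter_upwards [hc.latest σ hcσ.admissible hval, hcσ.latest τ hc.admissible hval.symm, hσβ,
        hβ.mem_noNews_iff l, hβ.mem, hβ.last_eq] with ω h1 h2 h3 h4 h5 h6 hω
      rw [le_antisymm h2 h1]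
      by_cases h0 : M.belief (lastLevel S.pos) ω = 0
      · have h7 := h3.1 h0
        rw [if_pos h0, h0, indirect_zero]
        refine ⟨Subtype.coe_lt_coe.1 ?_, ?_⟩
        · rw [h7]
          split_ifs
          · exact h4.1 hω
          · exact hl.2.trans_le hreg.le_R
        · rw [h7, min_eq_left (h5 h0).2]
          split_ifs with h8
          · rfl
          · rw [hreg.a_R, le_antisymm (h5 h0).2 (not_lt.1 h8)]
      · rw [if_neg h0, h6 h0, indirect_one, h3.2 h0]
        exact ⟨Subtype.coe_lt_coe.1 (by rw [h3.2 h0]; exact hl.2), rfl⟩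
    refine ⟨hlt.mono fun ω h hω => (h hω).1, ?_⟩
    have hτ : M.IsOptional τ := LearningProcess.isOptional_iff.2 hc.admissible.stopping
    -- Only after `l` is it known whether news came by `l`, so sampling is applied to `max (τ ω) l`,
    -- which agrees with `τ` almost surely when there is no such news.
    have hτ' : M.IsOptional fun ω => max (τ ω) l := by
      intro t
      have : {ω | max (τ ω) l < t} = {ω | τ ω < t} ∩ {_ω | l < t} := by ext ω; simp
      rw [this]
      exact (hτ t).inter (MeasurableSet.const _)
    have hadm' : IsStoppingLevel φ M fun ω => max (τ ω) l :=
      S.isStoppingLevel hτ' (ae_of_all _ fun ω =>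
        hl0.trans (Subtype.coe_le_coe.2 (le_max_right (τ ω) l)))
    have e1 : ∫ ω in N, indirect a (M.belief (τ ω) ω) (τ ω) ∂M.P =
        ∫ ω in N, indirect a (M.belief (max (τ ω) l) ω) (max (τ ω) l : Level L) ∂M.P := by
      refine setIntegral_congr_ae hNm (hlt.mono fun ω h hω => ?_)
      rw [max_eq_left (h hω).1.le]
    have e2 : ∫ ω in N, indirect a (M.belief (lastLevel S.pos) ω) (max (τ ω) l : Level L) ∂M.P =
        ∫ ω in N, (if M.belief (lastLevel S.pos) ω = 0 then a 0 (min (β ω) (p 1))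
          else a 1 (p 1)) ∂M.P := by
      refine setIntegral_congr_ae hNm (hlt.mono fun ω h hω => ?_)
      rw [max_eq_left (h hω).1.le, (h hω).2]
    rw [hcond, hvalue, e1, S.setIntegral_indirect hτ' hadm'
      (hτ'.measurableSet_noNews fun ω => le_max_right _ _), e2,
      hβ.setIntegral_ite hμ₀ h01 (hmin _ h01) _ l, hν.stop_eq hreg hl.1 hp0 hl.2.le le_rfl]

end Setting

end TechReg

/-! ### The theorem -/

theorem theorem2
    (L μ₀ : ℝ) (hL : 0 < L) (hμ₀ : μ₀ ∈ Set.Ioo (0 : ℝ) 1)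
    (u v : Fin 2 → ℝ → ℝ)
    (hu : ∀ θ, ContinuousOn (u θ) (Set.Icc 0 L)) (hv : ∀ θ, ContinuousOn (v θ) (Set.Icc 0 L))
    (φ : ℝ → EReal) (hφ : TechReg.IsMechanism L φ)
    (hU_peak : ∀ m ∈ Set.Icc (0 : ℝ) 1, TechReg.SinglePeaked L (TechReg.agentE u φ m))
    (hV_peak : ∀ m ∈ Set.Icc (0 : ℝ) 1, TechReg.SinglePeaked L (TechReg.principalE v φ m))
    (hU_cont : ContinuousOn (fun m => TechReg.oneShot L (TechReg.agentE u φ m)) (Set.Icc 0 1))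
    (hU_mono : MonotoneOn (fun m => TechReg.oneShot L (TechReg.agentE u φ m)) (Set.Icc 0 1))
    (hpref : TechReg.PrefersEarlierStopping L u v φ) :
    (∃ G : StieltjesFunction ℝ, TechReg.IsBadNewsCDF L μ₀ G ∧
      TechReg.IsWorstCaseBadNews.{w₁, w₂} L μ₀ u v φ G) ∧
    (TechReg.IncreasingMarginalRatio L u v φ →
      ∃ G : StieltjesFunction ℝ, TechReg.IsBadNewsCDF L μ₀ G ∧
        TechReg.IsWorstCaseBadNews.{w₁, w₂} L μ₀ u v φ G ∧
        ∃ Llow T : ℝ, T = TechReg.oneShot L (TechReg.agentE u φ 1) ∧ 0 ≤ Llow ∧ Llow ≤ T ∧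
          G.measure.support ∩ Set.Iio T = Set.Ico Llow T ∧ G T = 1 - μ₀ ∧
          ∀ l : TechReg.Level L, (l : ℝ) ∈ Set.Ico Llow T →
            ∀ (Ω : Type w₁) [MeasurableSpace Ω] (M : TechReg.LearningProcess L μ₀ Ω),
              TechReg.IsBadNews G M → TechReg.IsIndifferentAt u φ G M l) := by
  obtain ⟨R, hreg⟩ := TechReg.exists_regular hu hv hφ hU_peak hV_peak hU_cont hU_mono hpref
  have S : TechReg.Setting L u v φ (fun m => TechReg.oneShot L (TechReg.agentE u φ m)) R :=
    ⟨hL, hu, hv, hreg, fun l hl => TechReg.ne_top_of_oneShot_le hu hφ hU_peak hV_peak hpref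
        (by simp) hl,
      TechReg.continuousOn_transfer hu hv hφ hU_peak hV_peak hpref,
      fun m hm x y hx hxy hy hxt => (TechReg.agentNet_le_of_le hu hφ hU_peak hm hx hxy hy hxt).2⟩
  refine ⟨?_, fun hratio => ?_⟩
  · obtain ⟨ν, hν, hmin⟩ := hreg.exists_minimizer hμ₀
    have := hν.prob
    exact ⟨TechReg.arrivalCDF μ₀ ν, TechReg.isBadNewsCDF hμ₀ hν.supp hreg.nonneg hreg.one_le,
      S.isWorstCaseBadNews hμ₀ hν hmin⟩
  · obtain ⟨ν, hν⟩ := hreg.exists_gradual hμ₀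
    have := hν.obedient.prob
    have hμ : μ₀ ∈ Set.Icc (0 : ℝ) 1 := ⟨hμ₀.1.le, hμ₀.2.le⟩
    have ea : TechReg.agentR u φ 0 = TechReg.agentNet u φ 0 := by
      ext l; rw [TechReg.agentR_eq, TechReg.indirect_zero]
    have eb : TechReg.principalR v φ 0 = TechReg.principalNet v φ 0 := by
      ext l; rw [TechReg.principalR_eq, TechReg.indirect_zero]
    have h1 := hratio.diff_agent
    have h2 := hratio.diff_principal
    have h3 := hratio.deriv_ne_zero
    have h4 := hratio.increasing
    rw [ea] at h1 h3 h4
    rw [eb] at h2 h4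
    exact ⟨TechReg.arrivalCDF μ₀ ν,
      TechReg.isBadNewsCDF hμ₀ hν.obedient.supp hreg.nonneg hreg.one_le,
      S.isWorstCaseBadNews hμ₀ hν.obedient fun ν' hν' =>
        hreg.badNewsValue_gradual_le hμ₀ h1 h2 h3 h4 hν hν',
      TechReg.oneShot L (TechReg.agentE u φ μ₀), _, rfl,
      hreg.nonneg.trans (hreg.le_peak_zero hμ), hreg.peak_le_one hμ, hν.support_eq hμ₀,
      TechReg.arrivalCDF_of_ge hμ₀ hν.obedient.supp le_rfl,
      fun l hl Ω _ M hM => S.isIndifferentAt hμ₀ hν hM hl⟩
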